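/- Conventions. An Adams graded cdga $A$ is a nonzero unital graded-commutative differential graded $\mathbb{Q}$-algebra $A=\bigoplus_{n\in\mathbb{Z}}A^n$ with a decomposition into subcomplexes $A=\bigoplus_{r\ge 0}A(r)$ such that $A(r)\cdot A(s)\subset A(r+s)$ and $A(0)=\mathbb{Q}\cdot 1$; put $A^n(r)=A^n\cap A(r)$. It is cohomologically connected if $H^n(A)=0$ for $n<0$ and $H^0(A)=\mathbb{Q}\cdot 1$. An Adams graded dg $A$-module is a (left) dg $A$-module $M=\bigoplus_{n,s\in\mathbb{Z}}M^n(s)$ with $A^n(r)M^m(s)\subset M^{n+m}(r+s)$ and $d M^n(s)\subset M^{n+1}(s)$. Let $\mathcal{K}_A$ be the homotopy category of Adams graded dg $A$-modules (maps of bidegree $(0,0)$ modulo homotopy), triangulated by the cone sequences, and let $\mathcal{D}_A$ be its localization at the quasi-isomorphisms. A cell module is an Adams graded dg $A$-module $P$ which is free over $A$ on a bihomogeneous basis $(b_j)_{j\in J}$ such that there are $\emptyset=J_{-1}\subset J_0\subset J_1\subset\cdots$ with $J=\bigcup_n J_n$ and, for $j\in J_n$, $db_j$ is an $A$-linear combination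 of the $b_i$ with $i\in J_{n-1}$; it is finite if $J$ can be taken finite. Every object of $\mathcal{D}_A$ is isomorphic to a cell module. For a cell module $P$, let $W_nP\subset P$ be the dg submodule spanned over $A$ by the $b_j$ of Adams degree $\le n$, and let $P\otimes_A\mathbb{Q}=P/A^+P$, where $A^+=\bigoplus_{r>0}A(r)$. For $M\in\mathcal{D}_A$ put $W_nM:=W_nP$ and $M\otimes^L_A\mathbb{Q}:=P\otimes_A\mathbb{Q}$, where $P$ is a cell module isomorphic to $M$ in $\mathcal{D}_A$. Let $\mathcal{D}^{+w}_A\subset\mathcal{D}_A$ be the full subcategory of the $M$ with $W_nM\cong 0$ for some $n$, let $\mathcal{D}^f_A\subset\mathcal{D}_A$ be the full subcategory of the objects isomorphic in $\mathcal{D}_A$ to a finite cell module, and put $$\mathcal{D}_A^{\le 0}=\{M\in\mathcal{D}^{+w}_A : H^n(M\otimes^L_A\mathbb{Q})=0 \text{ for } n>0\},\qquad \mathcal{D}_A^{\ge 0}=\{M\in\mathcal{D}^{+w}_A : H^n(M\otimes^L_A\mathbb{Q})=0 \text{ for } n<0\},$$ $$\mathcal{H}_A=\{M\in\mathcal{D}^{+w}_A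 : H^n(M\otimes^L_A\mathbb{Q})=0 \text{ for } n\ne 0\}.$$ A t-structure $(\mathcal{D}^{\le 0},\mathcal{D}^{\ge 0})$ on a triangulated category $\mathcal{D}$, with $\mathcal{D}^{\le n}=\mathcal{D}^{\le 0}[-n]$ and $\mathcal{D}^{\ge n}=\mathcal{D}^{\ge 0}[-n]$, is called non-degenerate if every object of $\bigcap_{n\le 0}\mathcal{D}^{\le n}$ and every object of $\bigcap_{n\ge 0}\mathcal{D}^{\ge n}$ is zero; its heart is $\mathcal{D}^{\le 0}\cap\mathcal{D}^{\ge 0}$. Theorem. Let $A$ be a cohomologically connected Adams graded cdga. Then: 1. $\mathcal{D}^{+w}_A$ is a triangulated subcategory of $\mathcal{D}_A$, and $(\mathcal{D}_A^{\le 0},\mathcal{D}_A^{\ge 0})$ is a non-degenerate t-structure on it, with heart $\mathcal{H}_A$. 2. $\mathcal{D}^f_A$ is contained in $\mathcal{D}^{+w}_A$ and is a triangulated subcategory of $\mathcal{D}_A$, and $(\mathcal{D}^f_A\cap\mathcal{D}_A^{\le 0},\ \mathcal{D}^f_A\cap\mathcal{D}_A^{\ge 0})$ is a non-degenerate t-structure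 on it, with heart $\mathcal{H}^f_A=\mathcal{H}_A\cap\mathcal{D}^f_A$. -/

import Mathlib

open CategoryTheory CategoryTheory.Limits CategoryTheory.Pretriangulated

universe u

noncomputable section

namespace AdamsDG

/-! ### Gradings -/

/-- A criterion for a family of subgroups to give a direct sum decomposition. -/
theorem isInternal_of_proj {ι G : Type*} [DecidableEq ι] [AddCommGroup G]
    (gr : ι → AddSubgroup G) (pr : ι → G →+ G)
    (h_same : ∀ i, ∀ x ∈ gr i, pr i x = x)
    (h_diff : ∀ i j, i ≠ j → ∀ x ∈ gr j, pr i x = 0)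
    (h_sup : ∀ x, x ∈ ⨆ i, gr i) : DirectSum.IsInternal gr := by
  have key : ∀ (v : DirectSum ι fun i => gr i) (i : ι),
      pr i (DirectSum.coeAddMonoidHom gr v) = v i := by
    intro v i
    induction v using DirectSum.induction_on with
    | zero => simp
    | of j x =>
      rw [DirectSum.coeAddMonoidHom_of]
      by_cases hij : i = j
      · subst hij
        rw [h_same _ _ x.2, DirectSum.of_eq_same]
      · rw [h_diff i j hij _ x.2, DirectSum.of_eq_of_ne _ _ _ hij]
        rfl
    | add x y hx hy => simp [hx, hy]
  constructor
  · refine (injective_iff_map_eq_zero (DirectSum.coeAddMonoidHom gr)).2 fun v hv => ?_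
    ext i
    have := key v i
    rw [hv, map_zero] at this
    simpa using this.symm
  · intro x
    refine AddSubgroup.iSup_induction gr (C := fun x => ∃ a, DirectSum.coeAddMonoidHom gr a = x)
      (h_sup x) ?_ ⟨0, map_zero _⟩ ?_
    · intro i y hy
      exact ⟨DirectSum.of (fun i => gr i) i ⟨y, hy⟩, DirectSum.coeAddMonoidHom_of _ _ _⟩
    · rintro y z ⟨a, rfl⟩ ⟨b, rfl⟩
      exact ⟨a + b, map_add _ _ _⟩

/-! ### Adams graded cdgas -/

/-- An Adams graded commutative differential graded algebra over `ℚ`. The subspace `gr (n, r)`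
is the piece `A^n(r)` of cohomological degree `n` and Adams degree `r`. -/
structure AdamsCDGA where
  carrier : Type u
  [ring : Ring carrier]
  [algebra : Algebra ℚ carrier]
  [nontrivial : Nontrivial carrier]
  gr : ℤ × ℤ → Submodule ℚ carrier
  [graded : GradedAlgebra gr]
  mul_comm' : ∀ (n r m s : ℤ) (a b : carrier), a ∈ gr (n, r) → b ∈ gr (m, s) →
    a * b = (n * m).negOnePow • (b * a)
  d : carrier →ₗ[ℚ] carrier
  d_mem : ∀ (n r : ℤ) (a : carrier), a ∈ gr (n, r) → d a ∈ gr (n + 1, r)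
  d_d : ∀ a, d (d a) = 0
  leibniz : ∀ (n r : ℤ) (a b : carrier), a ∈ gr (n, r) →
    d (a * b) = d a * b + n.negOnePow • (a * d b)
  /-- `A(r) = 0` for `r < 0` -/
  adams_neg : ∀ n r : ℤ, r < 0 → gr (n, r) = ⊥
  /-- `A(0) = ℚ · 1` -/
  adams_zero : ⨆ n : ℤ, gr (n, 0) = Submodule.span ℚ {1}

attribute [instance] AdamsCDGA.ring AdamsCDGA.algebra AdamsCDGA.nontrivial AdamsCDGA.graded

namespace AdamsCDGA

variable (A : AdamsCDGA.{u})

/-- The underlying additive map of `AdamsCDGA.sgn`. -/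
def sgnAux (n : ℤ) : A.carrier →+ A.carrier :=
  (DirectSum.toAddMonoid fun p : ℤ × ℤ =>
    DistribSMul.toAddMonoidHom A.carrier (n * p.1).negOnePow |>.comp
      (A.gr p).subtype.toAddMonoidHom).comp
    (DirectSum.decomposeAddEquiv A.gr).toAddMonoidHom

theorem sgnAux_of_mem (n : ℤ) {p : ℤ × ℤ} {a : A.carrier} (ha : a ∈ A.gr p) :
    A.sgnAux n a = (n * p.1).negOnePow • a := by
  simp [sgnAux, DirectSum.decompose_of_mem A.gr ha]

@[elab_as_elim]
theorem induction {motive : A.carrier → Prop} (a : A.carrier)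
    (h : ∀ p, ∀ a ∈ A.gr p, motive a)
    (hadd : ∀ a b, motive a → motive b → motive (a + b)) : motive a :=
  DirectSum.Decomposition.inductionOn A.gr (h 0 0 (zero_mem _)) (fun {i} m => h i m m.2) hadd a

/-- The ring endomorphism of `A` multiplying an element of cohomological degree `i`
by `(-1) ^ (n * i)`. -/
def sgn (n : ℤ) : A.carrier →+* A.carrier :=
  { A.sgnAux n with
    map_one' := by
      have := A.sgnAux_of_mem n (SetLike.GradedOne.one_mem (A := A.gr))
      simpa using this
    map_mul' := by
      intro a b
      change A.sgnAux n (a * b) = A.sgnAux n a * A.sgnAux n b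
      refine A.induction a (fun p a ha => ?_) (fun a a' h h' => ?_)
      · refine A.induction b (fun q b hb => ?_) (fun b b' h h' => ?_)
        · rw [sgnAux_of_mem _ _ ha, sgnAux_of_mem _ _ hb,
            sgnAux_of_mem _ _ (SetLike.GradedMul.mul_mem ha hb)]
          rw [Prod.fst_add, mul_add, Int.negOnePow_add]
          rcases Int.units_eq_one_or (n * p.1).negOnePow with h | h <;>
            rcases Int.units_eq_one_or (n * q.1).negOnePow with h' | h' <;> simp [h, h']
        · simp [mul_add, h, h']
      · simp [add_mul, h, h'] }

theorem sgn_of_mem (n : ℤ) {p : ℤ × ℤ} {a : A.carrier} (ha : a ∈ A.gr p) :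
    A.sgn n a = (n * p.1).negOnePow • a := A.sgnAux_of_mem n ha

theorem sgn_mem (n : ℤ) {p : ℤ × ℤ} {a : A.carrier} (ha : a ∈ A.gr p) : A.sgn n a ∈ A.gr p := by
  rw [A.sgn_of_mem n ha, Units.smul_def]
  exact zsmul_mem ha _

theorem sgn_zero (a : A.carrier) : A.sgn 0 a = a :=
  A.induction a (fun p a ha => by simp [A.sgn_of_mem 0 ha]) (fun a b h h' => by simp [h, h'])

theorem sgn_add (n m : ℤ) (a : A.carrier) : A.sgn (n + m) a = A.sgn n (A.sgn m a) :=
  A.induction a (fun p a ha => by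
    rw [A.sgn_of_mem _ ha, A.sgn_of_mem n (A.sgn_mem m ha), A.sgn_of_mem m ha, add_mul,
      Int.negOnePow_add, mul_smul]) (fun a b h h' => by simp [h, h'])

theorem sgn_congr {n m : ℤ} (h : Even (n - m)) (a : A.carrier) : A.sgn n a = A.sgn m a :=
  A.induction a (fun p a ha => by
    rw [A.sgn_of_mem _ ha, A.sgn_of_mem _ ha, (Int.negOnePow_eq_iff _ _).2]
    rw [← sub_mul]
    exact h.mul_right _) (fun a b h h' => by simp [h, h'])

theorem sgn_one_sgn_one (a : A.carrier) : A.sgn 1 (A.sgn 1 a) = a := by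
  rw [← sgn_add, A.sgn_congr (m := 0) (by decide), sgn_zero]

theorem sgn_d (n : ℤ) (a : A.carrier) :
    A.sgn n (A.d a) = n.negOnePow • A.d (A.sgn n a) :=
  A.induction a (fun p a ha => by
    rw [A.sgn_of_mem n ha, A.sgn_of_mem n (A.d_mem p.1 p.2 a ha)]
    rw [mul_add, mul_one, Int.negOnePow_add, mul_comm, mul_smul]
    rcases Int.units_eq_one_or (n * p.1).negOnePow with h | h <;> simp [h]) (fun a b h h' => by simp [h, h'])

theorem leibniz' (a b : A.carrier) : A.d (a * b) = A.d a * b + A.sgn 1 a * A.d b :=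
  A.induction a (fun p a ha => by
    rw [A.leibniz p.1 p.2 a b ha, A.sgn_of_mem _ ha, one_mul]
    rcases Int.units_eq_one_or p.1.negOnePow with h | h <;> simp [h]) (fun a a' h h' => by simp [add_mul, h, h']; abel)

end AdamsCDGA

/-! ### Adams graded dg modules -/

/-- An Adams graded dg (left) module over `A`. The subgroup `gr (n, s)` is the piece `M^n(s)` of
cohomological degree `n` and Adams degree `s`. The `ℚ`-vector space structure is the restriction
of the `A`-module structure along `ℚ → A`; recall that additive maps between
`ℚ`-vector spaces are `ℚ`-linear, and that the `M^n(s)` are stable under `ℚ ⊆ A^0(0)`. -/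
structure DGMod (A : AdamsCDGA.{u}) where
  carrier : Type u
  [addCommGroup : AddCommGroup carrier]
  [module : Module A.carrier carrier]
  gr : ℤ × ℤ → AddSubgroup carrier
  isInternal : DirectSum.IsInternal gr
  smul_mem : ∀ (p q : ℤ × ℤ) (a : A.carrier) (x : carrier), a ∈ A.gr p → x ∈ gr q →
    a • x ∈ gr (p + q)
  d : carrier →+ carrier
  d_mem : ∀ (n s : ℤ) (x : carrier), x ∈ gr (n, s) → d x ∈ gr (n + 1, s)
  d_d : ∀ x, d (d x) = 0
  leibniz : ∀ (n r : ℤ) (a : A.carrier) (x : carrier), a ∈ A.gr (n, r) →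
    d (a • x) = A.d a • x + n.negOnePow • (a • d x)

attribute [instance] DGMod.addCommGroup DGMod.module

namespace DGMod

variable {A : AdamsCDGA.{u}} (M : DGMod A)

theorem leibniz' (a : A.carrier) (x : M.carrier) :
    M.d (a • x) = A.d a • x + A.sgn 1 a • M.d x :=
  A.induction a (fun p a ha => by
    rw [M.leibniz p.1 p.2 a x ha, A.sgn_of_mem _ ha, one_mul]
    rcases Int.units_eq_one_or p.1.negOnePow with h | h <;> simp [h]) (fun a a' h h' => by simp [add_smul, h, h']; abel)

/-- The projection of `M` to its piece of bidegree `p`. -/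
def pr (p : ℤ × ℤ) : M.carrier →+ M.carrier :=
  letI := M.isInternal.chooseDecomposition
  (M.gr p).subtype.comp ((DFinsupp.evalAddMonoidHom p).comp
    (DirectSum.decomposeAddEquiv M.gr).toAddMonoidHom)

theorem pr_mem (p : ℤ × ℤ) (x : M.carrier) : M.pr p x ∈ M.gr p := by
  simp only [pr, AddMonoidHom.comp_apply]
  exact SetLike.coe_mem _

theorem pr_same {p : ℤ × ℤ} {x : M.carrier} (hx : x ∈ M.gr p) : M.pr p x = x := by
  let := M.isInternal.chooseDecomposition
  exact DirectSum.decompose_of_mem_same M.gr hx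

theorem pr_diff {p q : ℤ × ℤ} (h : p ≠ q) {x : M.carrier} (hx : x ∈ M.gr q) : M.pr p x = 0 := by
  let := M.isInternal.chooseDecomposition
  exact DirectSum.decompose_of_mem_ne M.gr hx h.symm

theorem exists_sum_pr (x : M.carrier) : ∃ s : Finset (ℤ × ℤ), x = ∑ p ∈ s, M.pr p x := by
  classical
  let := M.isInternal.chooseDecomposition
  exact ⟨_, (DirectSum.sum_support_decompose M.gr x).symm⟩

@[elab_as_elim]
theorem induction {motive : M.carrier → Prop} (x : M.carrier)
    (h : ∀ p, ∀ x ∈ M.gr p, motive x)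
    (hadd : ∀ x y, motive x → motive y → motive (x + y)) : motive x :=
  letI := M.isInternal.chooseDecomposition
  DirectSum.Decomposition.inductionOn M.gr (h 0 0 (zero_mem _)) (fun {i} m => h i m m.2) hadd x

/-- Morphisms of Adams graded dg modules: `A`-linear maps of bidegree `(0, 0)` commuting with
the differentials. -/
@[ext]
structure Hom (M N : DGMod A) where
  lin : M.carrier →ₗ[A.carrier] N.carrier
  lin_mem : ∀ p, ∀ x ∈ M.gr p, lin x ∈ N.gr p
  lin_d : ∀ x, lin (M.d x) = N.d (lin x)

instance : Category (DGMod A) where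
  Hom := Hom
  id M := ⟨LinearMap.id, fun _ _ hx => hx, fun _ => rfl⟩
  comp f g := ⟨g.lin.comp f.lin, fun p x hx => g.lin_mem p _ (f.lin_mem p x hx),
    fun x => by simp [f.lin_d, g.lin_d]⟩

variable {M} {N P : DGMod A}

@[ext]
theorem hom_ext {f g : M ⟶ N} (h : ∀ x, f.lin x = g.lin x) : f = g :=
  Hom.ext (LinearMap.ext h)

@[simp] theorem id_lin (x : M.carrier) : Hom.lin (𝟙 M) x = x := rfl
@[simp] theorem comp_lin (f : M ⟶ N) (g : N ⟶ P) (x : M.carrier) :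
    (f ≫ g).lin x = g.lin (f.lin x) := rfl

instance : Zero (M ⟶ N) := ⟨⟨0, fun _ _ _ => zero_mem _, fun _ => by simp⟩⟩
instance : Add (M ⟶ N) := ⟨fun f g => ⟨f.lin + g.lin,
  fun p x hx => add_mem (f.lin_mem p x hx) (g.lin_mem p x hx),
  fun x => by simp [f.lin_d, g.lin_d]⟩⟩
instance : Neg (M ⟶ N) := ⟨fun f => ⟨-f.lin, fun p x hx => neg_mem (f.lin_mem p x hx),
  fun x => by simp [f.lin_d]⟩⟩

@[simp] theorem zero_lin (x : M.carrier) : Hom.lin (0 : M ⟶ N) x = 0 := rfl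
@[simp] theorem add_lin (f g : M ⟶ N) (x : M.carrier) : (f + g).lin x = f.lin x + g.lin x := rfl
@[simp] theorem neg_lin (f : M ⟶ N) (x : M.carrier) : (-f).lin x = -f.lin x := rfl

instance : AddCommGroup (M ⟶ N) where
  add_assoc f g h := by ext x; simp [add_assoc]
  zero_add f := by ext x; simp
  add_zero f := by ext x; simp
  nsmul := nsmulRec
  zsmul := zsmulRec
  neg_add_cancel f := by ext x; simp
  add_comm f g := by ext x; simp [add_comm]

instance : Preadditive (DGMod A) where
  add_comp _ _ _ f g h := by ext x; simp
  comp_add _ _ _ f g h := by ext x; simp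

/-! ### Shifts -/

theorem units_smul_eq {B G : Type*} [Ring B] [AddCommGroup G] [Module B G] (e : ℤˣ) (b : B)
    (x : G) : (e • b) • x = e • (b • x) := by
  rcases Int.units_eq_one_or e with h | h <;> simp [h]

theorem smul_units_eq {B G : Type*} [Ring B] [AddCommGroup G] [Module B G] (e : ℤˣ) (b : B)
    (x : G) : b • (e • x) = e • (b • x) := by
  rcases Int.units_eq_one_or e with h | h <;> simp [h]

theorem leibniz_of {G : Type*} [AddCommGroup G] [Module A.carrier G] (d : G → G)
    (h : ∀ (a : A.carrier) (x : G), d (a • x) = A.d a • x + A.sgn 1 a • d x)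
    (n r : ℤ) (a : A.carrier) (x : G) (ha : a ∈ A.gr (n, r)) :
    d (a • x) = A.d a • x + n.negOnePow • (a • d x) := by
  rw [h, A.sgn_of_mem 1 ha, one_mul, units_smul_eq]

/-- The shift `M[n]`: `M[n]^m(s) = M^{m+n}(s)`, with differential `(-1)^n d`. As usual for left
modules, an element `a` of degree `i` acts on `M[n]` as `(-1)^{ni} a` acts on `M`. -/
def shift (M : DGMod A) (n : ℤ) : DGMod A where
  carrier := M.carrier
  module := Module.compHom M.carrier (A.sgn n)
  gr p := M.gr (p.1 + n, p.2)
  isInternal := by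
    refine isInternal_of_proj _ (fun p => M.pr (p.1 + n, p.2)) (fun p x hx => M.pr_same hx)
      (fun p q h x hx => M.pr_diff ?_ hx) (fun x => ?_)
    · intro h'
      apply h
      simp only [Prod.mk.injEq, add_left_inj] at h'
      exact Prod.ext h'.1 h'.2
    · refine M.induction x (fun p x hx => ?_) (fun x y hx hy => add_mem hx hy)
      refine AddSubgroup.mem_iSup_of_mem (p.1 - n, p.2) ?_
      simpa using hx
  smul_mem p q a x ha hx := by
    have := M.smul_mem p (q.1 + n, q.2) (A.sgn n a) x (A.sgn_mem n ha) hx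
    change A.sgn n a • x ∈ M.gr (p.1 + q.1 + n, p.2 + q.2)
    rwa [show p + (q.1 + n, q.2) = (p.1 + q.1 + n, p.2 + q.2) from
      Prod.ext (add_assoc _ _ _).symm rfl] at this
  d := (DistribSMul.toAddMonoidHom M.carrier n.negOnePow).comp M.d
  d_mem m s x hx := by
    have := M.d_mem (m + n) s x hx
    rw [add_right_comm] at this
    exact zsmul_mem this (n.negOnePow : ℤ)
  d_d x := by
    simp [Units.smul_def, M.d_d]
  leibniz := by
    refine @leibniz_of A M.carrier _ (Module.compHom M.carrier (A.sgn n))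
      (fun x => n.negOnePow • M.d x) fun a x => ?_
    change n.negOnePow • M.d (A.sgn n a • x) =
      A.sgn n (A.d a) • x + A.sgn n (A.sgn 1 a) • n.negOnePow • M.d x
    rw [M.leibniz', A.sgn_d, units_smul_eq, smul_units_eq, ← A.sgn_add, ← A.sgn_add, add_comm n 1,
      smul_add]

theorem lin_units_smul {M N : DGMod A} (f : M ⟶ N) (e : ℤˣ) (x : M.carrier) :
    f.lin (e • x) = e • f.lin x := by
  rcases Int.units_eq_one_or e with h | h <;> simp [h]

/-- The shift functor on dg modules. -/
def shiftF (A : AdamsCDGA.{u}) (n : ℤ) : DGMod A ⥤ DGMod A where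
  obj M := M.shift n
  map {M N} f :=
    { lin :=
        { toFun := f.lin
          map_add' := f.lin.map_add
          map_smul' := fun a x => f.lin.map_smul (A.sgn n a) x }
      lin_mem := fun p x hx => f.lin_mem _ x hx
      lin_d := fun x => (lin_units_smul f _ _).trans (congrArg _ (f.lin_d x)) }

/-- The isomorphism `M[0] ≅ M`. -/
def shiftZero (M : DGMod A) : M.shift 0 ≅ M where
  hom :=
    { lin :=
        { toFun := fun x => x
          map_add' := fun _ _ => rfl
          map_smul' := fun a x => congrArg (fun b : A.carrier => b • (show M.carrier from x)) (A.sgn_zero a) }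
      lin_mem := fun p x hx => by
        change x ∈ M.gr (p.1 + 0, p.2) at hx
        change x ∈ M.gr p
        rwa [add_zero] at hx
      lin_d := fun x => one_smul ℤˣ (M.d x) }
  inv :=
    { lin :=
        { toFun := fun x => x
          map_add' := fun _ _ => rfl
          map_smul' := fun a x => congrArg (fun b : A.carrier => b • (show M.carrier from x)) (A.sgn_zero a).symm }
      lin_mem := fun p x hx => by
        change x ∈ M.gr p at hx
        change x ∈ M.gr (p.1 + 0, p.2)
        rwa [add_zero]
      lin_d := fun x => (one_smul ℤˣ (M.d x)).symm }
  hom_inv_id := rfl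
  inv_hom_id := rfl

/-- The isomorphism `M[n + m] ≅ M[n][m]`. -/
def shiftAdd (M : DGMod A) (n m : ℤ) : M.shift (n + m) ≅ (M.shift n).shift m where
  hom :=
    { lin :=
        { toFun := fun x => x
          map_add' := fun _ _ => rfl
          map_smul' := fun a x =>
            congrArg (fun b : A.carrier => b • (show M.carrier from x)) (A.sgn_add n m a) }
      lin_mem := fun p x hx => by
        change x ∈ M.gr _ at hx
        change x ∈ M.gr _
        rwa [add_comm n m, ← add_assoc] at hx
      lin_d := fun x => by
        change (n + m).negOnePow • M.d x = m.negOnePow • n.negOnePow • M.d x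
        rw [smul_smul, add_comm, Int.negOnePow_add] }
  inv :=
    { lin :=
        { toFun := fun x => x
          map_add' := fun _ _ => rfl
          map_smul' := fun a x =>
            congrArg (fun b : A.carrier => b • (show M.carrier from x)) (A.sgn_add n m a).symm }
      lin_mem := fun p x hx => by
        change x ∈ M.gr _ at hx
        change x ∈ M.gr _
        rwa [add_comm n m, ← add_assoc]
      lin_d := fun x => by
        change m.negOnePow • n.negOnePow • M.d x = (n + m).negOnePow • M.d x
        rw [smul_smul, add_comm, Int.negOnePow_add] }
  hom_inv_id := rfl
  inv_hom_id := rfl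

theorem eq_eqToHom_comp {M N : DGMod A} {n m : ℤ} (h : n = m)
    (h' : (shiftF A n).obj M = (shiftF A m).obj M) (f : (shiftF A m).obj M ⟶ N)
    (g : (shiftF A n).obj M ⟶ N)
    (hfg : ∀ x : M.carrier, Hom.lin g x = Hom.lin f x) : g = eqToHom h' ≫ f := by
  subst h
  rw [eqToHom_refl, Category.id_comp]
  exact hom_ext hfg

instance : HasShift (DGMod A) ℤ := hasShiftMk _ _
  { F := shiftF A
    zero := NatIso.ofComponents shiftZero (fun _ => rfl)
    add := fun n m => NatIso.ofComponents (fun M => shiftAdd M n m) (fun _ => rfl)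
    assoc_hom_app := fun n m k _ => eq_eqToHom_comp (add_assoc n m k) _ _ _ (fun _ => rfl)
    zero_add_hom_app := fun n _ => eq_eqToHom_comp (zero_add n) _ _ _ (fun _ => rfl)
    add_zero_hom_app := fun n _ => eq_eqToHom_comp (add_zero n) _ _ _ (fun _ => rfl) }

instance (n : ℤ) : (shiftFunctor (DGMod A) n).Additive where
  map_add := rfl

/-- The zero module. -/
def zeroMod (A : AdamsCDGA.{u}) : DGMod A where
  carrier := PUnit
  gr _ := ⊤
  isInternal := isInternal_of_proj _ 0 (fun _ _ _ => rfl) (fun _ _ _ _ _ => rfl)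
    (fun _ => AddSubgroup.mem_iSup_of_mem 0 trivial)
  smul_mem _ _ _ _ _ _ := trivial
  d := 0
  d_mem _ _ _ _ := trivial
  d_d _ := rfl
  leibniz _ _ _ _ _ := rfl

instance : HasZeroObject (DGMod A) :=
  ⟨zeroMod A, (IsZero.iff_id_eq_zero _).2 (by ext x; rfl)⟩

/-! ### The homotopy category -/

/-- A homotopy between `f` and `g`: a map `h` of degree `-1` and Adams degree `0`, `A`-linear in
the graded sense, whose differential `d ∘ h + h ∘ d` is `f - g`. -/
structure Htpy {M N : DGMod A} (f g : M ⟶ N) where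
  h : M.carrier →+ N.carrier
  h_mem : ∀ (n s : ℤ) (x : M.carrier), x ∈ M.gr (n, s) → h x ∈ N.gr (n - 1, s)
  h_smul : ∀ (n r : ℤ) (a : A.carrier) (x : M.carrier), a ∈ A.gr (n, r) →
    h (a • x) = n.negOnePow • (a • h x)
  comm : ∀ x, f.lin x - g.lin x = N.d (h x) + h (M.d x)

theorem Htpy.h_smul' {M N : DGMod A} {f g : M ⟶ N} (H : Htpy f g) (a : A.carrier)
    (x : M.carrier) : H.h (a • x) = A.sgn 1 a • H.h x :=
  A.induction a (fun p a ha => by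
    rw [H.h_smul p.1 p.2 a x ha, A.sgn_of_mem 1 ha, one_mul, units_smul_eq])
    (fun a b h h' => by simp [add_smul, h, h'])

/-- Construct a homotopy from the global form of graded linearity. -/
def Htpy.mk' {M N : DGMod A} {f g : M ⟶ N} (h : M.carrier →+ N.carrier)
    (h_mem : ∀ (n s : ℤ) (x : M.carrier), x ∈ M.gr (n, s) → h x ∈ N.gr (n - 1, s))
    (h_smul : ∀ (a : A.carrier) (x : M.carrier), h (a • x) = A.sgn 1 a • h x)
    (comm : ∀ x, f.lin x - g.lin x = N.d (h x) + h (M.d x)) : Htpy f g where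
  h := h
  h_mem := h_mem
  h_smul n r a x ha := by rw [h_smul, A.sgn_of_mem 1 ha, one_mul, units_smul_eq]
  comm := comm

/-- The homotopy relation. -/
def htpyRel (A : AdamsCDGA.{u}) : HomRel (DGMod A) := fun _ _ f g => Nonempty (Htpy f g)

theorem htpyRel_add {M N : DGMod A} {f f' g g' : M ⟶ N} (h : htpyRel A f f')
    (h' : htpyRel A g g') : htpyRel A (f + g) (f' + g') := by
  obtain ⟨h⟩ := h
  obtain ⟨h'⟩ := h'
  refine ⟨Htpy.mk' (h.h + h'.h) (fun n s x hx => add_mem (h.h_mem n s x hx) (h'.h_mem n s x hx))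
    (fun a x => by simp [h.h_smul', h'.h_smul']) (fun x => ?_)⟩
  have h1 := h.comm x
  have h2 := h'.comm x
  simp only [add_lin, AddMonoidHom.add_apply, map_add]
  rw [add_sub_add_comm, h1, h2]
  abel

instance : Congruence (htpyRel A) where
  equivalence :=
    { refl := fun f => ⟨Htpy.mk' 0 (fun _ _ _ _ => zero_mem _) (by simp) (by simp)⟩
      symm := by
        rintro f g ⟨h⟩
        refine ⟨Htpy.mk' (-h.h) (fun n s x hx => neg_mem (h.h_mem n s x hx))
          (by simp [h.h_smul']) (fun x => ?_)⟩
        rw [← neg_sub, h.comm x]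
        simp [add_comm]
      trans := by
        rintro f g k ⟨h⟩ ⟨h'⟩
        refine ⟨Htpy.mk' (h.h + h'.h)
          (fun n s x hx => add_mem (h.h_mem n s x hx) (h'.h_mem n s x hx))
          (fun a x => by simp [h.h_smul', h'.h_smul']) (fun x => ?_)⟩
        rw [← sub_add_sub_cancel _ (g.lin x), h.comm x, h'.comm x]
        simp only [AddMonoidHom.add_apply, map_add]
        abel }
  comp_left := by
    rintro X Y Z f g g' ⟨h⟩
    exact ⟨Htpy.mk' (h.h.comp f.lin.toAddMonoidHom)
      (fun n s x hx => h.h_mem n s _ (f.lin_mem _ x hx))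
      (fun a x => by simp [h.h_smul'])
      (fun x => by simpa [f.lin_d] using h.comm (f.lin x))⟩
  comp_right := by
    rintro X Y Z f f' g ⟨h⟩
    exact ⟨Htpy.mk' (g.lin.toAddMonoidHom.comp h.h)
      (fun n s x hx => g.lin_mem _ _ (h.h_mem n s x hx))
      (fun a x => by simp [h.h_smul'])
      (fun x => by simpa [g.lin_d] using congrArg g.lin (h.comm x))⟩

instance : (htpyRel A).IsCompatibleWithShift ℤ where
  condition := by
    rintro n M N f g ⟨h⟩
    refine ⟨Htpy.mk' (M := M.shift n) (N := N.shift n) (f := f⟦n⟧') (g := g⟦n⟧')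
      ((DistribSMul.toAddMonoidHom N.carrier n.negOnePow).comp h.h)
      (fun m s x hx => ?_) (fun a x => ?_) (fun x => ?_)⟩
    · have := h.h_mem (m + n) s x hx
      rw [add_sub_right_comm] at this
      exact zsmul_mem this (n.negOnePow : ℤ)
    · have key : ∀ x : M.carrier, n.negOnePow • h.h (A.sgn n a • x) =
          A.sgn n (A.sgn 1 a) • n.negOnePow • h.h x := fun x => by
        rw [h.h_smul', smul_units_eq, ← A.sgn_add, ← A.sgn_add, add_comm]
      exact key x
    · change f.lin x - g.lin x = n.negOnePow • N.d (n.negOnePow • h.h x) +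
        n.negOnePow • h.h (n.negOnePow • M.d x)
      rw [h.comm x]
      rcases Int.units_eq_one_or n.negOnePow with h | h <;> simp [h]

end DGMod

open DGMod

/-- The homotopy category `K_A` of Adams graded dg `A`-modules. -/
abbrev KCat (A : AdamsCDGA.{u}) := Quotient (htpyRel A)

variable {A : AdamsCDGA.{u}}

instance : Preadditive (KCat A) := Quotient.preadditive _ fun _ _ _ _ _ _ => htpyRel_add

/-- The quotient functor from dg modules to the homotopy category. -/
abbrev toK (A : AdamsCDGA.{u}) : DGMod A ⥤ KCat A := Quotient.functor (htpyRel A)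

instance : (toK A).Additive := Quotient.functor_additive _ fun _ _ _ _ _ _ => htpyRel_add

instance : HasZeroObject (KCat A) := (toK A).hasZeroObject_of_additive

instance (n : ℤ) : (shiftFunctor (KCat A) n).Additive := by
  have : (toK A ⋙ shiftFunctor (KCat A) n).Additive :=
    Functor.additive_of_iso ((toK A).commShiftIso n)
  exact Functor.additive_of_full_essSurj_comp (toK A) _

theorem toK_map_eq {M N : DGMod A} {f g : M ⟶ N} (h : Htpy f g) :
    (toK A).map f = (toK A).map g := CategoryTheory.Quotient.sound _ ⟨h⟩

theorem toK_htpy {M N : DGMod A} {f g : M ⟶ N} (h : (toK A).map f = (toK A).map g) :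
    Nonempty (Htpy f g) := (Quotient.functor_map_eq_iff (htpyRel A) f g).1 h

/-! ### Cones -/

namespace DGMod

/-- The cone of a morphism, with underlying bigraded module `N ⊕ M[1]` and differential
`d(n, m) = (dn + f(m), -dm)`. -/
def cone {M N : DGMod A} (f : M ⟶ N) : DGMod A where
  carrier := N.carrier × (M.shift 1).carrier
  gr p := (N.gr p).prod ((M.shift 1).gr p)
  isInternal := by
    refine isInternal_of_proj _ (fun p => (N.pr p).prodMap ((M.shift 1).pr p))
      (fun p x hx => ?_) (fun p q h x hx => ?_) (fun x => ?_)
    · exact Prod.ext (N.pr_same hx.1) ((M.shift 1).pr_same hx.2)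
    · exact Prod.ext (N.pr_diff h hx.1) ((M.shift 1).pr_diff h hx.2)
    · have hx : x = (x.1, 0) + (0, x.2) := by simp
      rw [hx]
      refine add_mem ?_ ?_
      · refine N.induction x.1 (fun p y hy => ?_) (fun y z hy hz => ?_)
        · exact AddSubgroup.mem_iSup_of_mem p ⟨hy, zero_mem _⟩
        · simpa using add_mem hy hz
      · refine (M.shift 1).induction x.2 (fun p y hy => ?_) (fun y z hy hz => ?_)
        · exact AddSubgroup.mem_iSup_of_mem p ⟨zero_mem _, hy⟩
        · simpa using add_mem hy hz
  smul_mem p q a x ha hx := ⟨N.smul_mem p q a _ ha hx.1, (M.shift 1).smul_mem p q a _ ha hx.2⟩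
  d :=
    { toFun := fun x => (N.d x.1 + f.lin x.2, (M.shift 1).d x.2)
      map_zero' := by
        refine Prod.ext ?_ (map_zero _)
        exact (congrArg₂ (· + ·) (map_zero N.d) (map_zero f.lin)).trans (add_zero _)
      map_add' := fun x y => by
        refine Prod.ext ?_ (map_add (M.shift 1).d x.2 y.2)
        exact (congrArg₂ (· + ·) (map_add N.d x.1 y.1) (map_add f.lin x.2 y.2)).trans
          (add_add_add_comm _ _ _ _) }
  d_mem n s x hx :=
    ⟨add_mem (N.d_mem n s _ hx.1) (f.lin_mem _ _ hx.2), (M.shift 1).d_mem n s _ hx.2⟩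
  d_d x := by
    refine Prod.ext ?_ ((M.shift 1).d_d x.2)
    have key : ∀ (y : N.carrier) (x : M.carrier),
        N.d (N.d y + f.lin x) + f.lin ((1 : ℤ).negOnePow • M.d x) = 0 := fun y x => by
      rw [lin_units_smul, f.lin_d]
      simp [N.d_d]
    exact key x.1 x.2
  leibniz := by
    refine leibniz_of _ fun a x => Prod.ext ?_ ((M.shift 1).leibniz' a x.2)
    have key : ∀ (y : N.carrier) (x : M.carrier), N.d (a • y) + f.lin (A.sgn 1 a • x) =
        A.d a • y + A.sgn 1 a • (N.d y + f.lin x) := fun y x => by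
      rw [N.leibniz', smul_add, add_assoc, f.lin.map_smul]
    exact key x.1 x.2

theorem cone_d {M N : DGMod A} (f : M ⟶ N) (y : N.carrier) (x : M.carrier) :
    (cone f).d (y, x) = (N.d y + f.lin x, -M.d x) := by
  refine Prod.ext rfl ?_
  change (1 : ℤ).negOnePow • M.d x = -M.d x
  simp

/-- The inclusion `N ⟶ Cone(f)`. -/
def coneInl {M N : DGMod A} (f : M ⟶ N) : N ⟶ cone f where
  lin := LinearMap.inl A.carrier N.carrier (M.shift 1).carrier
  lin_mem p x hx := ⟨hx, zero_mem _⟩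
  lin_d x := by
    refine Eq.trans ?_ (cone_d f x 0).symm
    rw [map_zero, map_zero, add_zero, neg_zero]
    rfl

/-- The projection `Cone(f) ⟶ M[1]`. -/
def coneSnd {M N : DGMod A} (f : M ⟶ N) : cone f ⟶ M⟦(1 : ℤ)⟧ where
  lin := LinearMap.snd A.carrier N.carrier (M.shift 1).carrier
  lin_mem _ _ hx := hx.2
  lin_d _ := rfl

/-- The cone sequence `M ⟶ N ⟶ Cone(f) ⟶ M[1]`. -/
abbrev coneTriangle {M N : DGMod A} (f : M ⟶ N) : Triangle (DGMod A) :=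
  Triangle.mk f (coneInl f) (coneSnd f)

end DGMod

namespace DGMod

/-- Constructor for morphisms. -/
def mkHom {M N : DGMod A} (φ : M.carrier → N.carrier)
    (h_add : ∀ x y, φ (x + y) = φ x + φ y)
    (h_smul : ∀ (a : A.carrier) x, φ (a • x) = a • φ x)
    (h_mem : ∀ p, ∀ x ∈ M.gr p, φ x ∈ N.gr p)
    (h_d : ∀ x, φ (M.d x) = N.d (φ x)) : M ⟶ N :=
  ⟨⟨⟨φ, h_add⟩, h_smul⟩, h_mem, h_d⟩

/-- The map of cones induced by a square which commutes up to homotopy. -/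
def coneMap {M N M' N' : DGMod A} {f : M ⟶ N} {f' : M' ⟶ N'} (a : M ⟶ M') (b : N ⟶ N')
    (h : Htpy (f ≫ b) (a ≫ f')) : cone f ⟶ cone f' :=
  mkHom (fun x => (b.lin x.1 + h.h x.2, a.lin x.2))
    (fun x y => by
      refine Prod.ext ?_ (a.lin.map_add x.2 y.2)
      exact (congrArg₂ (· + ·) (map_add b.lin x.1 y.1) (map_add h.h x.2 y.2)).trans
          (add_add_add_comm _ _ _ _))
    (fun c x => by
      refine Prod.ext ?_ (a.lin.map_smul (A.sgn 1 c) x.2)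
      have key : ∀ (y : N.carrier) (x : M.carrier), b.lin (c • y) + h.h (A.sgn 1 c • x) =
          c • (b.lin y + h.h x) := fun y x => by
        rw [h.h_smul', A.sgn_one_sgn_one, smul_add, b.lin.map_smul]
      exact key x.1 x.2)
    (fun p x hx => by
      refine ⟨add_mem (b.lin_mem p _ hx.1) ?_, a.lin_mem _ _ hx.2⟩
      have := h.h_mem (p.1 + 1) p.2 _ hx.2
      rwa [add_sub_cancel_right] at this)
    (fun x => by
      refine Prod.ext ?_ ?_
      · have key : ∀ (y : N.carrier) (x : M.carrier),
            b.lin (N.d y + f.lin x) + h.h ((1 : ℤ).negOnePow • M.d x) =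
            N'.d (b.lin y + h.h x) + f'.lin (a.lin x) := fun y x => by
          have := h.comm x
          simp only [comp_lin] at this
          rw [sub_eq_iff_eq_add] at this
          simp [this, b.lin_d]
          abel
        exact key x.1 x.2
      · exact (lin_units_smul a _ _).trans (congrArg _ (a.lin_d x.2)))

theorem coneInl_coneMap {M N M' N' : DGMod A} {f : M ⟶ N} {f' : M' ⟶ N'} (a : M ⟶ M')
    (b : N ⟶ N') (h : Htpy (f ≫ b) (a ≫ f')) :
    coneInl f ≫ coneMap a b h = b ≫ coneInl f' := by
  ext x
  refine Prod.ext ?_ (map_zero a.lin)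
  exact (congrArg (b.lin x + ·) (map_zero h.h)).trans (add_zero _)

theorem coneMap_coneSnd {M N M' N' : DGMod A} {f : M ⟶ N} {f' : M' ⟶ N'} (a : M ⟶ M')
    (b : N ⟶ N') (h : Htpy (f ≫ b) (a ≫ f')) :
    coneMap a b h ≫ coneSnd f' = coneSnd f ≫ a⟦(1 : ℤ)⟧' := rfl

theorem isIso_toK {M N : DGMod A} (s : M ⟶ N) (r : N ⟶ M) (h : Htpy (s ≫ r) (𝟙 M))
    (h' : Htpy (𝟙 N) (r ≫ s)) : IsIso ((toK A).map s) :=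
  ⟨(toK A).map r, by rw [← Functor.map_comp, toK_map_eq h, (toK A).map_id],
    by rw [← Functor.map_comp, ← toK_map_eq h', (toK A).map_id]⟩

/-- Equal morphisms are homotopic. -/
def Htpy.ofEq {M N : DGMod A} {f g : M ⟶ N} (h : f = g) : Htpy f g :=
  Htpy.mk' 0 (fun _ _ _ _ => zero_mem _) (by simp) (by simp [h])

/-- The cone of the identity is contractible. -/
def coneIdHtpy (M : DGMod A) : Htpy (𝟙 (cone (𝟙 M))) 0 :=
  Htpy.mk' (M := cone (𝟙 M)) (N := cone (𝟙 M))
    { toFun := fun x => (0, x.1)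
      map_zero' := rfl
      map_add' := fun x y => Prod.ext (add_zero (0 : M.carrier)).symm rfl }
    (fun n s x hx => by
      refine ⟨zero_mem _, ?_⟩
      change x.1 ∈ M.gr (n - 1 + 1, s)
      rw [sub_add_cancel]
      exact hx.1)
    (fun a x => Prod.ext (smul_zero (A.sgn 1 a : A.carrier) (A := M.carrier)).symm (by
      have key : ∀ (y : M.carrier), a • y = A.sgn 1 (A.sgn 1 a) • y := fun y => by
        rw [A.sgn_one_sgn_one]
      exact key x.1))
    (fun x => by
      have key : ∀ (y x : M.carrier), ((y, x) : M.carrier × M.carrier) - (0, 0) =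
          (M.d 0 + y, (1 : ℤ).negOnePow • M.d y) + (0, M.d y + x) := fun y x => by
        simp
      exact key x.1 x.2)

/-! #### Rotation -/

/-- The map `M[1] ⟶ Cone(N ⟶ Cone(f))`. -/
def rotS {M N : DGMod A} (f : M ⟶ N) : M.shift 1 ⟶ cone (coneInl f) :=
  mkHom (N := cone (coneInl f)) (fun x => ((0, x), - f.lin x))
    (fun x y => by
      refine Prod.ext (Prod.ext (add_zero (0 : N.carrier)).symm rfl) ?_
      exact (congrArg Neg.neg (map_add f.lin x y)).trans (neg_add _ _))
    (fun c x => by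
      refine Prod.ext (Prod.ext (smul_zero (A := N.carrier) c).symm rfl) ?_
      have key : ∀ (x : M.carrier), - f.lin (A.sgn 1 c • x) = A.sgn 1 c • - f.lin x := fun x => by
        simp
      exact key x)
    (fun p x hx => ⟨⟨zero_mem _, hx⟩, AddSubgroup.neg_mem (N.gr _) (f.lin_mem _ x hx)⟩)
    (fun x => by
      have key : ∀ (x : M.carrier), (((0, (1 : ℤ).negOnePow • M.d x),
          - f.lin ((1 : ℤ).negOnePow • M.d x)) : (N.carrier × M.carrier) × N.carrier) =
          ((N.d 0 + f.lin x, (1 : ℤ).negOnePow • M.d x) + (- f.lin x, 0),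
            (1 : ℤ).negOnePow • N.d (- f.lin x)) := fun x => by
        simp [f.lin_d]
      exact key x)

/-- The map `Cone(N ⟶ Cone(f)) ⟶ M[1]`. -/
def rotR {M N : DGMod A} (f : M ⟶ N) : cone (coneInl f) ⟶ M.shift 1 :=
  mkHom (M := cone (coneInl f)) (fun x => x.1.2) (fun _ _ => rfl) (fun _ _ => rfl)
    (fun _ _ hx => hx.1.2) (fun x => by
      have key : ∀ (x : M.carrier), (1 : ℤ).negOnePow • M.d x + 0 = (1 : ℤ).negOnePow • M.d x :=
        fun x => by simp
      exact key x.1.2)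

/-- `Cone(N ⟶ Cone(f))` is homotopy equivalent to `M[1]`. -/
def rotHtpy {M N : DGMod A} (f : M ⟶ N) : Htpy (𝟙 _) (rotR f ≫ rotS f) :=
  Htpy.mk' (M := cone (coneInl f)) (N := cone (coneInl f))
    { toFun := fun x => ((0, 0), x.1.1)
      map_zero' := rfl
      map_add' := fun x y =>
        Prod.ext (Prod.ext (add_zero (0 : N.carrier)).symm (add_zero (0 : M.carrier)).symm) rfl }
    (fun n s x hx => by
      refine ⟨⟨zero_mem _, zero_mem _⟩, ?_⟩
      change x.1.1 ∈ N.gr (n - 1 + 1, s)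
      rw [sub_add_cancel]
      exact hx.1.1)
    (fun a x => by
      have key : ∀ (y : N.carrier), (((0, 0), a • y) : (N.carrier × M.carrier) × N.carrier) =
          ((A.sgn 1 a • 0, A.sgn 1 (A.sgn 1 a) • 0), A.sgn 1 (A.sgn 1 a) • y) := fun y => by
        rw [A.sgn_one_sgn_one]
        simp
      exact key x.1.1)
    (fun x => by
      have key : ∀ (y z : N.carrier) (x : M.carrier),
          ((((y, x), z) : (N.carrier × M.carrier) × N.carrier) - ((0, x), - f.lin x)) =
          ((N.d 0 + f.lin 0, (1 : ℤ).negOnePow • M.d 0) + (y, 0), (1 : ℤ).negOnePow • N.d y) +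
          ((0, 0), (N.d y + f.lin x) + z) := fun y z x => by
        simp
        abel
      exact key x.1.1 x.2 x.1.2)

/-! #### Inverse rotation -/

/-- The map `Cone(f)[-1] ⟶ M`, up to sign. -/
def invRotG {M N : DGMod A} (f : M ⟶ N) : (cone f).shift (-1) ⟶ M :=
  mkHom (M := (cone f).shift (-1)) (fun x => - x.2) (fun x y => neg_add (α := M.carrier) x.2 y.2)
    (fun c x => by
      have key : ∀ (x : M.carrier), - (A.sgn 1 (A.sgn (-1) c) • x) = c • - x := fun x => by
        rw [← A.sgn_add, show (1 : ℤ) + (-1) = 0 from rfl, A.sgn_zero, smul_neg]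
      exact key x.2)
    (fun p x hx => by
      have := hx.2
      change x.2 ∈ M.gr (p.1 + -1 + 1, p.2) at this
      rw [neg_add_cancel_right] at this
      exact neg_mem this)
    (fun x => by
      have key : ∀ (x : M.carrier), - ((-1 : ℤ).negOnePow • (1 : ℤ).negOnePow • M.d x) =
          M.d (- x) := fun x => by
        simp
      exact key x.2)

/-- The map `N ⟶ Cone(Cone(f)[-1] ⟶ M)`. -/
def invRotS {M N : DGMod A} (f : M ⟶ N) : N ⟶ cone (invRotG f) :=
  mkHom (N := cone (invRotG f)) (fun x => (0, (x, 0)))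
    (fun x y => by
      have key : ∀ (x y : N.carrier), ((0, (x + y, 0)) : M.carrier × (N.carrier × M.carrier)) =
        (0, (x, 0)) + (0, (y, 0)) := by simp
      exact key x y)
    (fun c x => by
      have key : ∀ (x : N.carrier), ((0, (c • x, 0)) : M.carrier × (N.carrier × M.carrier)) =
        (c • 0, (A.sgn (-1) (A.sgn 1 c) • x, A.sgn 1 (A.sgn (-1) (A.sgn 1 c)) • 0)) := fun x => by
        rw [← A.sgn_add (-1) 1, show (-1 : ℤ) + 1 = 0 from rfl, A.sgn_zero]
        simp
      exact key x)
    (fun p x hx => by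
      refine ⟨zero_mem _, ?_, zero_mem _⟩
      change x ∈ N.gr (p.1 + 1 + -1, p.2)
      rw [add_neg_cancel_right]
      exact hx)
    (fun x => by
      have key : ∀ (x : N.carrier), ((0, (N.d x, 0)) : M.carrier × (N.carrier × M.carrier)) =
          (M.d 0 + -0, (1 : ℤ).negOnePow • (-1 : ℤ).negOnePow • (N.d x + f.lin 0,
            (1 : ℤ).negOnePow • M.d 0)) := fun x => by
        simp
      exact key x)

/-- The map `Cone(Cone(f)[-1] ⟶ M) ⟶ N`. -/
def invRotR {M N : DGMod A} (f : M ⟶ N) : cone (invRotG f) ⟶ N :=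
  mkHom (M := cone (invRotG f)) (fun x => x.2.1 + f.lin x.1)
    (fun x y => (congrArg (fun z : N.carrier => x.2.1 + y.2.1 + z) (map_add f.lin x.1 y.1)).trans
      (add_add_add_comm (G := N.carrier) _ _ _ _))
    (fun c x => by
      have key : ∀ (y : N.carrier) (x : M.carrier), A.sgn (-1) (A.sgn 1 c) • y + f.lin (c • x) =
        c • (y + f.lin x) := fun y x => by
        rw [← A.sgn_add (-1) 1, show (-1 : ℤ) + 1 = 0 from rfl, A.sgn_zero]
        simp
      exact key x.2.1 x.1)
    (fun p x hx => by
      refine add_mem ?_ (f.lin_mem p _ hx.1)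
      have := hx.2.1
      change x.2.1 ∈ N.gr (p.1 + 1 + -1, p.2) at this
      rwa [add_neg_cancel_right] at this)
    (fun x => by
      have key : ∀ (y : N.carrier) (x z : M.carrier),
          (1 : ℤ).negOnePow • (-1 : ℤ).negOnePow • (N.d y + f.lin x) + f.lin (M.d z + - x) =
          N.d (y + f.lin z) := fun y x z => by
        simp [f.lin_d]
        abel
      exact key x.2.1 x.2.2 x.1)

/-- `Cone(Cone(f)[-1] ⟶ M)` is homotopy equivalent to `N`. -/
def invRotHtpy {M N : DGMod A} (f : M ⟶ N) : Htpy (𝟙 _) (invRotR f ≫ invRotS f) :=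
  Htpy.mk' (M := cone (invRotG f)) (N := cone (invRotG f))
    { toFun := fun x => (0, (0, - x.1))
      map_zero' := by
        have key : ((0, (0, - 0)) : M.carrier × (N.carrier × M.carrier)) = 0 := by simp
        exact key
      map_add' := fun x y => by
        have key : ∀ (x y : M.carrier), ((0, (0, - (x + y))) : M.carrier × (N.carrier × M.carrier))
          = (0, (0, - x)) + (0, (0, - y)) := fun x y => by
          simp [add_comm]
        exact key x.1 y.1 }
    (fun n s x hx => by
      refine ⟨zero_mem _, zero_mem _, ?_⟩
      change - x.1 ∈ M.gr (n - 1 + 1 + -1 + 1, s)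
      rw [sub_add_cancel, neg_add_cancel_right]
      exact neg_mem hx.1)
    (fun a x => by
      have key : ∀ (y : M.carrier),
          ((0, (0, - (a • y))) : M.carrier × (N.carrier × M.carrier)) =
          (A.sgn 1 a • 0, (A.sgn (-1) (A.sgn 1 (A.sgn 1 a)) • 0,
            A.sgn 1 (A.sgn (-1) (A.sgn 1 (A.sgn 1 a))) • - y)) := fun y => by
        rw [A.sgn_one_sgn_one, ← A.sgn_add, show (1 : ℤ) + (-1) = 0 from rfl, A.sgn_zero]
        simp
      exact key x.1)
    (fun x => by
      have key : ∀ (y : N.carrier) (x z : M.carrier),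
          (((z, (y, x)) : M.carrier × (N.carrier × M.carrier)) - (0, (y + f.lin z, 0))) =
          (M.d 0 + - - z, (1 : ℤ).negOnePow • (-1 : ℤ).negOnePow • (N.d 0 + f.lin (- z),
            (1 : ℤ).negOnePow • M.d (- z))) +
          (0, (0, - (M.d z + - x))) := fun y x z => by
        simp
      exact key x.2.1 x.2.2 x.1)

/-! #### The octahedron -/

/-- The map `Cone(f) ⟶ Cone(f ≫ g)`. -/
def octA {M N P : DGMod A} (f : M ⟶ N) (g : N ⟶ P) : cone f ⟶ cone (f ≫ g) :=
  coneMap (𝟙 M) g (Htpy.ofEq (Category.id_comp _).symm)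

/-- The map `Cone(f ≫ g) ⟶ Cone(g)`. -/
def octB {M N P : DGMod A} (f : M ⟶ N) (g : N ⟶ P) : cone (f ≫ g) ⟶ cone g :=
  coneMap f (𝟙 P) (Htpy.ofEq (Category.comp_id _))

theorem octA_lin {M N P : DGMod A} (f : M ⟶ N) (g : N ⟶ P) (y : N.carrier) (x : M.carrier) :
    Hom.lin (octA f g) (show (cone f).carrier from (y, x)) =
      (show (cone (f ≫ g)).carrier from (g.lin y, x)) :=
  Prod.ext (add_zero (g.lin y)) rfl

theorem octB_lin {M N P : DGMod A} (f : M ⟶ N) (g : N ⟶ P) (y : P.carrier) (x : M.carrier) :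
    Hom.lin (octB f g) (show (cone (f ≫ g)).carrier from (y, x)) =
      (show (cone g).carrier from (y, f.lin x)) :=
  Prod.ext (add_zero y) rfl

/-- The map `Cone(g) ⟶ Cone(Cone(f) ⟶ Cone(f ≫ g))`. -/
def octS {M N P : DGMod A} (f : M ⟶ N) (g : N ⟶ P) : cone g ⟶ cone (octA f g) :=
  mkHom (M := cone g) (N := cone (octA f g)) (fun x => ((x.1, 0), (x.2, 0)))
    (fun x y => by
      have key : ∀ (x y : P.carrier) (x' y' : N.carrier),
        (((x + y, 0), (x' + y', 0)) : (P.carrier × M.carrier) × (N.carrier × M.carrier)) =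
        ((x, 0), (x', 0)) + ((y, 0), (y', 0)) := by simp
      exact key x.1 y.1 x.2 y.2)
    (fun c x => by
      have key : ∀ (x : P.carrier) (y : N.carrier),
        (((c • x, 0), (A.sgn 1 c • y, 0)) : (P.carrier × M.carrier) × (N.carrier × M.carrier)) =
        ((c • x, A.sgn 1 c • 0), (A.sgn 1 c • y, A.sgn 1 (A.sgn 1 c) • 0)) := by simp
      exact key x.1 x.2)
    (fun p x hx => ⟨⟨hx.1, zero_mem _⟩, hx.2, zero_mem _⟩)
    (fun x => by
      have key : ∀ (x : P.carrier) (y : N.carrier),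
        (((P.d x + g.lin y, 0), ((1 : ℤ).negOnePow • N.d y, 0)) :
          (P.carrier × M.carrier) × (N.carrier × M.carrier)) =
        ((P.d x + g.lin (f.lin 0), (1 : ℤ).negOnePow • M.d 0) + (g.lin y + 0, 0),
          (1 : ℤ).negOnePow • (N.d y + f.lin 0, (1 : ℤ).negOnePow • M.d 0)) := by simp
      exact key x.1 x.2)

/-- The map `Cone(Cone(f) ⟶ Cone(f ≫ g)) ⟶ Cone(g)`. -/
def octR {M N P : DGMod A} (f : M ⟶ N) (g : N ⟶ P) : cone (octA f g) ⟶ cone g :=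
  mkHom (M := cone (octA f g)) (N := cone g) (fun x => (x.1.1, x.2.1 + f.lin x.1.2))
    (fun x y => by
      have key : ∀ (z z' : P.carrier) (y y' : N.carrier) (x x' : M.carrier),
        ((z + z', y + y' + f.lin (x + x')) : P.carrier × N.carrier) =
        (z, y + f.lin x) + (z', y' + f.lin x') := fun z z' y y' x x' => by
          simp [add_add_add_comm]
      exact key x.1.1 y.1.1 x.2.1 y.2.1 x.1.2 y.1.2)
    (fun c x => by
      have key : ∀ (z : P.carrier) (y : N.carrier) (x : M.carrier),
        ((c • z, A.sgn 1 c • y + f.lin (A.sgn 1 c • x)) : P.carrier × N.carrier) =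
        (c • z, A.sgn 1 c • (y + f.lin x)) := by simp
      exact key x.1.1 x.2.1 x.1.2)
    (fun p x hx => ⟨hx.1.1, add_mem hx.2.1 (f.lin_mem _ _ hx.1.2)⟩)
    (fun x => by
      have key : ∀ (z : P.carrier) (y : N.carrier) (x x' : M.carrier),
        ((P.d z + g.lin (f.lin x) + (g.lin y + 0), (1 : ℤ).negOnePow • (N.d y + f.lin x') +
          f.lin ((1 : ℤ).negOnePow • M.d x + x')) : P.carrier × N.carrier) =
        (P.d z + g.lin (y + f.lin x), (1 : ℤ).negOnePow • N.d (y + f.lin x)) := fun z y x x' => by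
          simp [f.lin_d, add_comm, add_left_comm, add_assoc]
      exact key x.1.1 x.2.1 x.1.2 x.2.2)

/-- `Cone(Cone(f) ⟶ Cone(f ≫ g))` is homotopy equivalent to `Cone(g)`. -/
def octHtpy {M N P : DGMod A} (f : M ⟶ N) (g : N ⟶ P) : Htpy (𝟙 _) (octR f g ≫ octS f g) :=
  Htpy.mk' (M := cone (octA f g)) (N := cone (octA f g))
    { toFun := fun x => ((0, 0), (0, x.1.2))
      map_zero' := rfl
      map_add' := fun x y => by
        have key : ∀ (x x' : M.carrier),
          (((0, 0), (0, x + x')) : (P.carrier × M.carrier) × (N.carrier × M.carrier)) =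
          ((0, 0), (0, x)) + ((0, 0), (0, x')) := by simp
        exact key x.1.2 y.1.2 }
    (fun n s x hx => by
      refine ⟨⟨zero_mem _, zero_mem _⟩, zero_mem _, ?_⟩
      change x.1.2 ∈ M.gr (n - 1 + 1 + 1, s)
      rw [sub_add_cancel]
      exact hx.1.2)
    (fun a x => by
      have key : ∀ (x : M.carrier),
          (((0, 0), (0, A.sgn 1 a • x)) : (P.carrier × M.carrier) × (N.carrier × M.carrier)) =
          ((A.sgn 1 a • 0, A.sgn 1 (A.sgn 1 a) • 0), (A.sgn 1 (A.sgn 1 a) • 0,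
            A.sgn 1 (A.sgn 1 (A.sgn 1 a)) • x)) := fun x => by
        rw [A.sgn_one_sgn_one]
        simp
      exact key x.1.2)
    (fun x => by
      have key : ∀ (z : P.carrier) (y : N.carrier) (x x' : M.carrier),
          ((((z, x), (y, x')) : (P.carrier × M.carrier) × (N.carrier × M.carrier)) -
            ((z, 0), (y + f.lin x, 0))) =
          ((P.d 0 + g.lin (f.lin 0), (1 : ℤ).negOnePow • M.d 0) + (g.lin 0 + 0, x),
            (1 : ℤ).negOnePow • (N.d 0 + f.lin x, (1 : ℤ).negOnePow • M.d x)) +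
          ((0, 0), (0, (1 : ℤ).negOnePow • M.d x + x')) := fun z y x x' => by
        simp
      exact key x.1.1 x.2.1 x.1.2 x.2.2)

end DGMod

/-! ### The triangulated structure of the homotopy category -/

/-- The image in `K_A` of the cone sequence of a morphism. -/
abbrev coneTriangleK {M N : DGMod A} (f : M ⟶ N) : Triangle (KCat A) :=
  (toK A).mapTriangle.obj (coneTriangle f)

/-- The distinguished triangles of `K_A` are those isomorphic to a cone sequence. -/
def distTriangles (A : AdamsCDGA.{u}) : Set (Triangle (KCat A)) :=
  {T | ∃ (M N : DGMod A) (f : M ⟶ N), Nonempty (T ≅ coneTriangleK f)}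

theorem isZero_toK {M : DGMod A} (h : Htpy (𝟙 M) 0) : IsZero ((toK A).obj M) := by
  rw [IsZero.iff_id_eq_zero, ← (toK A).map_id, toK_map_eq h, Functor.map_zero]

/-- Triangles of dg modules which agree up to homotopy in the third object. -/
def mapTriangleIso {X Y Z Z' : DGMod A} {f : X ⟶ Y} {g : Y ⟶ Z} {g' : Y ⟶ Z'}
    {h : Z ⟶ X⟦(1 : ℤ)⟧} {h' : Z' ⟶ X⟦(1 : ℤ)⟧} (c : Z ⟶ Z') (hc : IsIso ((toK A).map c))
    (h₁ : (toK A).map (g ≫ c) = (toK A).map g') (h₂ : (toK A).map h = (toK A).map (c ≫ h')) :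
    (toK A).mapTriangle.obj (Triangle.mk f g h) ≅
      (toK A).mapTriangle.obj (Triangle.mk f g' h') :=
  Triangle.isoMk _ _ (Iso.refl _) (Iso.refl _) 
    (@asIso (KCat A) _ ((toK A).obj Z) ((toK A).obj Z') ((toK A).map c) hc)
    ((Category.comp_id _).trans (Category.id_comp _).symm)
    (by
      refine Eq.trans ?_ (Category.id_comp _).symm
      exact ((toK A).map_comp _ _).symm.trans h₁)
    (by
      refine (congrArg (_ ≫ ·) ((shiftFunctor (KCat A) (1 : ℤ)).map_id _)).trans
        ((Category.comp_id _).trans ?_)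
      refine Eq.trans (b := ((toK A).map h ≫ ((toK A).commShiftIso 1).hom.app X)) rfl ?_
      rw [h₂, Functor.map_comp, Category.assoc]
      rfl)

theorem rotate_mem (T : Triangle (KCat A)) (hT : T ∈ distTriangles A) :
    T.rotate ∈ distTriangles A := by
  obtain ⟨M, N, f, ⟨e⟩⟩ := hT
  refine ⟨_, _, coneInl f, ⟨(rotate _).mapIso e ≪≫
    (toK A).mapTriangleRotateIso.app (coneTriangle f) ≪≫ ?_⟩⟩
  have : IsIso ((toK A).map (rotS f)) := isIso_toK _ (rotR f) (Htpy.ofEq rfl) (rotHtpy f)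
  refine mapTriangleIso (rotS f) this ?_ rfl
  change (toK A).map (coneInl (coneInl f) ≫ rotR f ≫ rotS f) = _
  rw [Functor.map_comp, ← toK_map_eq (rotHtpy f), (toK A).map_id]
  exact Category.comp_id _

theorem invRotate_mem (T : Triangle (KCat A)) (hT : T ∈ distTriangles A) :
    T.invRotate ∈ distTriangles A := by
  obtain ⟨M, N, f, ⟨e⟩⟩ := hT
  refine ⟨_, _, invRotG f, ⟨(invRotate _).mapIso e ≪≫
    (toK A).mapTriangleInvRotateIso.app (coneTriangle f) ≪≫ ?_⟩⟩
  have : IsIso ((toK A).map (invRotS f)) := isIso_toK _ (invRotR f) (Htpy.ofEq (by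
    ext x
    exact (congrArg (x + ·) (map_zero f.lin)).trans (add_zero x))) (invRotHtpy f)
  refine mapTriangleIso (invRotS f) this ?_ rfl
  have h : f = coneInl (invRotG f) ≫ invRotR f := by
    ext x
    exact (zero_add (f.lin x)).symm
  have h' : coneInl (invRotG f) ≫ invRotR f ≫ invRotS f = f ≫ invRotS f :=
    (Category.assoc _ _ _).symm.trans (congrArg (· ≫ invRotS f) h.symm)
  change (toK A).map (f ≫ invRotS f) = _
  rw [← h', Functor.map_comp, ← toK_map_eq (invRotHtpy f), (toK A).map_id]
  exact Category.comp_id _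

theorem complete_of_iso {C : Type*} [Category C] [HasShift C ℤ] {T₁ T₂ S₁ S₂ : Triangle C}
    (e₁ : T₁ ≅ S₁) (e₂ : T₂ ≅ S₂)
    (H : ∀ (a : S₁.obj₁ ⟶ S₂.obj₁) (b : S₁.obj₂ ⟶ S₂.obj₂), S₁.mor₁ ≫ b = a ≫ S₂.mor₁ →
      ∃ (c : S₁.obj₃ ⟶ S₂.obj₃), S₁.mor₂ ≫ c = b ≫ S₂.mor₂ ∧
        S₁.mor₃ ≫ a⟦(1 : ℤ)⟧' = c ≫ S₂.mor₃)
    (a : T₁.obj₁ ⟶ T₂.obj₁) (b : T₁.obj₂ ⟶ T₂.obj₂)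
    (fac : T₁.mor₁ ≫ b = a ≫ T₂.mor₁) :
    ∃ (c : T₁.obj₃ ⟶ T₂.obj₃), T₁.mor₂ ≫ c = b ≫ T₂.mor₂ ∧
      T₁.mor₃ ≫ a⟦(1 : ℤ)⟧' = c ≫ T₂.mor₃ := by
  obtain ⟨c, hc, hc'⟩ := H (e₁.inv.hom₁ ≫ a ≫ e₂.hom.hom₁) (e₁.inv.hom₂ ≫ b ≫ e₂.hom.hom₂) (by
    rw [e₁.inv.comm₁_assoc, reassoc_of% fac, e₂.hom.comm₁]
    simp only [Category.assoc])
  let γ₁ : S₁ ⟶ S₂ := Triangle.homMk _ _ (e₁.inv.hom₁ ≫ a ≫ e₂.hom.hom₁)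
    (e₁.inv.hom₂ ≫ b ≫ e₂.hom.hom₂) c (by
      rw [e₁.inv.comm₁_assoc, reassoc_of% fac, e₂.hom.comm₁]
      simp only [Category.assoc]) hc hc'
  let γ : T₁ ⟶ T₂ := e₁.hom ≫ γ₁ ≫ e₂.inv
  have h₁ : γ.hom₁ = a := by simp [γ, γ₁]
  have h₂ : γ.hom₂ = b := by simp [γ, γ₁]
  exact ⟨γ.hom₃, by rw [← h₂]; exact γ.comm₂, by rw [← h₁]; exact γ.comm₃⟩

theorem complete_cone {M N M' N' : DGMod A} (f : M ⟶ N) (f' : M' ⟶ N')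
    (a : (toK A).obj M ⟶ (toK A).obj M') (b : (toK A).obj N ⟶ (toK A).obj N')
    (fac : (toK A).map f ≫ b = a ≫ (toK A).map f') :
    ∃ (c : (toK A).obj (cone f) ⟶ (toK A).obj (cone f')),
      (toK A).map (coneInl f) ≫ c = b ≫ (toK A).map (coneInl f') ∧
      ((toK A).map (coneSnd f) ≫ ((toK A).commShiftIso (1 : ℤ)).hom.app M) ≫ a⟦(1 : ℤ)⟧' =
        c ≫ (toK A).map (coneSnd f') ≫ ((toK A).commShiftIso (1 : ℤ)).hom.app M' := by
  obtain ⟨a, rfl⟩ := (toK A).map_surjective a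
  obtain ⟨b, rfl⟩ := (toK A).map_surjective b
  rw [← Functor.map_comp, ← Functor.map_comp] at fac
  obtain ⟨h⟩ := toK_htpy fac
  refine ⟨(toK A).map (coneMap a b h), ?_, ?_⟩
  · rw [← Functor.map_comp, ← Functor.map_comp, coneInl_coneMap]
  · rw [Category.assoc, ← Functor.commShiftIso_hom_naturality, ← Functor.map_comp_assoc,
      ← Functor.map_comp_assoc, coneMap_coneSnd]

theorem complete_mem (T₁ T₂ : Triangle (KCat A)) (hT₁ : T₁ ∈ distTriangles A)
    (hT₂ : T₂ ∈ distTriangles A) (a : T₁.obj₁ ⟶ T₂.obj₁) (b : T₁.obj₂ ⟶ T₂.obj₂)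
    (fac : T₁.mor₁ ≫ b = a ≫ T₂.mor₁) :
    ∃ (c : T₁.obj₃ ⟶ T₂.obj₃), T₁.mor₂ ≫ c = b ≫ T₂.mor₂ ∧
      T₁.mor₃ ≫ a⟦(1 : ℤ)⟧' = c ≫ T₂.mor₃ := by
  obtain ⟨M, N, f, ⟨e₁⟩⟩ := hT₁
  obtain ⟨M', N', f', ⟨e₂⟩⟩ := hT₂
  exact complete_of_iso e₁ e₂ (complete_cone f f') a b fac

instance : Pretriangulated (KCat A) where
  distinguishedTriangles := distTriangles A
  isomorphic_distinguished := by
    rintro T₁ ⟨M, N, f, ⟨e'⟩⟩ T₂ e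
    exact ⟨M, N, f, ⟨e ≪≫ e'⟩⟩
  contractible_distinguished X := by
    obtain ⟨X⟩ := X
    refine ⟨_, _, 𝟙 X, ⟨?_⟩⟩
    have h : IsZero ((toK A).obj (cone (𝟙 X))) := isZero_toK (coneIdHtpy X)
    exact Triangle.isoMk _ _ (Iso.refl _) (Iso.refl _) (h.isoZero.symm)
      (by exact (Category.comp_id _).trans (((toK A).map_id X).symm.trans (Category.id_comp _).symm)) (h.eq_of_tgt _ _)
      (zero_comp.trans (h.isoZero.symm.isZero_iff.2 h |>.eq_of_src _ _))
  distinguished_cocone_triangle f := by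
    obtain ⟨f, rfl⟩ := (toK A).map_surjective f
    exact ⟨_, _, _, ⟨_, _, f, ⟨Iso.refl _⟩⟩⟩
  rotate_distinguished_triangle T := by
    refine ⟨rotate_mem T, fun h => ?_⟩
    obtain ⟨M, N, f, ⟨e'⟩⟩ := invRotate_mem _ h
    exact ⟨M, N, f, ⟨(triangleRotation _).unitIso.app T ≪≫ e'⟩⟩
  complete_distinguished_triangle_morphism := complete_mem

theorem coneTriangleK_mem {M N : DGMod A} (f : M ⟶ N) : coneTriangleK f ∈ distTriang (KCat A) :=
  ⟨_, _, f, ⟨Iso.refl _⟩⟩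

theorem octTriangle_mem {M N P : DGMod A} (f : M ⟶ N) (g : N ⟶ P) :
    (toK A).mapTriangle.obj (Triangle.mk (octA f g) (octB f g)
      (coneSnd g ≫ (coneInl f)⟦(1 : ℤ)⟧')) ∈ distTriang (KCat A) := by
  have : IsIso ((toK A).map (octS f g)) := isIso_toK _ (octR f g) (Htpy.ofEq (by
    ext x
    have key : ∀ (z : P.carrier) (y : N.carrier), ((z, y + f.lin 0) : P.carrier × N.carrier) =
      (z, y) := by simp
    exact key x.1 x.2)) (octHtpy f g)
  have h : coneInl (octA f g) ≫ octR f g = octB f g := by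
    ext x
    have key : ∀ (z : P.carrier) (x : M.carrier), ((z, 0 + f.lin x) : P.carrier × N.carrier) =
      (z + 0, f.lin x) := by simp
    exact key x.1 x.2
  have h' : coneInl (octA f g) ≫ octR f g ≫ octS f g = octB f g ≫ octS f g :=
    (Category.assoc _ _ _).symm.trans (congrArg (· ≫ octS f g) h)
  refine ⟨_, _, octA f g, ⟨mapTriangleIso (octS f g) this ?_ rfl⟩⟩
  rw [← h', Functor.map_comp, ← toK_map_eq (octHtpy f g), (toK A).map_id]
  exact Category.comp_id _

instance : IsTriangulated (KCat A) := IsTriangulated.mk' (by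
  rintro ⟨M⟩ ⟨N⟩ ⟨P⟩ f g
  obtain ⟨f, rfl⟩ := (toK A).map_surjective f
  obtain ⟨g, rfl⟩ := (toK A).map_surjective g
  refine ⟨_, _, _, _, _, _, _, _, Iso.refl _, Iso.refl _, Iso.refl _,
    (Category.comp_id _).trans (Category.id_comp _).symm,
    (Category.comp_id _).trans (Category.id_comp _).symm,
    _, _, coneTriangleK_mem f, _, _, coneTriangleK_mem g, _, _, coneTriangleK_mem (f ≫ g), ⟨?_⟩⟩
  refine Triangulated.Octahedron.mk ((toK A).map (octA f g)) ((toK A).map (octB f g)) ?_ ?_ ?_ ?_ ?_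
  · change (toK A).map (coneInl f ≫ octA f g) = (toK A).map (g ≫ coneInl (f ≫ g))
    rw [octA, coneInl_coneMap]
  · have h : octA f g ≫ coneSnd (f ≫ g) = coneSnd f := rfl
    have h' := congrArg (fun k => (toK A).map k ≫ ((toK A).commShiftIso 1).hom.app M) h
    rw [Functor.map_comp, Category.assoc] at h'
    exact h'
  · change (toK A).map (coneInl (f ≫ g) ≫ octB f g) = (toK A).map (coneInl g)
    rw [octB, coneInl_coneMap, Category.id_comp]
  · have h : coneSnd (f ≫ g) ≫ f⟦(1 : ℤ)⟧' = octB f g ≫ coneSnd g := rfl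
    have h' := congrArg (fun k => (toK A).map k ≫ ((toK A).commShiftIso 1).hom.app N) h
    rw [Functor.map_comp, Functor.map_comp, Category.assoc, Category.assoc,
      Functor.commShiftIso_hom_naturality] at h'
    exact (Category.assoc _ _ _).trans h'
  · refine isomorphic_distinguished _ (octTriangle_mem f g) _ (Triangle.isoMk _ _ (Iso.refl _)
      (Iso.refl _) (Iso.refl _) ((Category.comp_id _).trans (Category.id_comp _).symm)
      ((Category.comp_id _).trans (Category.id_comp _).symm) ?_)
    refine (congrArg (_ ≫ ·) ((shiftFunctor (KCat A) (1 : ℤ)).map_id _)).trans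
        ((Category.comp_id _).trans (Eq.trans ?_ (Category.id_comp _).symm))
    have h' : (toK A).map (coneSnd g ≫ (coneInl f)⟦(1 : ℤ)⟧') ≫
        ((toK A).commShiftIso 1).hom.app (cone f) = ((toK A).map (coneSnd g) ≫
        ((toK A).commShiftIso 1).hom.app N) ≫ ((toK A).map (coneInl f))⟦(1 : ℤ)⟧' := by
      rw [Functor.map_comp, Category.assoc, Category.assoc, Functor.commShiftIso_hom_naturality]
    exact h'.symm)

/-! ### Total cohomology and the derived category -/

namespace DGMod

/-- The total cohomology group `ker d / im d`, the direct sum of all the groups `H^n(M)`. -/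
abbrev totalH (M : DGMod A) : Type u := M.d.ker ⧸ M.d.range.addSubgroupOf M.d.ker

/-- The map induced by a morphism on cocycles. -/
def kerMap {M N : DGMod A} (f : M ⟶ N) : M.d.ker →+ N.d.ker where
  toFun x := ⟨f.lin x.1, by
    have := x.2
    rw [AddMonoidHom.mem_ker] at this ⊢
    rw [← f.lin_d, this, map_zero]⟩
  map_zero' := Subtype.ext (map_zero f.lin)
  map_add' x y := Subtype.ext (map_add f.lin x.1 y.1)

/-- The map induced by a morphism on total cohomology. -/
def totalHMap {M N : DGMod A} (f : M ⟶ N) : M.totalH →+ N.totalH :=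
  QuotientAddGroup.map _ _ (kerMap f) (by
    rintro x ⟨y, hy⟩
    refine ⟨f.lin y, ?_⟩
    rw [← f.lin_d, hy]
    rfl)

theorem totalHMap_mk {M N : DGMod A} (f : M ⟶ N) (x : M.d.ker) :
    totalHMap f (QuotientAddGroup.mk x) = QuotientAddGroup.mk (kerMap f x) := rfl

theorem totalH_mk_eq_zero {M : DGMod A} (x : M.d.ker) :
    (QuotientAddGroup.mk x : M.totalH) = 0 ↔ ∃ y, M.d y = x := by
  rw [QuotientAddGroup.eq_zero_iff]
  rfl

/-- The total cohomology functor on dg modules. -/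
def totalHFunctor (A : AdamsCDGA.{u}) : DGMod A ⥤ AddCommGrpCat.{u} where
  obj M := AddCommGrpCat.of M.totalH
  map f := AddCommGrpCat.ofHom (totalHMap f)
  map_id M := by
    ext x
    rfl
  map_comp f g := by
    ext x
    rfl

theorem totalHMap_eq {M N : DGMod A} {f g : M ⟶ N} (h : Htpy f g) : totalHMap f = totalHMap g := by
  ext x
  change totalHMap f (QuotientAddGroup.mk x) = totalHMap g (QuotientAddGroup.mk x)
  rw [totalHMap_mk, totalHMap_mk, ← sub_eq_zero, ← QuotientAddGroup.mk_sub, totalH_mk_eq_zero]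
  refine ⟨h.h x, ?_⟩
  have := h.comm x
  rw [show M.d x = 0 from x.2, map_zero, add_zero] at this
  exact this.symm

end DGMod

/-- The total cohomology functor on the homotopy category. -/
def homologyK (A : AdamsCDGA.{u}) : KCat A ⥤ AddCommGrpCat.{u} :=
  CategoryTheory.Quotient.lift _ (totalHFunctor A)
    (fun _ _ _ _ ⟨h⟩ => congrArg AddCommGrpCat.ofHom (totalHMap_eq h))

instance : (homologyK A).PreservesZeroMorphisms where
  map_zero X Y := by
    change (totalHFunctor A).map (0 : X.as ⟶ Y.as) = 0
    ext x
    obtain ⟨x, rfl⟩ := QuotientAddGroup.mk_surjective x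
    rfl

instance : (homologyK A).IsHomological :=
  Functor.IsHomological.mk' _ (by
    rintro T ⟨M, N, f, ⟨e⟩⟩
    refine ⟨_, e, ?_⟩
    rw [ShortComplex.ab_exact_iff]
    intro x hx
    have key : ∀ x : N.totalH, totalHMap (coneInl f) x = 0 → ∃ y : M.totalH, totalHMap f y = x := by
      intro x hx
      obtain ⟨x, rfl⟩ := QuotientAddGroup.mk_surjective x
      rw [totalHMap_mk, totalH_mk_eq_zero] at hx
      obtain ⟨⟨y, z⟩, h⟩ := hx
      replace h := (cone_d f y z).symm.trans h
      obtain ⟨h₁, h₂⟩ := Prod.ext_iff.1 h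
      have h₁' : N.d y + f.lin z = x := h₁
      have h₂' : - M.d z = 0 := h₂
      refine ⟨QuotientAddGroup.mk ⟨z, neg_eq_zero.1 h₂'⟩, ?_⟩
      rw [totalHMap_mk, ← sub_eq_zero, ← QuotientAddGroup.mk_sub, totalH_mk_eq_zero]
      refine ⟨- y, ?_⟩
      rw [map_neg, neg_eq_iff_eq_neg]
      refine (eq_sub_of_add_eq h₁').trans ?_
      exact (neg_sub _ _).symm
    exact key x hx)

/-- The quasi-isomorphisms in `K_A`: the morphisms inducing isomorphisms on cohomology. -/
def quasiIso (A : AdamsCDGA.{u}) : MorphismProperty (KCat A) :=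
  fun _ _ f => IsIso ((homologyK A).map f)

theorem isIso_homologyK_iff {M N : DGMod A} (f : M ⟶ N) :
    IsIso ((homologyK A).map ((toK A).map f)) ↔
      (∀ x, M.d x = 0 → ∀ y, N.d y = f.lin x → ∃ z, M.d z = x) ∧
      (∀ y, N.d y = 0 → ∃ x, M.d x = 0 ∧ ∃ z, N.d z = f.lin x - y) := by
  rw [ConcreteCategory.isIso_iff_bijective]
  change Function.Bijective (totalHMap f) ↔ _
  rw [Function.Bijective, injective_iff_map_eq_zero]
  refine and_congr ⟨fun h x hx y hy => ?_, fun h x hx => ?_⟩ ⟨fun h y hy => ?_, fun h y => ?_⟩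
  · refine (totalH_mk_eq_zero ⟨x, hx⟩).1 (h _ ?_)
    rw [totalHMap_mk, totalH_mk_eq_zero]
    exact ⟨y, hy⟩
  · obtain ⟨x, rfl⟩ := QuotientAddGroup.mk_surjective x
    rw [totalHMap_mk, totalH_mk_eq_zero] at hx
    obtain ⟨y, hy⟩ := hx
    exact (totalH_mk_eq_zero x).2 (h x x.2 y hy)
  · obtain ⟨x, hx⟩ := h (QuotientAddGroup.mk ⟨y, hy⟩)
    obtain ⟨x, rfl⟩ := QuotientAddGroup.mk_surjective x
    rw [totalHMap_mk, ← sub_eq_zero, ← QuotientAddGroup.mk_sub, totalH_mk_eq_zero] at hx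
    exact ⟨x, x.2, hx⟩
  · obtain ⟨y, rfl⟩ := QuotientAddGroup.mk_surjective y
    obtain ⟨x, hx, z, hz⟩ := h y y.2
    refine ⟨QuotientAddGroup.mk ⟨x, hx⟩, ?_⟩
    rw [totalHMap_mk, ← sub_eq_zero, ← QuotientAddGroup.mk_sub, totalH_mk_eq_zero]
    exact ⟨z, hz⟩

theorem isIso_homologyK_shift {X Y : KCat A} (f : X ⟶ Y) (n : ℤ) :
    IsIso ((homologyK A).map (f⟦n⟧')) ↔ IsIso ((homologyK A).map f) := by
  obtain ⟨M⟩ := X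
  obtain ⟨N⟩ := Y
  obtain ⟨f, rfl⟩ := (toK A).map_surjective f
  have e : Arrow.mk (((toK A).map f)⟦n⟧') ≅ Arrow.mk ((toK A).map (f⟦n⟧')) :=
    Arrow.isoMk (((toK A).commShiftIso n).symm.app M) (((toK A).commShiftIso n).symm.app N)
      (((toK A).commShiftIso n).inv.naturality f).symm
  have h₁ : IsIso ((homologyK A).map (((toK A).map f)⟦n⟧')) ↔
      IsIso ((homologyK A).map ((toK A).map (f⟦n⟧'))) :=
    (MorphismProperty.isomorphisms AddCommGrpCat.{u}).arrow_mk_iso_iff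
      ((homologyK A).mapArrow.mapIso e)
  refine h₁.trans ?_
  rw [isIso_homologyK_iff, isIso_homologyK_iff]
  have key : ∀ e : ℤˣ,
    ((∀ x, e • M.d x = 0 → ∀ y, e • N.d y = f.lin x → ∃ z, e • M.d z = x) ∧
      (∀ y, e • N.d y = 0 → ∃ x, e • M.d x = 0 ∧ ∃ z, e • N.d z = f.lin x - y)) ↔
    ((∀ x, M.d x = 0 → ∀ y, N.d y = f.lin x → ∃ z, M.d z = x) ∧
      (∀ y, N.d y = 0 → ∃ x, M.d x = 0 ∧ ∃ z, N.d z = f.lin x - y)) := fun e => by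
    rcases Int.units_eq_one_or e with rfl | rfl
    · simp
    · simp only [Units.neg_smul, one_smul, neg_eq_zero]
      refine and_congr ⟨fun h x hx y hy => ?_, fun h x hx y hy => ?_⟩
        (forall₂_congr fun y hy => exists_congr fun x => and_congr_right fun hx =>
          ⟨fun ⟨z, hz⟩ => ⟨-z, by simpa using hz⟩, fun ⟨z, hz⟩ => ⟨-z, by simpa using hz⟩⟩)
      · obtain ⟨z, hz⟩ := h x hx (-y) (by simpa using hy)
        exact ⟨-z, by simpa using hz⟩
      · obtain ⟨z, hz⟩ := h x hx (-y) (by simpa using hy)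
        exact ⟨-z, by simpa using hz⟩
  exact key n.negOnePow

theorem quasiIso_eq : quasiIso A = (homologyK A).homologicalKernel.trW := by
  ext X Y f
  let : (homologyK A).ShiftSequence ℤ := Functor.ShiftSequence.tautological _ _
  rw [Functor.mem_homologicalKernel_trW_iff]
  exact ⟨fun h n => (isIso_homologyK_shift f n).2 h, fun h => (isIso_homologyK_shift f 0).1 (h 0)⟩

instance : (quasiIso A).HasLeftCalculusOfFractions := by
  rw [quasiIso_eq]
  infer_instance

instance : (quasiIso A).HasRightCalculusOfFractions := by
  rw [quasiIso_eq]
  infer_instance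

instance : (quasiIso A).IsCompatibleWithTriangulation := by
  rw [quasiIso_eq]
  infer_instance

/-- The derived category `D_A`: the localization of `K_A` at the quasi-isomorphisms. -/
abbrev DCat (A : AdamsCDGA.{u}) := (quasiIso A).Localization

/-- The functor from dg modules to the derived category. -/
abbrev toD (A : AdamsCDGA.{u}) : DGMod A ⥤ DCat A := toK A ⋙ (quasiIso A).Q


/-! ### Cohomology -/

namespace DGMod

variable (M : DGMod A)

/-- The part `M^n = ⨁_s M^n(s)` of cohomological degree `n`. -/
def deg (n : ℤ) : AddSubgroup M.carrier := ⨆ s : ℤ, M.gr (n, s)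

/-- The cocycles of degree `n`. -/
def cocycles (n : ℤ) : AddSubgroup M.carrier := M.deg n ⊓ M.d.ker

/-- The coboundaries of degree `n`. -/
def coboundaries (n : ℤ) : AddSubgroup M.carrier := (M.deg (n - 1)).map M.d

/-- The cohomology group `H^n(M)` of the underlying complex. -/
abbrev H (n : ℤ) : Type u := M.cocycles n ⧸ (M.coboundaries n).addSubgroupOf (M.cocycles n)

end DGMod

/-- The part `A^n = ⨁_r A^n(r)` of cohomological degree `n`. -/
def AdamsCDGA.deg (A : AdamsCDGA.{u}) (n : ℤ) : Submodule ℚ A.carrier := ⨆ r : ℤ, A.gr (n, r)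

/-- `A` is cohomologically connected: `H^n(A) = 0` for `n < 0`, and `H^0(A) = ℚ · 1`. -/
def AdamsCDGA.CohomologicallyConnected (A : AdamsCDGA.{u}) : Prop :=
  (∀ n < 0, ∀ x ∈ A.deg n, A.d x = 0 → ∃ y ∈ A.deg (n - 1), A.d y = x) ∧
    ∀ x ∈ A.deg 0, A.d x = 0 → ∃ q : ℚ, ∃ y ∈ A.deg (-1), x = q • (1 : A.carrier) + A.d y

/-! ### Submodules and quotients -/

namespace DGMod

/-- A dg submodule. -/
def sub (M : DGMod A) (S : Submodule A.carrier M.carrier) (hpr : ∀ p, ∀ x ∈ S, M.pr p x ∈ S)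
    (hd : ∀ x ∈ S, M.d x ∈ S) : DGMod A where
  carrier := S
  gr p := (M.gr p).addSubgroupOf S.toAddSubgroup
  isInternal := by
    refine isInternal_of_proj _ (fun p => ((M.pr p).comp S.subtype.toAddMonoidHom).codRestrict
      S.toAddSubgroup (fun x => hpr p x x.2)) (fun p x hx => Subtype.ext (M.pr_same hx))
      (fun p q h x hx => Subtype.ext (M.pr_diff h hx)) (fun x => ?_)
    obtain ⟨s, hs⟩ := M.exists_sum_pr x
    have hs' : x = ∑ p ∈ s, (⟨M.pr p x, hpr p x x.2⟩ : S) :=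
      Subtype.ext (hs.trans
        (map_sum S.subtype (fun p => (⟨M.pr p x, hpr p x x.2⟩ : S)) s).symm)
    rw [hs']
    exact sum_mem fun p _ => AddSubgroup.mem_iSup_of_mem p (M.pr_mem p x)
  smul_mem p q a x ha hx := M.smul_mem p q a x ha hx
  d := (M.d.comp S.subtype.toAddMonoidHom).codRestrict S.toAddSubgroup (fun x => hd x x.2)
  d_mem n s x hx := M.d_mem n s x hx
  d_d x := Subtype.ext (M.d_d x)
  leibniz n r a x ha := Subtype.ext (by
    refine (M.leibniz n r a x ha).trans ?_
    rcases Int.units_eq_one_or n.negOnePow with h | h <;> simp [h]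
    all_goals rfl)

/-- A dg quotient module. -/
def quot (M : DGMod A) (S : Submodule A.carrier M.carrier) (hpr : ∀ p, ∀ x ∈ S, M.pr p x ∈ S)
    (hd : ∀ x ∈ S, M.d x ∈ S) : DGMod A where
  carrier := M.carrier ⧸ S
  gr p := (M.gr p).map S.mkQ.toAddMonoidHom
  isInternal := by
    refine isInternal_of_proj _
      (fun p => QuotientAddGroup.map S.toAddSubgroup S.toAddSubgroup (M.pr p) (hpr p)) ?_ ?_ ?_
    · rintro p _ ⟨x, hx, rfl⟩
      exact congrArg S.mkQ (M.pr_same hx)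
    · rintro p q h _ ⟨x, hx, rfl⟩
      exact congrArg S.mkQ (M.pr_diff h hx)
    · intro x
      obtain ⟨x, rfl⟩ := S.mkQ_surjective x
      refine M.induction x (fun p x hx => ?_) (fun x y hx hy => ?_)
      · exact AddSubgroup.mem_iSup_of_mem p ⟨x, hx, rfl⟩
      · rw [map_add]
        exact add_mem hx hy
  smul_mem := by
    rintro p q a _ ha ⟨x, hx, rfl⟩
    exact ⟨a • x, M.smul_mem p q a x ha hx, rfl⟩
  d := QuotientAddGroup.map S.toAddSubgroup S.toAddSubgroup M.d hd
  d_mem := by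
    rintro n s _ ⟨x, hx, rfl⟩
    exact ⟨M.d x, M.d_mem n s x hx, rfl⟩
  d_d x := by
    obtain ⟨x, rfl⟩ := S.mkQ_surjective x
    exact congrArg S.mkQ (M.d_d x)
  leibniz n r a x ha := by
    obtain ⟨x, rfl⟩ := S.mkQ_surjective x
    refine (congrArg S.mkQ (M.leibniz n r a x ha)).trans ?_
    rw [map_add, Units.smul_def, map_zsmul]
    rfl

theorem pr_smul (M : DGMod A) (p q : ℤ × ℤ) (a : A.carrier) (ha : a ∈ A.gr q) (x : M.carrier) :
    M.pr p (a • x) = a • M.pr (p - q) x :=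
  M.induction x (fun r x hx => by
    by_cases h : p = q + r
    · subst h
      rw [M.pr_same (M.smul_mem q r a x ha hx), add_sub_cancel_left, M.pr_same hx]
    · rw [M.pr_diff h (M.smul_mem q r a x ha hx), M.pr_diff _ hx, smul_zero]
      rintro rfl
      simp at h) (fun x y hx hy => by rw [smul_add, map_add, map_add, hx, hy, smul_add])

theorem pr_mem_span (M : DGMod A) (G : Set M.carrier) (hG : ∀ g ∈ G, ∃ p, g ∈ M.gr p)
    (p : ℤ × ℤ) (x : M.carrier) (hx : x ∈ Submodule.span A.carrier G) :
    M.pr p x ∈ Submodule.span A.carrier G := by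
  induction hx using Submodule.span_induction generalizing p with
  | mem g hg =>
    obtain ⟨q, hq⟩ := hG g hg
    by_cases h : p = q
    · subst h
      rw [M.pr_same hq]
      exact Submodule.subset_span hg
    · rw [M.pr_diff h hq]
      exact zero_mem _
  | zero => simp
  | add x y _ _ hx hy =>
    rw [map_add]
    exact add_mem (hx p) (hy p)
  | smul a x _ hx =>
    refine A.induction a (fun q a ha => ?_) (fun a b h h' => ?_)
    · rw [M.pr_smul p q a ha]
      exact Submodule.smul_mem _ _ (hx _)
    · rw [add_smul, map_add]
      exact add_mem h h'

theorem d_mem_span (M : DGMod A) (G : Set M.carrier)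
    (hG : ∀ g ∈ G, M.d g ∈ Submodule.span A.carrier G)
    (x : M.carrier) (hx : x ∈ Submodule.span A.carrier G) :
    M.d x ∈ Submodule.span A.carrier G := by
  induction hx using Submodule.span_induction with
  | mem g hg => exact hG g hg
  | zero => simp
  | add x y _ _ hx hy =>
    rw [map_add]
    exact add_mem hx hy
  | smul a x hx hx' =>
    rw [M.leibniz']
    exact add_mem (Submodule.smul_mem _ _ hx) (Submodule.smul_mem _ _ hx')

/-- The elements of `M^m(s)` with `s ≤ n`. -/
def weightSet (M : DGMod A) (n : ℤ) : Set M.carrier := {x | ∃ m s : ℤ, s ≤ n ∧ x ∈ M.gr (m, s)}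

/-- The submodule `W_n M` generated by the elements of Adams degree at most `n`. If `M` is free
with bihomogeneous basis `(b_j)`, this is the span of the `b_j` of Adams degree at most `n`,
because an element of Adams degree `s` is a combination of elements `b_j` of Adams degree at
most `s`. -/
def W (M : DGMod A) (n : ℤ) : DGMod A :=
  M.sub (Submodule.span A.carrier (M.weightSet n))
    (M.pr_mem_span _ (by
      rintro x ⟨m, s, _, h⟩
      exact ⟨(m, s), h⟩))
    (M.d_mem_span _ (by
      rintro x ⟨m, s, hs, h⟩
      exact Submodule.subset_span ⟨m + 1, s, hs, M.d_mem m s x h⟩))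

/-- The products `a • x` with `a ∈ A(r)` homogeneous, `r > 0`, and `x` homogeneous. They generate
the submodule `A⁺ M`, with `A⁺ = ⨁_{r > 0} A(r)` the augmentation ideal. -/
def augSet (M : DGMod A) : Set M.carrier :=
  {z | ∃ (p q : ℤ × ℤ) (a : A.carrier) (x : M.carrier),
    0 < p.2 ∧ a ∈ A.gr p ∧ x ∈ M.gr q ∧ z = a • x}

/-- The tensor product `M ⊗_A ℚ = M / A⁺ M` along the augmentation `A ⟶ A / A⁺ = ℚ`. -/
def red (M : DGMod A) : DGMod A :=
  M.quot (Submodule.span A.carrier M.augSet)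
    (M.pr_mem_span _ (by
      rintro _ ⟨p, q, a, x, _, ha, hx, rfl⟩
      exact ⟨p + q, M.smul_mem p q a x ha hx⟩))
    (M.d_mem_span _ (by
      rintro _ ⟨⟨n, r⟩, ⟨m, s⟩, a, x, hr, ha, hx, rfl⟩
      rw [M.leibniz n r a x ha]
      refine add_mem (Submodule.subset_span ?_) ?_
      · exact ⟨(n + 1, r), (m, s), A.d a, x, hr, A.d_mem n r a ha, hx, rfl⟩
      rw [Units.smul_def]
      refine zsmul_mem (Submodule.subset_span ?_) _
      exact ⟨(n, r), (m + 1, s), a, M.d x, hr, ha, M.d_mem m s x hx, rfl⟩))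

/-! ### Cell modules -/

/-- A presentation of `M` as a cell module: a bihomogeneous `A`-basis `(b_j)_{j ∈ J}` and an
exhaustive filtration `∅ = F_0 ⊆ F_1 ⊆ F_2 ⊆ ⋯` of `J` such that, for `j ∈ F_{n+1}`, the element
`d b_j` is a combination of the `b_i` with `i ∈ F_n`. -/
structure CellBasis (M : DGMod A) (J : Type u) where
  b : Module.Basis J A.carrier M.carrier
  homogeneous : ∀ j, ∃ p, b j ∈ M.gr p
  F : ℕ → Set J
  F_zero : F 0 = ∅
  F_mono : Monotone F
  F_exhaustive : ∀ j, ∃ n, j ∈ F n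
  d_b : ∀ n, ∀ j ∈ F (n + 1), M.d (b j) ∈ Submodule.span A.carrier (b '' F n)

/-- `M` is a cell module. -/
def IsCell (M : DGMod A) : Prop := ∃ J : Type u, Nonempty (CellBasis M J)

/-- `M` is a finite cell module. -/
def IsFinCell (M : DGMod A) : Prop := ∃ J : Type u, Finite J ∧ Nonempty (CellBasis M J)

end DGMod

/-! ### Subcategories of the derived category -/

/-- `P` is a cell module replacing the object `M` of `D_A`. -/
def IsCellReplacement (P : DGMod A) (M : DCat A) : Prop :=
  P.IsCell ∧ Nonempty ((toD A).obj P ≅ M)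

/-- `D^{+w}_A`: the objects `M` with `W_n M ≅ 0` in `D_A` for some `n`, where `W_n M` is `W_n P`
for a cell module `P` isomorphic to `M` in `D_A`. -/
def Dplusw (A : AdamsCDGA.{u}) : ObjectProperty (DCat A) := fun M =>
  ∃ P : DGMod A, IsCellReplacement P M ∧ ∃ n : ℤ, IsZero ((toD A).obj (P.W n))

/-- `D^f_A`: the objects isomorphic in `D_A` to a finite cell module. -/
def Dfin (A : AdamsCDGA.{u}) : ObjectProperty (DCat A) := fun M =>
  ∃ P : DGMod A, P.IsFinCell ∧ Nonempty ((toD A).obj P ≅ M)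

/-- The condition `H^n(M ⊗^L_A ℚ) = 0`, where `M ⊗^L_A ℚ` is `P ⊗_A ℚ` for a cell module `P`
isomorphic to `M` in `D_A`, for all `n` in a set `I`. -/
def redAcyclic (A : AdamsCDGA.{u}) (I : Set ℤ) : ObjectProperty (DCat A) := fun M =>
  ∃ P : DGMod A, IsCellReplacement P M ∧ ∀ n ∈ I, Subsingleton (P.red.H n)

/-- `D_A^{≤ 0}`: the objects `M` of `D^{+w}_A` with `H^n(M ⊗^L_A ℚ) = 0` for `n > 0`. -/
def DLE (A : AdamsCDGA.{u}) : ObjectProperty (DCat A) := Dplusw A ⊓ redAcyclic A {n | 0 < n}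

/-- `D_A^{≥ 0}`: the objects `M` of `D^{+w}_A` with `H^n(M ⊗^L_A ℚ) = 0` for `n < 0`. -/
def DGE (A : AdamsCDGA.{u}) : ObjectProperty (DCat A) := Dplusw A ⊓ redAcyclic A {n | n < 0}

/-- `ℋ_A`: the objects `M` of `D^{+w}_A` with `H^n(M ⊗^L_A ℚ) = 0` for `n ≠ 0`. -/
def heart (A : AdamsCDGA.{u}) : ObjectProperty (DCat A) := Dplusw A ⊓ redAcyclic A {n | n ≠ 0}

/-- A t-structure is non-degenerate if the objects in all `D^{≤ n}` with `n ≤ 0`, and the objects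
in all `D^{≥ n}` with `n ≥ 0`, are zero. -/
def IsNondegenerate {C : Type*} [Category C] [Preadditive C] [HasZeroObject C] [HasShift C ℤ]
    [∀ n : ℤ, (shiftFunctor C n).Additive] [Pretriangulated C]
    (t : Triangulated.TStructure C) : Prop :=
  (∀ X : C, (∀ n ≤ 0, t.le n X) → IsZero X) ∧ (∀ X : C, (∀ n ≥ 0, t.ge n X) → IsZero X)

end AdamsDG

end

/-! Below, "weight" means Adams degree, a "sphere" is a free module on one generator, and the
"reduction" of `X` is `X ⊗^L ℚ`.

For any `A` there is a t-structure on the whole of `D_A`: on one side the objects built from cells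
of cohomological degree `≤ 0`, on the other those without cohomology in negative degrees (`cellLE`,
`cohGE`, `tStr`). Orthogonality is obstruction theory: a map out of a cell module is null-homotopic
when the cohomology of its target vanishes in the bidegrees of the cells (`Cells.htpy_zero`). The
same fact shows that maps out of cell modules agree in `K_A` and `D_A`. Truncation triangles come
from attaching all possible cells of prescribed bidegrees (`exists_cells_attached`,
`exists_approximation`).

On `D^{+w}_A` this t-structure can be read off the reduction, for two reasons. A Nakayama argument
on weights shows that an object with zero reduction is zero (`isZero_of_redVanishAt`). If `A` is
cohomologically connected, an object with cohomology only in degrees `≥ n` has reduction only in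
degrees `≥ n` (`redVanishAt_of_cohGE`): the cohomology of lowest weight is split off by a free
module, whose cone still has cohomology only in degrees `≥ n` because `H^0(A) = ℚ` and `H^i(A) = 0`
for `i < 0`. Cells of degree `≤ n` clearly have reduction in degrees `≤ n`. If the reduction of `X`
satisfies one of the two bounds, the truncation triangle shows that the unwanted truncation has zero
reduction, hence is zero (`cellLE_iff`, `cohGE_iff`). Truncation stays in `D^{+w}_A` once the
weights of the attached cells are bounded below.

For finite cell modules, truncations are constructed by induction on the number of cells
(`FinTrunc.attach`). A new top cell either joins the lower truncation or leaves it unchanged. The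
delicate case is a cell of degree `0`; it is settled because a map between spheres of equal bidegree
is a rational scalar, so zero or invertible. -/

noncomputable section

namespace AdamsDG

variable {A : AdamsCDGA.{u}}

namespace DGMod

/-! ### Cocycles and boundaries of a given bidegree -/

theorem pr_d (M : DGMod A) (p : ℤ × ℤ) (x : M.carrier) :
    M.pr p (M.d x) = M.d (M.pr (p.1 - 1, p.2) x) :=
  M.induction x (fun q x hx => by
    have hd := M.d_mem q.1 q.2 x hx
    by_cases h : p = (q.1 + 1, q.2)
    · subst h
      rw [M.pr_same hd, M.pr_same]
      simpa using hx
    · rw [M.pr_diff h hd, M.pr_diff _ hx, map_zero]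
      rintro rfl
      simp at h) (fun x y hx hy => by simp only [map_add, hx, hy])

/-- The cohomology of `M` in bidegree `p` vanishes. -/
def AcyclicAt (M : DGMod A) (p : ℤ × ℤ) : Prop :=
  ∀ x ∈ M.gr p, M.d x = 0 → ∃ y, M.d y = x

/-- Projecting any primitive to the right bidegree gives another primitive, which is why `AcyclicAt`
need not constrain its witness. -/
theorem AcyclicAt.exists_mem {M : DGMod A} {p : ℤ × ℤ} (h : M.AcyclicAt p) {x : M.carrier}
    (hx : x ∈ M.gr p) (hd : M.d x = 0) : ∃ y ∈ M.gr (p.1 - 1, p.2), M.d y = x := by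
  obtain ⟨y, hy⟩ := h x hx hd
  exact ⟨M.pr _ y, M.pr_mem _ y, by rw [← pr_d, hy, M.pr_same hx]⟩

theorem exact_of_acyclicAt {M : DGMod A} (h : ∀ p, M.AcyclicAt p) (x : M.carrier)
    (hx : M.d x = 0) : ∃ y, M.d y = x := by
  obtain ⟨s, hs⟩ := M.exists_sum_pr x
  have (p : ℤ × ℤ) : ∃ y, M.d y = M.pr p x := by
    refine h p _ (M.pr_mem p x) ?_
    have := M.pr_d (p.1 + 1, p.2) x
    rw [hx, map_zero] at this
    simpa using this.symm
  choose y hy using this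
  exact ⟨∑ p ∈ s, y p, by
    rw [map_sum]
    exact (Finset.sum_congr rfl fun p _ => hy p).trans hs.symm⟩

theorem acyclicAt_shift_iff (M : DGMod A) (n : ℤ) (p : ℤ × ℤ) :
    (M.shift n).AcyclicAt p ↔ M.AcyclicAt (p.1 + n, p.2) := by
  have key : ∀ e : ℤˣ, (∀ x ∈ M.gr (p.1 + n, p.2), e • M.d x = 0 → ∃ y, e • M.d y = x) ↔
      M.AcyclicAt (p.1 + n, p.2) := fun e => by
    rcases Int.units_eq_one_or e with rfl | rfl
    · simp [AcyclicAt]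
    · simp only [Units.neg_smul, one_smul, neg_eq_zero]
      exact forall₃_congr fun x _ _ =>
        ⟨fun ⟨y, hy⟩ => ⟨-y, by simpa using hy⟩, fun ⟨y, hy⟩ => ⟨-y, by simpa using hy⟩⟩
  exact key n.negOnePow

theorem acyclicAt_cone_iff {M N : DGMod A} (f : M ⟶ N) (p : ℤ × ℤ) :
    (cone f).AcyclicAt p ↔ ∀ x ∈ N.gr p, ∀ y ∈ M.gr (p.1 + 1, p.2), N.d x + f.lin y = 0 →
      M.d y = 0 → ∃ (x' : N.carrier) (y' : M.carrier), N.d x' + f.lin y' = x ∧ - M.d y' = y := by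
  constructor
  · intro h x hx y hy h₁ h₂
    obtain ⟨⟨x', y'⟩, h'⟩ := h (show (cone f).carrier from (x, y)) ⟨hx, hy⟩
      ((cone_d f x y).trans (Prod.ext h₁ (neg_eq_zero.2 h₂)))
    have := (cone_d f x' y').symm.trans h'
    exact ⟨x', y', congrArg Prod.fst this, congrArg Prod.snd this⟩
  · rintro h ⟨x, y⟩ ⟨hx, hy⟩ hd
    have hd' := (cone_d f x y).symm.trans hd
    obtain ⟨x', y', h₁, h₂⟩ := h x hx y hy (congrArg Prod.fst hd')
      (neg_eq_zero.1 (congrArg Prod.snd hd'))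
    exact ⟨(x', y'), (cone_d f x' y').trans (Prod.ext h₁ h₂)⟩

/-! ### Maps out of free modules -/

section

variable {M : DGMod A} {J : Type*} (b : Module.Basis J A.carrier M.carrier) {deg : J → ℤ × ℤ}

@[elab_as_elim]
theorem basis_induction {motive : M.carrier → Prop} (x : M.carrier) (h_zero : motive 0)
    (h_basis : ∀ j, motive (b j)) (h_add : ∀ x y, motive x → motive y → motive (x + y))
    (h_smul : ∀ p, ∀ a ∈ A.gr p, ∀ x, motive x → motive (a • x)) : motive x := by
  have hx : x ∈ Submodule.span A.carrier (Set.range b) := by simp [b.span_eq]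
  induction hx using Submodule.span_induction with
  | mem x hx =>
    obtain ⟨j, rfl⟩ := hx
    exact h_basis j
  | zero => exact h_zero
  | add x y _ _ hx hy => exact h_add x y hx hy
  | smul a x _ hx =>
    refine A.induction a (fun p a ha => h_smul p a ha x hx) (fun a a' h h' => ?_)
    rw [add_smul]
    exact h_add _ _ h h'

-- A linear map which respects the degrees of a basis commutes with all bihomogeneous projections;
-- that stronger claim is the one that passes to sums and scalar multiples. Differentials play no
-- role.
include b in
theorem linear_mem_of_basis {N : DGMod A} (hb : ∀ j, b j ∈ M.gr (deg j))
    (φ : M.carrier →ₗ[A.carrier] N.carrier) (hφ : ∀ j, φ (b j) ∈ N.gr (deg j)) (p : ℤ × ℤ)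
    (x : M.carrier) (hx : x ∈ M.gr p) : φ x ∈ N.gr p := by
  have key : ∀ x p, φ (M.pr p x) = N.pr p (φ x) := fun x => by
    refine basis_induction b x (by simp) (fun j p => ?_) (fun x y hx hy p => by simp [hx, hy])
      (fun q a ha x hx p => by rw [M.pr_smul p q a ha, map_smul, hx, map_smul, N.pr_smul p q a ha])
    by_cases h : p = deg j
    · subst h
      rw [M.pr_same (hb j), N.pr_same (hφ j)]
    · rw [M.pr_diff h (hb j), N.pr_diff h (hφ j), map_zero]
  rw [← M.pr_same hx, key]
  exact N.pr_mem _ _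

/-- The morphism from a dg module with a basis given by images of the basis elements. -/
def homOfBasis {N : DGMod A} (hb : ∀ j, b j ∈ M.gr (deg j)) (φ : M.carrier →ₗ[A.carrier] N.carrier)
    (hφ : ∀ j, φ (b j) ∈ N.gr (deg j)) (hd : ∀ j, φ (M.d (b j)) = N.d (φ (b j))) : M ⟶ N where
  lin := φ
  lin_mem := linear_mem_of_basis b hb φ hφ
  lin_d x := basis_induction b x (by simp) hd (fun x y hx hy => by simp [hx, hy])
    (fun p a ha x hx => by rw [M.leibniz', map_smul, N.leibniz', map_add, map_smul, map_smul, hx])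

end

theorem sgn_neg_one (a : A.carrier) : A.sgn (-1) a = A.sgn 1 a := A.sgn_congr (by decide) a

theorem sgn_one_d (a : A.carrier) : A.sgn 1 (A.d a) = - A.d (A.sgn 1 a) := by
  simp [A.sgn_d]

/-- The additive map underlying a linear map to `N[-1]`. -/
def unshift {M N : DGMod A} (φ : M.carrier →ₗ[A.carrier] (N.shift (-1)).carrier) :
    M.carrier →+ N.carrier := φ.toAddMonoidHom

/-- Honest linear maps to `N[-1]` are graded-linear maps to `N` of degree `-1`, so homotopies can be
prescribed freely on a basis. -/
theorem unshift_smul {M N : DGMod A} (φ : M.carrier →ₗ[A.carrier] (N.shift (-1)).carrier)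
    (a : A.carrier) (x : M.carrier) : unshift φ (a • x) = A.sgn 1 a • unshift φ x := by
  rw [← sgn_neg_one]
  exact φ.map_smul a x

/-- The two terms containing the differential of the scalar cancel, since `A.sgn 1` anticommutes
with `A.d`. Hence the homotopy identity need only be checked on generators. -/
theorem htpy_smul {M N : DGMod A} {f g : M ⟶ N}
    (φ : M.carrier →ₗ[A.carrier] (N.shift (-1)).carrier) {x : M.carrier}
    (hx : f.lin x - g.lin x = N.d (unshift φ x) + unshift φ (M.d x)) (a : A.carrier) :
    f.lin (a • x) - g.lin (a • x) = N.d (unshift φ (a • x)) + unshift φ (M.d (a • x)) := by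
  rw [map_smul, map_smul, ← smul_sub, hx, M.leibniz', map_add, unshift_smul, unshift_smul,
    unshift_smul, N.leibniz', sgn_one_d, A.sgn_one_sgn_one]
  simp only [neg_smul, smul_add]
  abel

theorem htpy_of_mem_span {M N : DGMod A} {f g : M ⟶ N}
    (φ : M.carrier →ₗ[A.carrier] (N.shift (-1)).carrier) {S : Set M.carrier}
    (hS : ∀ x ∈ S, f.lin x - g.lin x = N.d (unshift φ x) + unshift φ (M.d x))
    {x : M.carrier} (hx : x ∈ Submodule.span A.carrier S) :
    f.lin x - g.lin x = N.d (unshift φ x) + unshift φ (M.d x) := by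
  induction hx using Submodule.span_induction with
  | mem x hx => exact hS x hx
  | zero => simp
  | add x y _ _ hx hy =>
    simp only [map_add]
    rw [add_sub_add_comm, hx, hy]
    abel
  | smul a x _ hx => exact htpy_smul φ hx a

/-- A homotopy out of a dg module with a basis can be checked on the basis. -/
def htpyOfBasis {M N : DGMod A} {J : Type*} (b : Module.Basis J A.carrier M.carrier)
    {deg : J → ℤ × ℤ} (hb : ∀ j, b j ∈ M.gr (deg j)) {f g : M ⟶ N}
    (φ : M.carrier →ₗ[A.carrier] (N.shift (-1)).carrier)
    (hφ : ∀ j, φ (b j) ∈ (N.shift (-1)).gr (deg j))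
    (hd : ∀ j, f.lin (b j) - g.lin (b j) =
      N.d (unshift φ (b j)) + unshift φ (M.d (b j))) : Htpy f g :=
  Htpy.mk' (unshift φ) (fun n s x hx => linear_mem_of_basis b hb φ hφ _ x hx) (unshift_smul φ)
    fun x => htpy_of_mem_span φ (S := Set.range b) (by rintro _ ⟨j, rfl⟩; exact hd j)
      (by simp [b.span_eq])

/-! ### Cells -/

/-- A bihomogeneous basis with a rank function such that `d b_j` is a combination of the `b_i` of
smaller rank. -/
structure Cells (M : DGMod A) (J : Type*) where
  b : Module.Basis J A.carrier M.carrier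
  deg : J → ℤ × ℤ
  mem : ∀ j, b j ∈ M.gr (deg j)
  rank : J → ℕ
  d_b : ∀ j, M.d (b j) ∈ Submodule.span A.carrier (b '' {i | rank i < rank j})

/-- The rank function of a filtration. -/
def CellBasis.toCells {M : DGMod A} {J : Type u} (c : CellBasis M J) : Cells M J := by
  classical
  exact
  { b := c.b
    deg := fun j => (c.homogeneous j).choose
    mem := fun j => (c.homogeneous j).choose_spec
    rank := fun j => Nat.find (c.F_exhaustive j)
    d_b := fun j => by
      have h := Nat.find_spec (c.F_exhaustive j)
      -- The least index is positive because `F 0` is empty.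
      obtain ⟨n, hn⟩ : ∃ n, Nat.find (c.F_exhaustive j) = n + 1 := by
        refine Nat.exists_eq_add_one_of_ne_zero fun h' => ?_
        rw [h', c.F_zero] at h
        exact h
      rw [hn] at h
      refine Submodule.span_mono (Set.image_mono fun i hi => ?_) (c.d_b n j h)
      change Nat.find _ < Nat.find _
      rw [hn]
      exact Nat.lt_succ_of_le (Nat.find_le hi) }

/-- The filtration given by a rank function. -/
def Cells.toCellBasis {M : DGMod A} {J : Type u} (c : Cells M J) : CellBasis M J where
  b := c.b
  homogeneous j := ⟨_, c.mem j⟩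
  F n := {j | c.rank j < n}
  F_zero := by simp
  F_mono n m h j hj := lt_of_lt_of_le hj h
  F_exhaustive j := ⟨_, Nat.lt_succ_self _⟩
  d_b n j hj := Submodule.span_mono (Set.image_mono fun i hi =>
    lt_of_lt_of_le hi (Nat.lt_succ_iff.1 hj)) (c.d_b j)

theorem Cells.isCell {M : DGMod A} {J : Type u} (c : Cells M J) : M.IsCell :=
  ⟨J, ⟨c.toCellBasis⟩⟩

/-- Build cells from a well-founded relation on the basis. -/
def Cells.ofWellFounded {M : DGMod A} {J : Type*} (b : Module.Basis J A.carrier M.carrier)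
    (deg : J → ℤ × ℤ) (mem : ∀ j, b j ∈ M.gr (deg j)) (r : J → J → Prop) (hr : WellFounded r)
    (d_b : ∀ j, M.d (b j) ∈ Submodule.span A.carrier (b '' {i | r i j})) : Cells M J := by
  classical
  -- A natural number suffices as rank for any well-founded relation: each boundary involves
  -- finitely many basis elements, so the supremum is over a finite set.
  let R : J → ℕ := hr.fix fun j rec =>
    (b.repr (M.d (b j))).support.sup fun i => if h : r i j then rec i h + 1 else 0
  have hR : ∀ j, R j = (b.repr (M.d (b j))).support.sup
      fun i => if r i j then R i + 1 else 0 := fun j => by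
    refine (hr.fix_eq _ j).trans ?_
    simp only [dite_eq_ite]
    rfl
  exact
  { b := b
    deg := deg
    mem := mem
    rank := R
    d_b := fun j => by
      rw [b.mem_span_image]
      intro i hi
      have h : r i j := (b.mem_span_image.1 (d_b j)) hi
      have := Finset.le_sup (f := fun i => if r i j then R i + 1 else 0) hi
      rw [← hR, if_pos h] at this
      exact this }

/-- A map from a cell module is null-homotopic if the cohomology of the target vanishes in the
bidegrees of the cells. -/
theorem Cells.htpy_zero {M N : DGMod A} {J : Type*} (c : Cells M J)
    (hN : ∀ j, N.AcyclicAt (c.deg j)) (f : M ⟶ N) : Nonempty (Htpy f 0) := by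
  classical
  let L : (J → N.carrier) → M.carrier →ₗ[A.carrier] (N.shift (-1)).carrier :=
    fun η => c.b.constr ℕ (M' := (N.shift (-1)).carrier) η
  let φ : (J → N.carrier) → M.carrier →+ N.carrier := fun η => unshift (L η)
  have hφ : ∀ η j, φ η (c.b j) = η j :=
    fun η j => c.b.constr_basis ℕ (M' := (N.shift (-1)).carrier) η j
  -- On the boundary of a cell, the homotopy depends only on its values on cells of smaller rank;
  -- this makes the recursion for `η` legitimate.
  have hφ' : ∀ (η η' : J → N.carrier) (j : J), (∀ i, c.rank i < c.rank j → η i = η' i) →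
      φ η (M.d (c.b j)) = φ η' (M.d (c.b j)) := fun η η' j h => by
    refine LinearMap.eqOn_span (f := L η) (g := L η') ?_ (c.d_b j)
    rintro _ ⟨i, hi, rfl⟩
    exact ((hφ η i).trans (h i hi)).trans (hφ η' i).symm
  let pick : ℤ × ℤ → N.carrier → N.carrier := fun p z =>
    if h : ∃ y ∈ N.gr (p.1 - 1, p.2), N.d y = z then h.choose else 0
  have hpick : ∀ p z, (∃ y ∈ N.gr (p.1 - 1, p.2), N.d y = z) →
      pick p z ∈ N.gr (p.1 - 1, p.2) ∧ N.d (pick p z) = z := fun p z h => by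
    simp only [pick, dif_pos h]
    exact h.choose_spec
  let wf : WellFounded fun i j => c.rank i < c.rank j := (measure c.rank).wf
  -- The value on `b_j` is a chosen primitive of the obstruction `f b_j - h (d b_j)`. The default
  -- `0` of `pick` is never used, as `key` shows.
  let η : J → N.carrier := wf.fix fun j rec => pick (c.deg j)
    (f.lin (c.b j) - φ (fun i => if h : c.rank i < c.rank j then rec i h else 0) (M.d (c.b j)))
  have hη : ∀ j, η j = pick (c.deg j) (f.lin (c.b j) - φ η (M.d (c.b j))) := fun j => by
    refine (wf.fix_eq _ j).trans ?_
    refine congrArg (fun z : N.carrier => pick (c.deg j) (f.lin (c.b j) - z))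
      (hφ' _ _ j fun i hi => ?_)
    exact dif_pos hi
  have key : ∀ j, η j ∈ N.gr ((c.deg j).1 - 1, (c.deg j).2) ∧
      N.d (η j) = f.lin (c.b j) - φ η (M.d (c.b j)) := fun j => by
    induction j using wf.induction with
    | _ j ih =>
      rw [hη]
      refine hpick _ _ ((hN j).exists_mem (sub_mem (f.lin_mem _ _ (c.mem j)) ?_) ?_)
      -- Homogeneity of `η` is so far known only in smaller ranks, so the other values are replaced
      -- by zero.
      · let η' : J → N.carrier := fun i => if c.rank i < c.rank j then η i else 0
        rw [hφ' η η' j fun i hi => (if_pos hi).symm]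
        have := linear_mem_of_basis (N := N.shift (-1)) c.b c.mem (L η') (fun i => ?_) _ _
          (M.d_mem _ _ _ (c.mem j))
        · change φ η' (M.d (c.b j)) ∈ N.gr ((c.deg j).1 + 1 + -1, (c.deg j).2) at this
          rwa [add_neg_cancel_right] at this
        · change φ η' (c.b i) ∈ N.gr ((c.deg i).1 + -1, (c.deg i).2)
          rw [hφ]
          by_cases hi : c.rank i < c.rank j
          · simp only [η', if_pos hi]
            exact (ih i hi).1
          · simp only [η', if_neg hi]
            exact zero_mem _
      -- The obstruction is a cocycle: the homotopy identity, valid on the span of the lower cells,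
      -- is applied to `d b_j`, where it reads `f (d b_j) = d (h (d b_j))`.
      · have := htpy_of_mem_span (f := f) (g := 0) (L η) (S := c.b '' {i | c.rank i < c.rank j}) (by
          rintro _ ⟨i, hi, rfl⟩
          change _ = N.d (φ η _) + φ η _
          rw [hφ, (ih i hi).2, zero_lin, sub_zero, sub_add_cancel]) (c.d_b j)
        rw [zero_lin, sub_zero, M.d_d, map_zero, add_zero] at this
        rw [map_sub, ← f.lin_d, this, sub_self]
  refine ⟨htpyOfBasis c.b c.mem (L η) (fun j => ?_) (fun j => ?_)⟩
  · change φ η (c.b j) ∈ N.gr ((c.deg j).1 - 1, (c.deg j).2)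
    rw [hφ]
    exact (key j).1
  · change _ = N.d (φ η _) + φ η _
    rw [hφ, (key j).2, zero_lin, sub_zero, sub_add_cancel]

end DGMod

namespace DGMod

/-! ### Semifree dg modules -/

/-- The differential on the free module on `J` sending the basis elements to `bd`. -/
def semifreeD {J : Type u} (bd : J → J →₀ A.carrier) : (J →₀ A.carrier) →+ (J →₀ A.carrier) :=
  Finsupp.liftAddHom fun j => (Finsupp.singleAddHom j).comp A.d.toAddMonoidHom +
    ((smulAddHom A.carrier (J →₀ A.carrier)).flip (bd j)).comp (A.sgn 1).toAddMonoidHom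

theorem semifreeD_single {J : Type u} (bd : J → J →₀ A.carrier) (j : J) (a : A.carrier) :
    semifreeD bd (Finsupp.single j a) = Finsupp.single j (A.d a) + A.sgn 1 a • bd j := by
  simp [semifreeD]

theorem semifreeD_smul {J : Type u} (bd : J → J →₀ A.carrier) (a : A.carrier)
    (x : J →₀ A.carrier) :
    semifreeD bd (a • x) = A.d a • x + A.sgn 1 a • semifreeD bd x := by
  induction x using Finsupp.induction_linear with
  | zero => simp
  | add x y hx hy =>
    simp only [smul_add, map_add, hx, hy]
    abel
  | single _ c =>
    rw [Finsupp.smul_single, smul_eq_mul, semifreeD_single, semifreeD_single, A.leibniz', map_mul,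
      smul_add, Finsupp.single_add, Finsupp.smul_single, Finsupp.smul_single, smul_smul]
    simp only [smul_eq_mul]
    abel

/-- The data defining a semifree dg module. -/
structure Semifree (A : AdamsCDGA.{u}) (J : Type u) where
  deg : J → ℤ × ℤ
  bd : J → J →₀ A.carrier
  bd_mem : ∀ j i, bd j i ∈ A.gr ((deg j).1 + 1 - (deg i).1, (deg j).2 - (deg i).2)
  bd_bd : ∀ j, semifreeD bd (bd j) = 0

namespace Semifree

variable {J : Type u} (F : Semifree A J)

/-- The elements of bidegree `p` of a semifree dg module. -/
def gr (p : ℤ × ℤ) : AddSubgroup (J →₀ A.carrier) where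
  carrier := {x | ∀ j, x j ∈ A.gr (p - F.deg j)}
  zero_mem' _ := zero_mem _
  add_mem' hx hy j := add_mem (hx j) (hy j)
  neg_mem' hx j := neg_mem (hx j)

theorem single_mem {p : ℤ × ℤ} {j : J} {a : A.carrier} (ha : a ∈ A.gr (p - F.deg j)) :
    Finsupp.single j a ∈ F.gr p := fun i => by
  classical
  rw [Finsupp.single_apply]
  split_ifs with h
  · exact h ▸ ha
  · exact zero_mem _

/-- The projection to the piece of bidegree `p`. -/
def proj (p : ℤ × ℤ) : (J →₀ A.carrier) →+ (J →₀ A.carrier) :=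
  Finsupp.liftAddHom fun j => (Finsupp.singleAddHom j).comp (GradedRing.proj A.gr (p - F.deg j))

theorem proj_apply (p : ℤ × ℤ) (x : J →₀ A.carrier) (j : J) :
    F.proj p x j = GradedRing.proj A.gr (p - F.deg j) (x j) := by
  classical
  induction x using Finsupp.induction_linear with
  | zero => simp
  | add x y hx hy => simp [hx, hy]
  | single i c =>
    simp only [proj, Finsupp.liftAddHom_apply_single, AddMonoidHom.comp_apply,
      Finsupp.singleAddHom_apply, Finsupp.single_apply]
    split_ifs with h
    · rw [h]
    · rw [map_zero]

theorem semifreeD_mem {p : ℤ × ℤ} {x : J →₀ A.carrier} (hx : x ∈ F.gr p) :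
    semifreeD F.bd x ∈ F.gr (p.1 + 1, p.2) := by
  rw [← x.sum_single, Finsupp.sum, map_sum]
  refine sum_mem fun j _ => ?_
  rw [semifreeD_single]
  refine add_mem (F.single_mem ?_) fun i => ?_
  · have := A.d_mem _ _ _ (hx j)
    rwa [sub_add_eq_add_sub] at this
  · have := SetLike.GradedMul.mul_mem (A.sgn_mem 1 (hx j)) (F.bd_mem j i)
    rwa [show p - F.deg j + ((F.deg j).1 + 1 - (F.deg i).1, (F.deg j).2 - (F.deg i).2) =
      (p.1 + 1, p.2) - F.deg i from Prod.ext (by simp; ring) (by simp)] at this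

/-- The semifree dg module. -/
def mod : DGMod A where
  carrier := J →₀ A.carrier
  gr := F.gr
  isInternal := by
    refine isInternal_of_proj _ F.proj (fun p x hx => ?_) (fun p q h x hx => ?_) (fun x => ?_)
    · ext j
      rw [proj_apply, GradedRing.proj_apply, DirectSum.decompose_of_mem_same _ (hx j)]
    · ext j
      rw [proj_apply, GradedRing.proj_apply, DirectSum.decompose_of_mem_ne _ (hx j)]
      · rfl
      · simpa [sub_left_inj] using h.symm
    · induction x using Finsupp.induction_linear with
      | zero => exact zero_mem _
      | add x y hx hy => exact add_mem hx hy
      | single j a =>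
        refine A.induction a (fun q a ha => ?_) (fun a b ha hb => ?_)
        · refine AddSubgroup.mem_iSup_of_mem (q + F.deg j) (F.single_mem ?_)
          rwa [add_sub_cancel_right]
        · rw [Finsupp.single_add]
          exact add_mem ha hb
  smul_mem p q a x ha hx j := by
    rw [add_sub_assoc]
    exact SetLike.GradedMul.mul_mem ha (hx j)
  d := semifreeD F.bd
  d_mem n s x hx := F.semifreeD_mem hx
  d_d x := by
    induction x using Finsupp.induction_linear with
    | zero => simp
    | add x y hx hy => simp [hx, hy]
    | single j a =>
      rw [semifreeD_single, map_add, semifreeD_single, semifreeD_smul, F.bd_bd, A.d_d,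
        sgn_one_d]
      simp
  leibniz := leibniz_of _ (semifreeD_smul F.bd)

/-- The standard basis. -/
def basis : Module.Basis J A.carrier F.mod.carrier := Finsupp.basisSingleOne

theorem basis_mem (j : J) : F.basis j ∈ F.mod.gr (F.deg j) := by
  refine F.single_mem ?_
  rw [sub_self]
  exact SetLike.GradedOne.one_mem

theorem d_one : A.d 1 = 0 := by
  have := A.leibniz' 1 1
  simpa using this

theorem d_basis (j : J) : F.mod.d (F.basis j) = (show F.mod.carrier from F.bd j) := by
  refine (semifreeD_single F.bd j 1).trans ?_
  simp [d_one]

/-- A rank function gives a structure of cell module. -/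
def cells (rank : J → ℕ) (h : ∀ j, ∀ i ∈ (F.bd j).support, rank i < rank j) : Cells F.mod J where
  b := F.basis
  deg := F.deg
  mem := F.basis_mem
  rank := rank
  d_b j := by
    rw [d_basis, F.basis.mem_span_image]
    exact h j

end Semifree

/-! ### Attaching cells -/

/-- Formal cells of bidegrees in `S` over `M`: a formal boundary `∑ a_i c_i`, a bidegree `p`, and
an image in `M`. -/
inductive FormalCell (S : Set (ℤ × ℤ)) (M : DGMod A) : Type u
  | mk (n : ℕ) (a : Fin n → A.carrier) (c : Fin n → FormalCell S M) (p : S) (m : M.carrier) :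
    FormalCell S M

namespace FormalCell

variable {S : Set (ℤ × ℤ)} {M : DGMod A}

/-- The bidegree of a formal cell. -/
def deg : FormalCell S M → ℤ × ℤ
  | mk _ _ _ p _ => p

/-- The depth of a formal cell. -/
def depth : FormalCell S M → ℕ
  | mk _ _ c _ _ => (Finset.univ.sup fun i => (c i).depth) + 1

open scoped Classical in
/-- The boundary of a formal cell and its image in `M`, which are set to zero if they do not
satisfy the conditions which a cell has to satisfy. -/
def data : FormalCell S M → (FormalCell S M →₀ A.carrier) × M.carrier
  | mk _ a c p m =>
    if (∀ i, a i ∈ A.gr (p.1.1 + 1 - (c i).deg.1, p.1.2 - (c i).deg.2)) ∧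
        ∑ i, (Finsupp.single (c i) (A.d (a i)) + A.sgn 1 (a i) • (c i).data.1) = 0 ∧
        ∑ i, a i • (c i).data.2 = M.d m ∧ m ∈ M.gr p then
      (∑ i, Finsupp.single (c i) (a i), m)
    else 0

/-- Ill-formed data were replaced by zero, which is again legitimate: such a cell is a cocycle
mapping to zero. So all formal cells can be used, without cutting out a subtype. -/
theorem data_spec (c : FormalCell S M) :
    (∀ i, c.data.1 i ∈ A.gr (c.deg.1 + 1 - i.deg.1, c.deg.2 - i.deg.2)) ∧
      semifreeD (fun c : FormalCell S M => c.data.1) c.data.1 = 0 ∧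
      Finsupp.linearCombination A.carrier (fun c : FormalCell S M => c.data.2) c.data.1 =
        M.d c.data.2 ∧ c.data.2 ∈ M.gr c.deg ∧
      ∀ i ∈ c.data.1.support, i.depth < c.depth := by
  classical
  obtain ⟨n, a, c, p, m⟩ := c
  rw [data]
  split_ifs with h
  · obtain ⟨h₁, h₂, h₃, h₄⟩ := h
    refine ⟨fun i => ?_, ?_, ?_, h₄, fun i hi => ?_⟩
    · rw [Finsupp.finsetSum_apply]
      refine sum_mem fun k _ => ?_
      rw [Finsupp.single_apply]
      split_ifs with h
      · exact h ▸ h₁ k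
      · exact zero_mem _
    · rw [map_sum, ← h₂]
      exact Finset.sum_congr rfl fun i _ => semifreeD_single _ _ _
    · rw [map_sum, ← h₃]
      exact Finset.sum_congr rfl fun i _ => Finsupp.linearCombination_single _ _ _
    · obtain ⟨k, -, hk⟩ := Finset.mem_biUnion.1 (Finsupp.support_finsetSum hi)
      obtain rfl := Finset.mem_singleton.1 (Finsupp.support_single_subset hk)
      rw [depth]
      exact Nat.lt_succ_of_le (Finset.le_sup (f := fun i => (c i).depth) (Finset.mem_univ k))
  · simp

/-- Every admissible boundary and image is realised by some formal cell. Thus the free module on all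
formal cells is already closed under attaching cells, and no colimit of successive attachments is
needed. -/
theorem exists_data_eq (p : S) (x : FormalCell S M →₀ A.carrier) (m : M.carrier)
    (h₁ : ∀ i, x i ∈ A.gr (p.1.1 + 1 - i.deg.1, p.1.2 - i.deg.2))
    (h₂ : semifreeD (fun c : FormalCell S M => c.data.1) x = 0)
    (h₃ : Finsupp.linearCombination A.carrier (fun c : FormalCell S M => c.data.2) x = M.d m)
    (h₄ : m ∈ M.gr p) : ∃ c : FormalCell S M, c.data = (x, m) := by
  classical
  have key : ∀ {G : Type u} [AddCommGroup G] (φ : FormalCell S M → G),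
      ∑ k : Fin x.support.card, φ (x.support.equivFin.symm k) = ∑ i ∈ x.support, φ i := fun φ => by
    exact (Equiv.sum_comp x.support.equivFin.symm (fun i => φ i)).trans
      (Finset.sum_coe_sort x.support φ)
  let c : Fin x.support.card → FormalCell S M := fun k => x.support.equivFin.symm k
  have hx : ∑ k, Finsupp.single (c k) (x (c k)) = x :=
    (key fun i => Finsupp.single i (x i)).trans x.sum_single
  refine ⟨mk _ (fun k => x (c k)) c p m, ?_⟩
  rw [data, if_pos, hx]
  refine ⟨fun k => h₁ _, ?_, ?_, h₄⟩
  · refine Eq.trans ?_ ((congrArg (semifreeD _) hx).trans h₂)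
    rw [map_sum]
    simp only [semifreeD_single]
  · refine Eq.trans ?_ ((congrArg (Finsupp.linearCombination _ _) hx).trans h₃)
    rw [map_sum]
    simp only [Finsupp.linearCombination_single]

end FormalCell

/-- The semifree dg module on all formal cells. -/
def formalCells (S : Set (ℤ × ℤ)) (M : DGMod A) : Semifree A (FormalCell S M) where
  deg := FormalCell.deg
  bd c := c.data.1
  bd_mem c := c.data_spec.1
  bd_bd c := c.data_spec.2.1

/-- For every set `S` of bidegrees, there is a map to `M` from a cell module with cells of
bidegrees in `S` such that the cohomology of the cone vanishes in the bidegrees in `S`. -/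
theorem exists_cells_attached (M : DGMod A) (S : Set (ℤ × ℤ)) :
    ∃ (P : DGMod A) (J : Type u) (c : Cells P J) (g : P ⟶ M), (∀ j, c.deg j ∈ S) ∧
      ∀ p ∈ S, (cone g).AcyclicAt p := by
  let F := formalCells S M
  let φ : F.mod.carrier →ₗ[A.carrier] M.carrier :=
    Finsupp.linearCombination A.carrier (fun c : FormalCell S M => c.data.2)
  have hφ : ∀ c, φ (F.basis c) = c.data.2 := fun c =>
    (Finsupp.linearCombination_single _ _ _).trans (one_smul _ _)
  let g : F.mod ⟶ M := homOfBasis F.basis F.basis_mem φ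
    (fun c => by rw [hφ]; exact c.data_spec.2.2.2.1)
    (fun c => by rw [hφ, F.d_basis]; exact c.data_spec.2.2.1)
  refine ⟨F.mod, _, F.cells FormalCell.depth fun c => c.data_spec.2.2.2.2, g, ?_, ?_⟩
  · rintro ⟨n, a, c, p, m⟩
    exact p.2
  · intro p hp
    rw [acyclicAt_cone_iff]
    intro m hm x hx h₁ h₂
    -- A cocycle `(m, x)` of the cone satisfies `d m + g x = 0` and `d x = 0`. So a cell with
    -- boundary `x` and image `-m` exists, and `(0, -c)` is a primitive of `(m, x)`.
    obtain ⟨c, hc⟩ := FormalCell.exists_data_eq ⟨p, hp⟩ x (- m) (fun i => hx i) h₂ (by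
      rw [map_neg]
      exact eq_neg_of_add_eq_zero_right h₁) (neg_mem hm)
    refine ⟨0, - F.basis c, ?_, ?_⟩
    · change _ + φ (- F.basis c) = m
      rw [map_neg, hφ, hc, map_zero, zero_add, neg_neg]
    · rw [map_neg, neg_neg, F.d_basis]
      exact congrArg Prod.fst hc

end DGMod

open DGMod

/-! ### Morphisms in the derived category -/

theorem exists_toD_obj_iso (X : DCat A) : ∃ M : DGMod A, Nonempty ((toD A).obj M ≅ X) := by
  have := Localization.essSurj (quasiIso A).Q (quasiIso A)
  obtain ⟨⟨M⟩, ⟨e⟩⟩ := this.mem_essImage X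
  exact ⟨M, ⟨e⟩⟩

theorem exists_cone_distinguished {M N : DGMod A} (f : M ⟶ N) :
    ∃ h, Triangle.mk ((toD A).map f) ((toD A).map (coneInl f)) h ∈ distTriang (DCat A) :=
  ⟨_, (quasiIso A).Q.map_distinguished _ (coneTriangleK_mem f)⟩

theorem isIso_toD_map {M N : DGMod A} (f : M ⟶ N)
    (h₁ : ∀ x, M.d x = 0 → ∀ y, N.d y = f.lin x → ∃ z, M.d z = x)
    (h₂ : ∀ y, N.d y = 0 → ∃ x, M.d x = 0 ∧ ∃ z, N.d z = f.lin x - y) :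
    IsIso ((toD A).map f) :=
  Localization.inverts (quasiIso A).Q (quasiIso A) _ ((isIso_homologyK_iff f).2 ⟨h₁, h₂⟩)

theorem isIso_toD_map_of_bijective {M N : DGMod A} (f : M ⟶ N) (hf : Function.Bijective f.lin) :
    IsIso ((toD A).map f) := by
  refine isIso_toD_map f (fun x _ y hy => ?_) (fun y hy => ?_)
  · obtain ⟨z, rfl⟩ := hf.2 y
    exact ⟨z, hf.1 ((f.lin_d z).trans hy)⟩
  · obtain ⟨x, rfl⟩ := hf.2 y
    exact ⟨x, hf.1 (by rw [f.lin_d, hy, map_zero]), 0, by simp⟩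

/-- The zero endomorphism is then a quasi-isomorphism and becomes invertible. -/
theorem isZero_toD_of_acyclic {M : DGMod A} (hM : ∀ p, M.AcyclicAt p) :
    IsZero ((toD A).obj M) := by
  have h : IsIso ((toD A).map (0 : M ⟶ M)) :=
    isIso_toD_map _ (fun x hx _ _ => exact_of_acyclicAt hM x hx) (fun y hy => by
      obtain ⟨z, hz⟩ := exact_of_acyclicAt hM (-y) (by simp [hy])
      exact ⟨0, map_zero _, z, by simp [hz]⟩)
  rw [Functor.map_zero] at h
  rw [IsZero.iff_id_eq_zero, ← cancel_mono (0 : (toD A).obj M ⟶ (toD A).obj M)]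
  simp

theorem toD_map_eq_of_htpy {M N : DGMod A} {f g : M ⟶ N} (h : Htpy f g) :
    (toD A).map f = (toD A).map g := congrArg (quasiIso A).Q.map (toK_map_eq h)

theorem acyclicAt_of_mem_homologicalKernel {N : DGMod A}
    (hN : (homologyK A).homologicalKernel ((toK A).obj N)) (p : ℤ × ℤ) : N.AcyclicAt p := by
  intro x _ hx
  have h := (hN 0).of_iso ((homologyK A).mapIso ((shiftFunctorZero (KCat A) ℤ).app _).symm)
  have : Subsingleton N.totalH := AddCommGrpCat.subsingleton_of_isZero h
  exact (totalH_mk_eq_zero ⟨x, hx⟩).1 (Subsingleton.elim (α := N.totalH) _ _)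

/-- Cell modules are K-projective: an acyclic target offers no obstruction at any cell. -/
theorem DGMod.Cells.leftOrthogonal {P : DGMod A} {J : Type*} (c : Cells P J) :
    (homologyK A).homologicalKernel.leftOrthogonal ((toK A).obj P) := by
  rintro ⟨N⟩ f hN
  obtain ⟨f, rfl⟩ := (toK A).map_surjective f
  obtain ⟨h⟩ := c.htpy_zero (fun j => acyclicAt_of_mem_homologicalKernel hN _) f
  rw [toK_map_eq h, Functor.map_zero]

/-- In a Verdier quotient, morphisms out of an object left orthogonal to the kernel are unchanged.
This reduces questions about maps between cell modules in `D_A` to chain maps and homotopies. -/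
theorem DGMod.Cells.Q_map_bijective {P : DGMod A} {J : Type*} (c : Cells P J) (Y : KCat A) :
    Function.Bijective ((quasiIso A).Q.map : ((toK A).obj P ⟶ Y) → _) := by
  have : (quasiIso A).Q.IsLocalization (homologyK A).homologicalKernel.trW := by
    rw [← quasiIso_eq]
    infer_instance
  exact c.leftOrthogonal.map_bijective_of_isTriangulated _ Y

theorem DGMod.Cells.toD_map_surjective {P N : DGMod A} {J : Type*} (c : Cells P J)
    (f : (toD A).obj P ⟶ (toD A).obj N) : ∃ g : P ⟶ N, (toD A).map g = f := by
  obtain ⟨g, rfl⟩ := (c.Q_map_bijective ((toK A).obj N)).2 f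
  obtain ⟨g, rfl⟩ := (toK A).map_surjective g
  exact ⟨g, rfl⟩

theorem DGMod.Cells.htpy_of_toD_map_eq {P N : DGMod A} {J : Type*} (c : Cells P J)
    {f g : P ⟶ N} (h : (toD A).map f = (toD A).map g) : Nonempty (Htpy f g) :=
  toK_htpy ((c.Q_map_bijective ((toK A).obj N)).1 h)

/-- Maps in the derived category out of a cell module vanish if the cohomology of the target
vanishes in the bidegrees of the cells. -/
theorem DGMod.Cells.toD_hom_eq_zero {P N : DGMod A} {J : Type*} (c : Cells P J)
    (hN : ∀ j, N.AcyclicAt (c.deg j)) (f : (toD A).obj P ⟶ (toD A).obj N) : f = 0 := by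
  obtain ⟨f, rfl⟩ := c.toD_map_surjective f
  obtain ⟨h⟩ := c.htpy_zero hN f
  rw [toD_map_eq_of_htpy h, Functor.map_zero]

/-! ### Free modules of rank one -/

/-- The data of the free module on a generator of bidegree `p`. -/
def sphereData (A : AdamsCDGA.{u}) (p : ℤ × ℤ) : Semifree A PUnit.{u + 1} where
  deg _ := p
  bd _ := 0
  bd_mem _ _ := zero_mem _
  bd_bd _ := map_zero _

/-- The free module on a generator of bidegree `p`. -/
def sphere (A : AdamsCDGA.{u}) (p : ℤ × ℤ) : DGMod A := (sphereData A p).mod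

/-- The generator of `sphere A p`. -/
def sphereGen (A : AdamsCDGA.{u}) (p : ℤ × ℤ) : (sphere A p).carrier :=
  (sphereData A p).basis PUnit.unit

/-- The cell structure of `sphere A p`. -/
def sphereCells (A : AdamsCDGA.{u}) (p : ℤ × ℤ) : Cells (sphere A p) PUnit.{u + 1} :=
  (sphereData A p).cells 0 (fun _ _ h => by simp [sphereData] at h)

theorem d_sphereGen (p : ℤ × ℤ) : (sphere A p).d (sphereGen A p) = 0 :=
  (sphereData A p).d_basis _

/-- The map out of a free module of rank one given by a cocycle. -/
def ofCocycle {M : DGMod A} {p : ℤ × ℤ} {x : M.carrier} (hx : x ∈ M.gr p) (hd : M.d x = 0) :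
    sphere A p ⟶ M :=
  homOfBasis (sphereData A p).basis (sphereData A p).basis_mem
    ((sphereData A p).basis.constr ℕ fun _ => x) (fun j => by rw [Module.Basis.constr_basis]; exact hx)
    (fun j => by
      rw [Module.Basis.constr_basis, hd, (sphereData A p).d_basis]
      exact map_zero _)

theorem ofCocycle_gen {M : DGMod A} {p : ℤ × ℤ} {x : M.carrier} (hx : x ∈ M.gr p)
    (hd : M.d x = 0) : (ofCocycle hx hd).lin (sphereGen A p) = x :=
  (sphereData A p).basis.constr_basis ℕ _ _

/-! ### Vanishing of cohomology in a bidegree, as a property of objects of `D_A`. -/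

/-- The objects of the derived category with vanishing cohomology in bidegree `p`. -/
def vanishAt (A : AdamsCDGA.{u}) (p : ℤ × ℤ) : ObjectProperty (DCat A) :=
  fun X => ∀ f : (toD A).obj (sphere A p) ⟶ X, f = 0

instance (p : ℤ × ℤ) : (vanishAt A p).IsClosedUnderIsomorphisms where
  of_iso e h f := by
    rw [← cancel_mono e.inv, h (f ≫ e.inv), zero_comp]

/-- Spheres corepresent cohomology: maps out of one are cocycles, and a null-homotopy evaluated at
the generator is a primitive. -/
theorem vanishAt_toD_iff (M : DGMod A) (p : ℤ × ℤ) :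
    vanishAt A p ((toD A).obj M) ↔ M.AcyclicAt p := by
  constructor
  · intro h x hx hd
    have h' := h ((toD A).map (ofCocycle hx hd))
    rw [← Functor.map_zero] at h'
    obtain ⟨H⟩ := (sphereCells A p).htpy_of_toD_map_eq h'
    refine ⟨H.h (sphereGen A p), ?_⟩
    have := H.comm (sphereGen A p)
    rwa [d_sphereGen, map_zero, add_zero, ofCocycle_gen, zero_lin, sub_zero, eq_comm] at this
  · exact fun h f => (sphereCells A p).toD_hom_eq_zero (fun _ => h) f

theorem isZero_of_vanishAt {X : DCat A} (h : ∀ p, vanishAt A p X) : IsZero X := by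
  obtain ⟨M, ⟨e⟩⟩ := exists_toD_obj_iso X
  exact (isZero_toD_of_acyclic fun p =>
    (vanishAt_toD_iff M p).1 ((vanishAt A p).prop_of_iso e.symm (h p))).of_iso e.symm

theorem vanishAt_of_isZero {X : DCat A} (h : IsZero X) (p : ℤ × ℤ) : vanishAt A p X :=
  fun _ => h.eq_of_tgt _ _

theorem vanishAt_shift_iff (X : DCat A) (n : ℤ) (p : ℤ × ℤ) :
    vanishAt A p (X⟦n⟧) ↔ vanishAt A (p.1 + n, p.2) X := by
  obtain ⟨M, ⟨e⟩⟩ := exists_toD_obj_iso X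
  rw [← (vanishAt A _).prop_iff_of_iso e,
    ← (vanishAt A p).prop_iff_of_iso ((shiftFunctor (DCat A) n).mapIso e),
    vanishAt_toD_iff, ← acyclicAt_shift_iff, ← vanishAt_toD_iff]
  exact ((vanishAt A p).prop_iff_of_iso (((toD A).commShiftIso n).app M)).symm

theorem vanishAt_obj₂ {T : Triangle (DCat A)} (hT : T ∈ distTriang (DCat A)) {p : ℤ × ℤ}
    (h₁ : vanishAt A p T.obj₁) (h₃ : vanishAt A p T.obj₃) : vanishAt A p T.obj₂ := fun f => by
  obtain ⟨g, rfl⟩ := T.coyoneda_exact₂ hT f (h₃ _)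
  rw [h₁ g, zero_comp]

theorem vanishAt_obj₃ {T : Triangle (DCat A)} (hT : T ∈ distTriang (DCat A)) {p : ℤ × ℤ}
    (h₂ : vanishAt A p T.obj₂) (h₁ : vanishAt A (p.1 + 1, p.2) T.obj₁) : vanishAt A p T.obj₃ :=
  vanishAt_obj₂ (rot_of_distTriang _ hT) h₂ ((vanishAt_shift_iff _ _ _).2 h₁)

namespace DGMod

/-! ### Shifts and cones of cell modules -/

/-- The automorphism `A.sgn n` of `A`. -/
def sgnEquiv (A : AdamsCDGA.{u}) (n : ℤ) : A.carrier ≃+* A.carrier :=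
  { A.sgn n with
    invFun := A.sgn (-n)
    left_inv := fun a => by
      change A.sgn (-n) (A.sgn n a) = a
      rw [← A.sgn_add, neg_add_cancel, A.sgn_zero]
    right_inv := fun a => by
      change A.sgn n (A.sgn (-n) a) = a
      rw [← A.sgn_add, add_neg_cancel, A.sgn_zero] }

theorem sgn_sgn_neg (n : ℤ) (a : A.carrier) : A.sgn n (A.sgn (-n) a) = a :=
  (sgnEquiv A n).apply_symm_apply a

/-- A basis of `M` is a basis of `M[n]`. -/
def shiftBasis {M : DGMod A} {J : Type*} (b : Module.Basis J A.carrier M.carrier) (n : ℤ) :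
    Module.Basis J A.carrier (M.shift n).carrier :=
  @Module.Basis.mapCoeffs J A.carrier M.carrier _ _ _ b A.carrier _ (M.shift n).module
    (sgnEquiv A (-n)) (fun a x => congrArg (fun c : A.carrier => c • (show M.carrier from x))
      (sgn_sgn_neg n a))

theorem shiftBasis_apply {M : DGMod A} {J : Type*} (b : Module.Basis J A.carrier M.carrier)
    (n : ℤ) (j : J) : shiftBasis b n j = (show (M.shift n).carrier from b j) :=
  @Module.Basis.mapCoeffs_apply J A.carrier M.carrier _ _ _ b A.carrier _ (M.shift n).module
    (sgnEquiv A (-n)) (fun a x => congrArg (fun c : A.carrier => c • (show M.carrier from x))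
      (sgn_sgn_neg n a)) j

theorem mem_span_shift {M : DGMod A} (n : ℤ) {S : Set M.carrier} {x : M.carrier}
    (hx : x ∈ Submodule.span A.carrier S) :
    (show (M.shift n).carrier from x) ∈
      Submodule.span A.carrier (show Set (M.shift n).carrier from S) := by
  induction hx using Submodule.span_induction with
  | mem x hx => exact Submodule.subset_span hx
  | zero => exact zero_mem _
  | add x y _ _ hx hy => exact add_mem hx hy
  | smul a x _ hx =>
    have h := Submodule.smul_mem _ (A.sgn (-n) a) hx
    have h' : A.sgn (-n) a • (show (M.shift n).carrier from x) =
        (show (M.shift n).carrier from a • x) :=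
      congrArg (fun c : A.carrier => c • (show M.carrier from x)) (sgn_sgn_neg n a)
    rwa [h'] at h

/-- The cells of `M[n]`. -/
def Cells.shift {M : DGMod A} {J : Type*} (c : Cells M J) (n : ℤ) : Cells (M.shift n) J where
  b := shiftBasis c.b n
  deg j := ((c.deg j).1 - n, (c.deg j).2)
  mem j := by
    rw [shiftBasis_apply]
    change c.b j ∈ M.gr ((c.deg j).1 - n + n, (c.deg j).2)
    rw [sub_add_cancel]
    exact c.mem j
  rank := c.rank
  d_b j := by
    rw [shiftBasis_apply]
    have h := mem_span_shift n (c.d_b j)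
    rw [show ((shiftBasis c.b n : J → (M.shift n).carrier) '' {i | c.rank i < c.rank j}) =
      (show Set (M.shift n).carrier from c.b '' {i | c.rank i < c.rank j}) from
      Set.image_congr fun i _ => shiftBasis_apply c.b n i]
    exact zsmul_mem h (n.negOnePow : ℤ)

/-- The inclusion of `M[1]` in the cone. -/
def coneInr {M N : DGMod A} (f : M ⟶ N) : (M.shift 1).carrier →ₗ[A.carrier] (cone f).carrier :=
  LinearMap.inr A.carrier N.carrier (M.shift 1).carrier

/-- The basis of the cone. -/
def coneBasis {M N : DGMod A} {J K : Type*} (b : Module.Basis K A.carrier N.carrier)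
    (b' : Module.Basis J A.carrier (M.shift 1).carrier) (f : M ⟶ N) :
    Module.Basis (K ⊕ J) A.carrier (cone f).carrier :=
  (b.prod b' : Module.Basis (K ⊕ J) A.carrier (N.carrier × (M.shift 1).carrier))

theorem coneBasis_inl {M N : DGMod A} {J K : Type*} (b : Module.Basis K A.carrier N.carrier)
    (b' : Module.Basis J A.carrier (M.shift 1).carrier) (f : M ⟶ N) (k : K) :
    coneBasis b b' f (Sum.inl k) = (coneInl f).lin (b k) :=
  Prod.ext (b.prod_apply_inl_fst b' k) (b.prod_apply_inl_snd b' k)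

theorem coneBasis_inr {M N : DGMod A} {J K : Type*} (b : Module.Basis K A.carrier N.carrier)
    (b' : Module.Basis J A.carrier (M.shift 1).carrier) (f : M ⟶ N) (j : J) :
    coneBasis b b' f (Sum.inr j) = coneInr f (b' j) :=
  Prod.ext (b.prod_apply_inr_fst b' j) (b.prod_apply_inr_snd b' j)

theorem cone_d_inr {M N : DGMod A} (f : M ⟶ N) (x : (M.shift 1).carrier) :
    (cone f).d (coneInr f x) =
      (coneInl f).lin (f.lin (show M.carrier from x)) + coneInr f ((M.shift 1).d x) := by
  refine Prod.ext ?_ (zero_add ((M.shift 1).d x)).symm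
  change N.d 0 + f.lin (show M.carrier from x) = f.lin (show M.carrier from x) + 0
  rw [map_zero, zero_add, add_zero]

theorem map_mem_span {R M N ι κ : Type*} [Ring R] [AddCommGroup M] [Module R M] [AddCommGroup N]
    [Module R N] (f : M →ₗ[R] N) (b : ι → M) (b' : κ → N) (g : ι → κ)
    (h : ∀ i, b' (g i) = f (b i)) {S : Set ι} {T : Set κ} (hST : ∀ i ∈ S, g i ∈ T) {x : M}
    (hx : x ∈ Submodule.span R (b '' S)) : f x ∈ Submodule.span R (b' '' T) := by
  have := Submodule.mem_map_of_mem (f := f) hx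
  rw [Submodule.map_span] at this
  refine Submodule.span_mono ?_ this
  rintro _ ⟨_, ⟨i, hi, rfl⟩, rfl⟩
  exact ⟨g i, hST i hi, h i⟩

/-- The cells of the cone. -/
def Cells.cone {M N : DGMod A} {J K : Type*} (c : Cells M J) (e : Cells N K) (f : M ⟶ N) :
    Cells (cone f) (K ⊕ J) :=
  Cells.ofWellFounded (coneBasis e.b (c.shift 1).b f) (Sum.elim e.deg (c.shift 1).deg)
    (by
      rintro (k | j)
      · rw [coneBasis_inl]
        exact ⟨e.mem k, zero_mem _⟩
      · rw [coneBasis_inr]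
        exact ⟨zero_mem _, (c.shift 1).mem j⟩)
    -- All cells of `N` precede those of `M[1]`, because the boundary of a cell of `M[1]` contains
    -- its image under `f`, which may involve cells of `N` of any rank. Ranks in `N` may be
    -- unbounded, so an order is given instead of a rank.
    (Sum.Lex (fun i j => e.rank i < e.rank j)
      (fun i j => (c.shift 1).rank i < (c.shift 1).rank j))
    (Sum.lex_wf (measure e.rank).wf (measure (c.shift 1).rank).wf)
    (by
      have hl := coneBasis_inl e.b (c.shift 1).b f
      have hr := coneBasis_inr e.b (c.shift 1).b f
      rintro (k | j)
      · rw [hl, ← (coneInl f).lin_d]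
        have := map_mem_span (coneInl f).lin e.b (coneBasis e.b (c.shift 1).b f) Sum.inl hl
          (T := {i | Sum.Lex (fun i j => e.rank i < e.rank j)
            (fun i j => (c.shift 1).rank i < (c.shift 1).rank j) i (Sum.inl k)})
          (fun i hi => Sum.Lex.inl hi) (e.d_b k)
        exact this
      · rw [hr, cone_d_inr]
        have h₁ := map_mem_span (coneInl f).lin e.b (coneBasis e.b (c.shift 1).b f) Sum.inl hl
          (S := Set.univ) (T := {i | Sum.Lex (fun i j => e.rank i < e.rank j)
            (fun i j => (c.shift 1).rank i < (c.shift 1).rank j) i (Sum.inr j)})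
          (x := f.lin (show M.carrier from (c.shift 1).b j))
          (fun i _ => Sum.Lex.sep _ _) (by
            rw [Set.image_univ, e.b.span_eq]
            trivial)
        have h₂ := map_mem_span (coneInr f) (c.shift 1).b (coneBasis e.b (c.shift 1).b f) Sum.inr hr
          (T := {i | Sum.Lex (fun i j => e.rank i < e.rank j)
            (fun i j => (c.shift 1).rank i < (c.shift 1).rank j) i (Sum.inr j)})
          (fun i hi => Sum.Lex.inr hi) ((c.shift 1).d_b j)
        exact add_mem h₁ h₂)

theorem IsFinCell.cone {M N : DGMod A} (hM : M.IsFinCell) (hN : N.IsFinCell) (f : M ⟶ N) :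
    (cone f).IsFinCell := by
  obtain ⟨J, _, ⟨c⟩⟩ := hM
  obtain ⟨K, _, ⟨e⟩⟩ := hN
  exact ⟨_, inferInstance, ⟨(Cells.cone c.toCells e.toCells f).toCellBasis⟩⟩

theorem IsFinCell.shift {M : DGMod A} (hM : M.IsFinCell) (n : ℤ) : (M.shift n).IsFinCell := by
  obtain ⟨J, hJ, ⟨c⟩⟩ := hM
  exact ⟨J, hJ, ⟨(c.toCells.shift n).toCellBasis⟩⟩

/-! ### Coordinates -/

/-- Taking coordinates is a linear map to the semifree module with the same degrees. Since
`linear_mem_of_basis` ignores differentials, the target may be given the zero boundary. -/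
theorem Cells.repr_mem {M : DGMod A} {J : Type u} (c : Cells M J) {p : ℤ × ℤ} {x : M.carrier}
    (hx : x ∈ M.gr p) (j : J) : c.b.repr x j ∈ A.gr (p - c.deg j) := by
  let F : Semifree A J :=
    { deg := c.deg
      bd := 0
      bd_mem := fun _ _ => zero_mem _
      bd_bd := fun _ => map_zero _ }
  refine linear_mem_of_basis (N := F.mod) c.b c.mem c.b.repr.toLinearMap (fun j => ?_) p x hx j
  have := F.basis_mem j
  convert this using 1
  exact c.b.repr_self j

end DGMod

/-! ### Consequences of `A(0) = ℚ · 1` and of the absence of negative weights. -/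

theorem AdamsCDGA.eq_zero_of_mem_gr_zero {n : ℤ} (hn : n ≠ 0) {a : A.carrier}
    (ha : a ∈ A.gr (n, 0)) : a = 0 := by
  have h : a ∈ A.gr (0, 0) := by
    have h₁ : a ∈ ⨆ n : ℤ, A.gr (n, 0) := Submodule.mem_iSup_of_mem n ha
    rw [A.adams_zero] at h₁
    exact Submodule.span_le.2 (Set.singleton_subset_iff.2 SetLike.GradedOne.one_mem) h₁
  rw [← DirectSum.decompose_of_mem_same A.gr h, DirectSum.decompose_of_mem_ne A.gr ha]
  simpa using hn

theorem AdamsCDGA.exists_eq_smul_one {a : A.carrier} (ha : a ∈ A.gr (0, 0)) :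
    ∃ q : ℚ, a = q • (1 : A.carrier) := by
  have h₁ : a ∈ ⨆ n : ℤ, A.gr (n, 0) := Submodule.mem_iSup_of_mem 0 ha
  rw [A.adams_zero] at h₁
  obtain ⟨q, hq⟩ := Submodule.mem_span_singleton.1 h₁
  exact ⟨q, hq.symm⟩

theorem AdamsCDGA.eq_zero_of_neg {p : ℤ × ℤ} (hp : p.2 < 0) {a : A.carrier}
    (ha : a ∈ A.gr p) : a = 0 := by
  have := A.adams_neg p.1 p.2 hp
  rw [Prod.mk.eta] at this
  rw [this] at ha
  exact ha

/-- All coordinates would have negative weight in `A`. -/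
theorem DGMod.Cells.eq_zero_of_lt {M : DGMod A} {J : Type u} (c : Cells M J) {p : ℤ × ℤ}
    (hp : ∀ j, p.2 < (c.deg j).2) {x : M.carrier} (hx : x ∈ M.gr p) : x = 0 := by
  rw [← c.b.repr.map_eq_zero_iff]
  ext j
  exact AdamsCDGA.eq_zero_of_neg (by simpa using hp j) (c.repr_mem hx j)

theorem DGMod.Cells.acyclicAt_of_lt {M : DGMod A} {J : Type u} (c : Cells M J) {p : ℤ × ℤ}
    (hp : ∀ j, p.2 < (c.deg j).2) : M.AcyclicAt p := fun x hx _ =>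
  ⟨0, by rw [c.eq_zero_of_lt hp hx, map_zero]⟩

open DGMod

/-! ### Approximation by cell modules -/

theorem distinguished_of_iso₂ {C : Type*} [Category C] [Preadditive C] [HasZeroObject C]
    [HasShift C ℤ] [∀ n : ℤ, (shiftFunctor C n).Additive] [Pretriangulated C] {X Y Z Y' : C}
    {f : X ⟶ Y} {g : Y ⟶ Z} {h : Z ⟶ X⟦(1 : ℤ)⟧} (hT : Triangle.mk f g h ∈ distTriang C)
    (e : Y ≅ Y') : Triangle.mk (f ≫ e.hom) (e.inv ≫ g) h ∈ distTriang C :=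
  isomorphic_distinguished _ hT _ (Triangle.isoMk _ _ (Iso.refl _) e.symm (Iso.refl _)
    (show (f ≫ e.hom) ≫ e.inv = 𝟙 X ≫ f by simp) (show (e.inv ≫ g) ≫ 𝟙 Z = e.inv ≫ g by simp)
    (show h ≫ (shiftFunctor C (1 : ℤ)).map (𝟙 X) = 𝟙 Z ≫ h by simp))

/-- Cellular approximation with a free choice of allowed bidegrees. Suitable `S` yield cell
replacements, replacements with bounded weights, and truncations. -/
theorem exists_approximation (X : DCat A) (S : Set (ℤ × ℤ)) :
    ∃ (P : DGMod A) (J : Type u) (c : Cells P J) (Y : DCat A) (f : (toD A).obj P ⟶ X) (g : X ⟶ Y)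
      (h : Y ⟶ ((toD A).obj P)⟦(1 : ℤ)⟧), (∀ j, c.deg j ∈ S) ∧ (∀ p ∈ S, vanishAt A p Y) ∧
      Triangle.mk f g h ∈ distTriang (DCat A) := by
  obtain ⟨M, ⟨e⟩⟩ := exists_toD_obj_iso X
  obtain ⟨P, J, c, g, hc, hg⟩ := exists_cells_attached M S
  obtain ⟨h, hT⟩ := exists_cone_distinguished g
  refine ⟨P, J, c, _, (toD A).map g ≫ e.hom, e.inv ≫ (toD A).map (coneInl g), h, hc,
    fun p hp => (vanishAt_toD_iff _ _).2 (hg p hp),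
    distinguished_of_iso₂ hT e⟩

/-- An object with vanishing cohomology outside of the Adams degrees greater than `n` is
isomorphic to a cell module with cells of Adams degrees greater than `n`. -/
theorem exists_cells_of_vanishAt {X : DCat A} {n : ℤ} (hX : ∀ p : ℤ × ℤ, p.2 ≤ n → vanishAt A p X) :
    ∃ (P : DGMod A) (J : Type u) (c : Cells P J), (∀ j, n < (c.deg j).2) ∧
      Nonempty ((toD A).obj P ≅ X) := by
  obtain ⟨P, J, c, Y, f, g, h, hc, hY, hT⟩ := exists_approximation X {p | n < p.2}
  have hY' : ∀ p, vanishAt A p Y := fun p => by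
    by_cases hp : n < p.2
    · exact hY p hp
    -- In the weights outside `S` both `X` and `P` have no cohomology, so neither does the cone.
    · refine vanishAt_obj₃ hT (hX p (not_lt.1 hp)) ?_
      exact (vanishAt_toD_iff _ _).2 (c.acyclicAt_of_lt fun j => (not_lt.1 hp).trans_lt (hc j))
  have : IsIso f := (Triangle.isZero₃_iff_isIso₁ _ hT).1 (isZero_of_vanishAt hY')
  exact ⟨P, J, c, hc, ⟨asIso f⟩⟩

theorem exists_cells (X : DCat A) :
    ∃ (P : DGMod A) (J : Type u) (_ : Cells P J), Nonempty ((toD A).obj P ≅ X) := by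
  obtain ⟨P, J, c, Y, f, g, h, -, hY, hT⟩ := exists_approximation X Set.univ
  have : IsIso f := (Triangle.isZero₃_iff_isIso₁ _ hT).1 (isZero_of_vanishAt fun p => hY p trivial)
  exact ⟨P, J, c, ⟨asIso f⟩⟩

/-- `W_n P` contains all of `P` in weights `≤ n`, so its vanishing kills the cohomology of `P`
there. Conversely, a replacement with cells only of weight `> n` has `W_n P = 0` on the nose. The
resulting condition involves no choice of replacement. -/
theorem dplusw_iff (X : DCat A) :
    Dplusw A X ↔ ∃ n : ℤ, ∀ p : ℤ × ℤ, p.2 ≤ n → vanishAt A p X := by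
  constructor
  · rintro ⟨P, ⟨-, ⟨e⟩⟩, n, hn⟩
    refine ⟨n, fun p hp => (vanishAt A p).prop_of_iso e ((vanishAt_toD_iff _ _).2 ?_)⟩
    intro x hx hd
    obtain ⟨y, hy⟩ := (vanishAt_toD_iff _ _).1 (vanishAt_of_isZero hn p)
      ⟨x, Submodule.subset_span ⟨p.1, p.2, hp, hx⟩⟩ hx (Subtype.ext hd)
    exact ⟨y.1, congrArg Subtype.val hy⟩
  · rintro ⟨n, hn⟩
    obtain ⟨P, J, c, hc, e⟩ := exists_cells_of_vanishAt hn
    refine ⟨P, ⟨c.isCell, e⟩, n, isZero_toD_of_acyclic fun p x _ _ => ⟨0, ?_⟩⟩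
    have hx := x.2
    have h : P.weightSet n ⊆ {0} := by
      rintro y ⟨m, s, hs, hy⟩
      exact c.eq_zero_of_lt (fun j => hs.trans_lt (hc j)) hy
    have := Submodule.span_mono (R := A.carrier) h hx
    rw [Submodule.span_singleton_eq_bot.2 rfl] at this
    rw [map_zero]
    exact Subtype.ext ((Submodule.mem_bot _).1 this).symm

/-! ### The t-structure on the derived category -/

/-- The objects isomorphic to a cell module with cells of degrees at most `n`. -/
def cellLE (A : AdamsCDGA.{u}) (n : ℤ) : ObjectProperty (DCat A) := fun X =>
  ∃ (P : DGMod A) (J : Type u) (c : Cells P J), (∀ j, (c.deg j).1 ≤ n) ∧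
    Nonempty ((toD A).obj P ≅ X)

/-- The objects with vanishing cohomology in degrees less than `n`. -/
def cohGE (A : AdamsCDGA.{u}) (n : ℤ) : ObjectProperty (DCat A) := fun X =>
  ∀ p : ℤ × ℤ, p.1 < n → vanishAt A p X

instance (n : ℤ) : (cellLE A n).IsClosedUnderIsomorphisms where
  of_iso := by
    rintro X Y e ⟨P, J, c, hc, ⟨e'⟩⟩
    exact ⟨P, J, c, hc, ⟨e' ≪≫ e⟩⟩

instance (n : ℤ) : (cohGE A n).IsClosedUnderIsomorphisms where
  of_iso e h p hp := (vanishAt A p).prop_of_iso e (h p hp)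

/-- The target has no cohomology in the degrees of the cells, so all obstructions to a null-homotopy
vanish. -/
theorem hom_eq_zero_of_cellLE_of_cohGE {X Y : DCat A} {n m : ℤ} (hnm : n < m) (hX : cellLE A n X)
    (hY : cohGE A m Y) (f : X ⟶ Y) : f = 0 := by
  obtain ⟨P, J, c, hc, ⟨e⟩⟩ := hX
  obtain ⟨N, ⟨e'⟩⟩ := exists_toD_obj_iso Y
  have := c.toD_hom_eq_zero (N := N) (fun j => (vanishAt_toD_iff _ _).1
    ((vanishAt A _).prop_of_iso e'.symm (hY _ ((hc j).trans_lt hnm)))) (e.hom ≫ f ≫ e'.inv)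
  rw [← cancel_epi e.hom, ← cancel_mono e'.inv]
  simpa using this

/-- The t-structure on the derived category. -/
def tStr (A : AdamsCDGA.{u}) : Triangulated.TStructure (DCat A) where
  le := cellLE A
  ge := cohGE A
  le_shift := by
    rintro n a n' h X ⟨P, J, c, hc, ⟨e⟩⟩
    refine ⟨P.shift a, J, c.shift a, fun j => ?_,
      ⟨((toD A).commShiftIso a).app P ≪≫ (shiftFunctor (DCat A) a).mapIso e⟩⟩
    have := hc j
    change (c.deg j).1 - a ≤ n'
    lia
  ge_shift n a n' h X hX p hp := by
    rw [vanishAt_shift_iff]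
    exact hX _ (by change p.1 + a < n; lia)
  zero' X Y f hX hY := hom_eq_zero_of_cellLE_of_cohGE zero_lt_one hX hY f
  le_zero_le := by
    rintro X ⟨P, J, c, hc, e⟩
    exact ⟨P, J, c, fun j => (hc j).trans zero_le_one, e⟩
  ge_one_le X hX p hp := hX p (hp.trans zero_lt_one)
  exists_triangle_zero_one X := by
    -- Attaching all cells of degree `≤ 0` leaves a cone with cohomology only in degrees `≥ 1`.
    obtain ⟨P, J, c, Y, f, g, h, hc, hY, hT⟩ := exists_approximation X {p | p.1 ≤ 0}
    exact ⟨_, Y, ⟨P, J, c, hc, ⟨Iso.refl _⟩⟩, fun p hp => hY p (Int.lt_add_one_iff.1 hp),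
      f, g, h, hT⟩

/-! ### The subcategory of objects of bounded below weights -/

instance : (Dplusw A).IsClosedUnderIsomorphisms where
  of_iso {X Y} e h := by
    rw [dplusw_iff] at h ⊢
    obtain ⟨n, hn⟩ := h
    exact ⟨n, fun p hp => (vanishAt A p).prop_of_iso e (hn p hp)⟩

theorem isTriangulated_dplusw (A : AdamsCDGA.{u}) : (Dplusw A).IsTriangulated where
  exists_zero := by
    obtain ⟨Z, hZ⟩ := HasZeroObject.zero (C := DCat A)
    exact ⟨Z, hZ, (dplusw_iff _).2 ⟨0, fun p _ => vanishAt_of_isZero hZ p⟩⟩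
  toIsStableUnderShift := ⟨fun a => ⟨fun X hX => by
    change Dplusw A _
    rw [dplusw_iff] at hX ⊢
    obtain ⟨n, hn⟩ := hX
    exact ⟨n, fun p hp => (vanishAt_shift_iff _ _ _).2 (hn _ hp)⟩⟩⟩
  toIsTriangulatedClosed₂ := .mk' (fun T hT h₁ h₃ => by
    rw [dplusw_iff] at h₁ h₃ ⊢
    obtain ⟨n, hn⟩ := h₁
    obtain ⟨m, hm⟩ := h₃
    exact ⟨min n m, fun p hp => vanishAt_obj₂ hT (hn p (hp.trans (min_le_left _ _)))
      (hm p (hp.trans (min_le_right _ _)))⟩)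

/-- The attached cells are also required to have weight above the bound `m` for `X`, which keeps
both truncations in `D^{+w}_A`. Nothing is lost in weights `≤ m`, where `X` and `P` have no
cohomology and so the cone has none. -/
theorem exists_truncation {X : DCat A} (hX : Dplusw A X) (n : ℤ) :
    ∃ (X' Y' : DCat A) (f : X' ⟶ X) (g : X ⟶ Y') (h : Y' ⟶ X'⟦(1 : ℤ)⟧), cellLE A n X' ∧
      cohGE A (n + 1) Y' ∧ Dplusw A X' ∧ Dplusw A Y' ∧ Triangle.mk f g h ∈ distTriang (DCat A) := by
  obtain ⟨m, hm⟩ := (dplusw_iff _).1 hX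
  obtain ⟨P, J, c, Y, f, g, h, hc, hY, hT⟩ := exists_approximation X {p | p.1 ≤ n ∧ m < p.2}
  have hP : ∀ p : ℤ × ℤ, p.2 ≤ m → vanishAt A p ((toD A).obj P) := fun p hp =>
    (vanishAt_toD_iff _ _).2 (c.acyclicAt_of_lt fun j => hp.trans_lt (hc j).2)
  have hY' : ∀ p : ℤ × ℤ, p.2 ≤ m → vanishAt A p Y := fun p hp =>
    vanishAt_obj₃ hT (hm p hp) (hP _ hp)
  refine ⟨_, Y, f, g, h, ⟨P, J, c, fun j => (hc j).1, ⟨Iso.refl _⟩⟩, fun p hp => ?_,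
    (dplusw_iff _).2 ⟨m, hP⟩, (dplusw_iff _).2 ⟨m, hY'⟩, hT⟩
  by_cases hp' : p.2 ≤ m
  · exact hY' p hp'
  · exact hY p ⟨Int.lt_add_one_iff.1 hp, not_le.1 hp'⟩

theorem hasInducedTStructure_dplusw (A : AdamsCDGA.{u}) [(Dplusw A).IsTriangulated] :
    (Dplusw A).HasInducedTStructure (tStr A) where
  exists_triangle_zero_one X hX := by
    obtain ⟨X', Y', f, g, h, hX', hY', h₁, h₂, hT⟩ := exists_truncation hX 0
    exact ⟨X', Y', ⟨hX'⟩, ⟨hY'⟩, f, g, h, hT, ObjectProperty.le_isoClosure _ _ h₁,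
      ObjectProperty.le_isoClosure _ _ h₂⟩

open DGMod

/-! ### Removing a cell -/

namespace DGMod.Cells

variable {P : DGMod A} {J : Type u} (c : Cells P J) (j₀ : J)

/-- The span of the cells other than `j₀`. -/
def compl : Submodule A.carrier P.carrier :=
  Submodule.span A.carrier (Set.range fun i : {i // i ≠ j₀} => c.b i)

variable (h₀ : ∀ j, c.rank j ≤ c.rank j₀)

-- A cell of maximal rank has rank smaller than that of no cell, so it occurs in no boundary.
include h₀ in
theorem d_mem_compl (j : J) : P.d (c.b j) ∈ c.compl j₀ := by
  refine Submodule.span_mono ?_ (c.d_b j)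
  rintro _ ⟨i, hi, rfl⟩
  have hi : c.rank i < c.rank j := hi
  exact ⟨⟨i, by rintro rfl; exact absurd (h₀ j) (not_le.2 hi)⟩, rfl⟩

/-- The dg submodule spanned by the cells other than the top cell `j₀`. -/
def complMod : DGMod A :=
  P.sub (c.compl j₀) (P.pr_mem_span _ (by rintro _ ⟨i, rfl⟩; exact ⟨_, c.mem i⟩))
    (P.d_mem_span _ (by rintro _ ⟨i, rfl⟩; exact c.d_mem_compl j₀ h₀ i))

/-- The basis of `complMod`. -/
def complBasis : Module.Basis {i // i ≠ j₀} A.carrier (c.complMod j₀ h₀).carrier :=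
  Module.Basis.span (c.b.linearIndependent.comp _ Subtype.val_injective)

/-- The inclusion of `complMod`. -/
def complIncl : c.complMod j₀ h₀ ⟶ P where
  lin := (c.compl j₀).subtype
  lin_mem _ _ hx := hx
  lin_d _ := rfl

theorem complIncl_injective : Function.Injective (c.complIncl j₀ h₀).lin :=
  (c.compl j₀).injective_subtype

theorem complIncl_basis (i : {i // i ≠ j₀}) :
    (c.complIncl j₀ h₀).lin (c.complBasis j₀ h₀ i) = c.b i :=
  congrArg Subtype.val
    (Module.Basis.span_apply (c.b.linearIndependent.comp _ Subtype.val_injective) i)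

/-- The cells of `complMod`. -/
def complCells : Cells (c.complMod j₀ h₀) {i // i ≠ j₀} where
  b := c.complBasis j₀ h₀
  deg i := c.deg i
  mem i := by
    change (c.complIncl j₀ h₀).lin (c.complBasis j₀ h₀ i) ∈ P.gr _
    rw [complIncl_basis]
    exact c.mem i
  rank i := c.rank i
  d_b i := by
    have h := c.d_b i
    rw [← c.complIncl_basis j₀ h₀, ← (c.complIncl j₀ h₀).lin_d] at h
    have himg : c.b '' {k | c.rank k < c.rank i} ⊆ (c.complIncl j₀ h₀).lin ''
        (c.complBasis j₀ h₀ '' {k | c.rank k < c.rank i}) := by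
      rintro _ ⟨k, hk, rfl⟩
      have hk' : c.rank k < c.rank i := hk
      exact ⟨_, ⟨⟨k, by rintro rfl; exact absurd (h₀ i) (not_le.2 hk')⟩, hk, rfl⟩,
        c.complIncl_basis j₀ h₀ _⟩
    have h := Submodule.span_mono himg h
    rw [← Submodule.map_span] at h
    obtain ⟨y, hy, hxy⟩ := h
    rwa [c.complIncl_injective j₀ h₀ hxy] at hy

/-- The attaching map of the top cell. -/
def attach : sphere A ((c.deg j₀).1 + 1, (c.deg j₀).2) ⟶ c.complMod j₀ h₀ :=
  ofCocycle (x := (⟨P.d (c.b j₀), c.d_mem_compl j₀ h₀ j₀⟩ : c.compl j₀))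
    (P.d_mem _ _ _ (c.mem j₀)) (Subtype.ext (P.d_d _))

/-- The bijection between the cells other than `j₀` with one cell added and all cells. -/
def complEquiv : {i // i ≠ j₀} ⊕ PUnit.{u + 1} ≃ J :=
  Equiv.ofBijective (Sum.elim Subtype.val fun _ => j₀) (by
    classical
    refine ⟨?_, fun j => ?_⟩
    · rintro (⟨i, hi⟩ | _) (⟨k, hk⟩ | _) h
      · exact congrArg Sum.inl (Subtype.ext h)
      · exact absurd h hi
      · exact absurd h.symm hk
      · rfl
    · by_cases hj : j = j₀
      · exact ⟨Sum.inr PUnit.unit, hj.symm⟩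
      · exact ⟨Sum.inl ⟨j, hj⟩, rfl⟩)

/-- The identification of bases of the cone of `attach` and of `P`. -/
def attachEquiv : (DGMod.cone (c.attach j₀ h₀)).carrier ≃ₗ[A.carrier] P.carrier :=
  (coneBasis (c.complCells j₀ h₀).b ((sphereCells A _).shift 1).b (c.attach j₀ h₀)).equiv c.b
    (complEquiv j₀)

theorem attachEquiv_inl (x : (c.complMod j₀ h₀).carrier) :
    c.attachEquiv j₀ h₀ ((coneInl (c.attach j₀ h₀)).lin x) = (c.complIncl j₀ h₀).lin x := by
  have : (c.attachEquiv j₀ h₀).toLinearMap.comp (coneInl (c.attach j₀ h₀)).lin =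
      (c.complIncl j₀ h₀).lin := by
    refine (c.complCells j₀ h₀).b.ext fun i => ?_
    rw [LinearMap.comp_apply, ← coneBasis_inl (c.complCells j₀ h₀).b ((sphereCells A _).shift 1).b]
    exact (Module.Basis.equiv_apply _ (Sum.inl i) _ _).trans (c.complIncl_basis j₀ h₀ i).symm
  exact LinearMap.congr_fun this x

/-- `P` is its lower part with one cell attached along `d b_{j₀}`. The attaching sphere has degree
one more than the cell, and the shift in the cone lowers it again. Matching bases gives an
isomorphism already at the level of dg modules. -/
theorem exists_attach_iso : Nonempty ((toD A).obj (DGMod.cone (c.attach j₀ h₀)) ≅ (toD A).obj P) := by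
  let b := coneBasis (c.complCells j₀ h₀).b ((sphereCells A _).shift 1).b (c.attach j₀ h₀)
  let e := (c.complCells j₀ h₀)
  have hb (i) : c.attachEquiv j₀ h₀ (b i) = c.b (complEquiv j₀ i) :=
    Module.Basis.equiv_apply _ i _ _
  let F := homOfBasis (N := P) b (deg := Sum.elim e.deg ((sphereCells A _).shift 1).deg)
    (by
      rintro (k | j)
      · rw [coneBasis_inl]
        exact ⟨e.mem k, zero_mem _⟩
      · rw [coneBasis_inr]
        exact ⟨zero_mem _, ((sphereCells A _).shift 1).mem j⟩)
    (c.attachEquiv j₀ h₀).toLinearMap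
    (by
      intro i
      refine (hb i).symm ▸ ?_
      rcases i with i | i
      · exact c.mem i
      · change c.b j₀ ∈ P.gr ((c.deg j₀).1 + 1 - 1, (c.deg j₀).2)
        rw [add_sub_cancel_right]
        exact c.mem j₀)
    (by
      intro i
      change c.attachEquiv j₀ h₀ _ = P.d (c.attachEquiv j₀ h₀ _)
      rcases i with i | i
      · rw [coneBasis_inl, ← (coneInl _).lin_d, attachEquiv_inl, attachEquiv_inl, Hom.lin_d]
      -- For the new cell, the differential in the cone is the image of the generator under
      -- `attach`, which is `d b_{j₀}`; the shifted sphere contributes nothing since its generator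
      -- is a cocycle.
      · rw [hb, coneBasis_inr, cone_d_inr]
        have h₁ : ((sphereCells A ((c.deg j₀).1 + 1, (c.deg j₀).2)).shift 1).b i =
            (show ((sphere A _).shift 1).carrier from sphereGen A _) := shiftBasis_apply _ _ _
        have h₂ : ((sphere A ((c.deg j₀).1 + 1, (c.deg j₀).2)).shift 1).d
            (show ((sphere A _).shift 1).carrier from sphereGen A _) = 0 :=
          (congrArg (fun x : (sphere A ((c.deg j₀).1 + 1, (c.deg j₀).2)).carrier =>
            (1 : ℤ).negOnePow • x) (d_sphereGen _)).trans
            (smul_zero (A := (sphere A _).carrier) (1 : ℤ).negOnePow)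
        have h₃ : (c.attach j₀ h₀).lin (sphereGen A _) =
            (show (c.complMod j₀ h₀).carrier from
              (⟨P.d (c.b j₀), c.d_mem_compl j₀ h₀ j₀⟩ : c.compl j₀)) := ofCocycle_gen _ _
        refine (congrArg (c.attachEquiv j₀ h₀) (congrArg₂ (· + ·)
          (congrArg (coneInl _).lin ((congrArg (c.attach j₀ h₀).lin h₁).trans h₃))
          (congrArg (coneInr _) ((congrArg _ h₁).trans h₂)))).trans ?_
        rw [map_zero, add_zero, attachEquiv_inl]
        rfl)
  have : IsIso ((toD A).map F) := isIso_toD_map_of_bijective F (c.attachEquiv j₀ h₀).bijective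
  exact ⟨asIso ((toD A).map F)⟩

end DGMod.Cells

open DGMod

/-! ### The subcategory of finite cell modules -/

theorem nonempty_iso₃ {C : Type*} [Category C] [Preadditive C] [HasZeroObject C]
    [HasShift C ℤ] [∀ n : ℤ, (shiftFunctor C n).Additive] [Pretriangulated C] {T T' : Triangle C}
    (hT : T ∈ distTriang C) (hT' : T' ∈ distTriang C) (e₁ : T.obj₁ ≅ T'.obj₁)
    (e₂ : T.obj₂ ≅ T'.obj₂) (h : T.mor₁ ≫ e₂.hom = e₁.hom ≫ T'.mor₁) :
    Nonempty (T.obj₃ ≅ T'.obj₃) := by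
  obtain ⟨φ, h₁, h₂⟩ := exists_iso_of_arrow_iso T T' hT hT' (Arrow.isoMk e₁ e₂ h.symm)
  exact ⟨Triangle.π₃.mapIso φ⟩

/-- The third vertex of a triangle is the cone of a map between cell modules representing the
first two vertices. -/
theorem exists_cone_iso {T : Triangle (DCat A)} (hT : T ∈ distTriang (DCat A)) {P Q : DGMod A}
    {J : Type*} (c : Cells P J) (e₁ : (toD A).obj P ≅ T.obj₁) (e₂ : (toD A).obj Q ≅ T.obj₂) :
    ∃ f : P ⟶ Q, Nonempty ((toD A).obj (cone f) ≅ T.obj₃) := by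
  obtain ⟨f, hf⟩ := c.toD_map_surjective (e₁.hom ≫ T.mor₁ ≫ e₂.inv)
  obtain ⟨h, hT'⟩ := exists_cone_distinguished f
  exact ⟨f, nonempty_iso₃ hT' hT e₁ e₂ (by
    change (toD A).map f ≫ e₂.hom = _
    rw [hf, Category.assoc, Category.assoc, e₂.inv_hom_id, Category.comp_id]
    rfl)⟩

instance : (Dfin A).IsClosedUnderIsomorphisms where
  of_iso := by
    rintro X Y e ⟨P, hP, ⟨e'⟩⟩
    exact ⟨P, hP, ⟨e' ≪≫ e⟩⟩

theorem dfin_toD {P : DGMod A} {J : Type u} [hJ : Finite J] (c : Cells P J) :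
    Dfin A ((toD A).obj P) := ⟨P, ⟨J, hJ, ⟨c.toCellBasis⟩⟩, ⟨Iso.refl _⟩⟩

theorem Dfin.exists_cells {X : DCat A} (hX : Dfin A X) :
    ∃ (P : DGMod A) (J : Type u) (_ : Finite J) (_ : Cells P J), Nonempty ((toD A).obj P ≅ X) := by
  obtain ⟨P, ⟨J, hJ, ⟨c⟩⟩, e⟩ := hX
  exact ⟨P, J, hJ, c.toCells, e⟩

theorem DGMod.Cells.isZero_toD {P : DGMod A} {J : Type u} [IsEmpty J] (c : Cells P J) :
    IsZero ((toD A).obj P) :=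
  isZero_toD_of_acyclic fun p => c.acyclicAt_of_lt (p := p) isEmptyElim

theorem exists_cells_pempty (A : AdamsCDGA.{u}) :
    ∃ P : DGMod A, Nonempty (Cells P PEmpty.{u + 1}) :=
  let F : Semifree A PEmpty.{u + 1} :=
    { deg := PEmpty.elim
      bd := PEmpty.elim
      bd_mem := fun j => j.elim
      bd_bd := fun j => j.elim }
  ⟨F.mod, ⟨F.cells 0 (fun j => j.elim)⟩⟩

theorem dfin_of_isZero {X : DCat A} (hX : IsZero X) : Dfin A X := by
  obtain ⟨P, ⟨c⟩⟩ := exists_cells_pempty A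
  exact (Dfin A).prop_of_iso (c.isZero_toD.iso hX) (dfin_toD c)

theorem isStableUnderShift_dfin (A : AdamsCDGA.{u}) : (Dfin A).IsStableUnderShift ℤ :=
  ⟨fun a => ⟨fun X hX => by
  obtain ⟨P, hP, ⟨e⟩⟩ := hX
  exact ⟨P.shift a, hP.shift a,
    ⟨((toD A).commShiftIso a).app P ≪≫ (shiftFunctor (DCat A) a).mapIso e⟩⟩⟩⟩

theorem isTriangulatedClosed₃_dfin (A : AdamsCDGA.{u}) : (Dfin A).IsTriangulatedClosed₃ :=
  .mk' (fun T hT h₁ h₂ => by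
  obtain ⟨P, hP, ⟨e₁⟩⟩ := h₁
  obtain ⟨Q, hQ, ⟨e₂⟩⟩ := h₂
  obtain ⟨J, _, ⟨c⟩⟩ := id hP
  obtain ⟨f, e⟩ := exists_cone_iso hT c.toCells e₁ e₂
  exact ⟨_, hP.cone hQ f, e⟩)

attribute [local instance] isStableUnderShift_dfin isTriangulatedClosed₃_dfin

theorem isTriangulated_dfin (A : AdamsCDGA.{u}) : (Dfin A).IsTriangulated where
  toIsTriangulatedClosed₂ := .of_isTriangulatedClosed₃
  exists_zero := by
    obtain ⟨Z, hZ⟩ := HasZeroObject.zero (C := DCat A)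
    exact ⟨Z, hZ, dfin_of_isZero hZ⟩

theorem dfin_le_dplusw (A : AdamsCDGA.{u}) : Dfin A ≤ Dplusw A := fun X hX => by
  obtain ⟨P, J, _, c, ⟨e⟩⟩ := hX.exists_cells
  obtain ⟨n, hn⟩ := (Set.finite_range fun j => (c.deg j).2).bddBelow
  -- The lower bound `n` may itself be the weight of a cell, hence `n - 1`.
  refine (dplusw_iff X).2 ⟨n - 1, fun p hp => (vanishAt A p).prop_of_iso e
    ((vanishAt_toD_iff _ _).2 (c.acyclicAt_of_lt fun j => ?_))⟩
  have := hn ⟨j, rfl⟩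
  exact lt_of_le_of_lt hp (by simpa [Int.sub_one_lt_iff] using this)

/-! ### Truncation of finite cell modules -/

/-- The map lifts to a chain map sending generator to multiple of generator, and the coefficient
lies in `A^0(0) = ℚ`. A nonzero rational is a unit of `A`. -/
theorem DGMod.Cells.eq_zero_or_isIso {P N : DGMod A} (c : Cells P PUnit.{u + 1})
    (e : Cells N PUnit.{u + 1}) (h : c.deg PUnit.unit = e.deg PUnit.unit)
    (f : (toD A).obj P ⟶ (toD A).obj N) : f = 0 ∨ IsIso f := by
  obtain ⟨φ, rfl⟩ := c.toD_map_surjective f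
  have hmem := e.repr_mem (φ.lin_mem _ _ (c.mem PUnit.unit)) PUnit.unit
  rw [h, sub_self] at hmem
  obtain ⟨q, hq⟩ := AdamsCDGA.exists_eq_smul_one hmem
  have hφ : φ.lin (c.b PUnit.unit) = (algebraMap ℚ A.carrier q) • e.b PUnit.unit := by
    rw [← e.b.sum_repr (φ.lin (c.b PUnit.unit))]
    simp [hq, Algebra.algebraMap_eq_smul_one]
  by_cases hq0 : q = 0
  · left
    have : φ = 0 := by
      refine hom_ext fun x => ?_
      have : φ.lin = 0 := c.b.ext fun _ => by simp [hφ, hq0]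
      rw [this]
      rfl
    rw [this, Functor.map_zero]
  · right
    refine isIso_toD_map_of_bijective φ ?_
    let u : A.carrierˣ := (Units.mk0 q hq0).map (algebraMap ℚ A.carrier).toMonoidHom
    have key : φ.lin = (c.b.equiv (e.b.unitsSMul fun _ => u) (Equiv.refl _)).toLinearMap :=
      c.b.ext fun j => by
        refine hφ.trans ?_
        refine Eq.trans ?_ (Module.Basis.equiv_apply c.b j _ (Equiv.refl _)).symm
        rw [Module.Basis.unitsSMul_apply]
        rfl
    rw [key]
    exact LinearEquiv.bijective _

/-- The multiple by `a` of the generator of `sphere A p`. -/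
def sphereElt (p : ℤ × ℤ) : A.carrier →+ (sphere A p).carrier :=
  (Finsupp.singleAddHom PUnit.unit : A.carrier →+ (PUnit.{u + 1} →₀ A.carrier))

theorem sphereElt_surjective (p : ℤ × ℤ) : Function.Surjective (sphereElt (A := A) p) :=
  fun x => ⟨(show PUnit.{u + 1} →₀ A.carrier from x) PUnit.unit,
    (Finsupp.unique_single (show PUnit.{u + 1} →₀ A.carrier from x)).symm⟩

theorem sphereElt_mem_iff {p q : ℤ × ℤ} {a : A.carrier} :
    sphereElt p a ∈ (sphere A p).gr q ↔ a ∈ A.gr (q - p) := by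
  refine ⟨fun h => ?_, fun h => (sphereData A p).single_mem h⟩
  have := h PUnit.unit
  change (Finsupp.single PUnit.unit a : PUnit.{u + 1} →₀ A.carrier) _ ∈ _ at this
  rwa [Finsupp.single_eq_same] at this

theorem sphereElt_eq_zero_iff {p : ℤ × ℤ} {a : A.carrier} : sphereElt p a = 0 ↔ a = 0 :=
  Finsupp.single_eq_zero

theorem d_sphereElt (p : ℤ × ℤ) (a : A.carrier) :
    (sphere A p).d (sphereElt p a) = sphereElt p (A.d a) := by
  refine (semifreeD_single _ _ _).trans ?_
  change _ + A.sgn 1 a • (0 : PUnit.{u + 1} →₀ A.carrier) = _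
  rw [smul_zero, add_zero]
  rfl

/-- The cohomology of the sphere is that of `A` with bidegrees translated by `p`. Below the degree
of the generator it vanishes, and in that degree only the class of the generator, of weight `p.2`,
survives. -/
theorem AdamsCDGA.CohomologicallyConnected.acyclicAt_sphere (hA : A.CohomologicallyConnected)
    {p q : ℤ × ℤ} (h : q.1 < p.1 ∨ q.1 = p.1 ∧ q.2 ≠ p.2) : (sphere A p).AcyclicAt q := by
  intro x hx hd
  obtain ⟨a, rfl⟩ := sphereElt_surjective p x
  have ha : a ∈ A.deg (q.1 - p.1) :=
    Submodule.mem_iSup_of_mem (q.2 - p.2) (sphereElt_mem_iff.1 hx)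
  rw [d_sphereElt, sphereElt_eq_zero_iff] at hd
  rcases h with h | ⟨h, h'⟩
  · obtain ⟨b, -, hb⟩ := hA.1 _ (sub_neg.2 h) a ha hd
    exact ⟨_, (d_sphereElt p b).trans (by rw [hb])⟩
  · rw [h, sub_self] at ha
    -- Here `a = t • 1 + d b`. The scalar part sits in bidegree `p`, so projecting to `q ≠ p`
    -- removes it and leaves a boundary.
    obtain ⟨t, b, -, hb⟩ := hA.2 a ha hd
    refine ⟨(sphere A p).pr (q.1 - 1, q.2) (sphereElt p b), ?_⟩
    have ht : sphereElt p (t • (1 : A.carrier)) ∈ (sphere A p).gr p := by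
      rw [sphereElt_mem_iff, sub_self]
      exact Submodule.smul_mem _ _ SetLike.GradedOne.one_mem
    have hqp : q ≠ p := fun h => h' (h ▸ rfl)
    rw [← pr_d, d_sphereElt, ← (sphere A p).pr_same hx, hb, map_add, map_add,
      (sphere A p).pr_diff hqp ht, zero_add]

theorem cellLE_sphere (p : ℤ × ℤ) : cellLE A p.1 ((toD A).obj (sphere A p)) :=
  ⟨_, _, sphereCells A p, fun _ => le_rfl, ⟨Iso.refl _⟩⟩

theorem dfin_sphere (p : ℤ × ℤ) : Dfin A ((toD A).obj (sphere A p)) := dfin_toD (sphereCells A p)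

/-- The existence of a truncation triangle with finite truncations. -/
def FinTrunc (X : DCat A) : Prop :=
  ∃ (X' Y' : DCat A) (f : X' ⟶ X) (g : X ⟶ Y') (h : Y' ⟶ X'⟦(1 : ℤ)⟧),
    cellLE A 0 X' ∧ cohGE A 1 Y' ∧ Dfin A X' ∧ Triangle.mk f g h ∈ distTriang (DCat A)

theorem FinTrunc.of_iso {X X₁ : DCat A} (h : FinTrunc X) (e : X ≅ X₁) : FinTrunc X₁ := by
  obtain ⟨X', Y', f, g, k, h₁, h₂, h₃, h₄⟩ := h
  exact ⟨X', Y', _, _, _, h₁, h₂, h₃, distinguished_of_iso₂ h₄ e⟩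

theorem FinTrunc.of_isZero {X : DCat A} (h : IsZero X) : FinTrunc X :=
  ⟨X, _, 𝟙 X, 0, 0, by
    obtain ⟨P, ⟨c⟩⟩ := exists_cells_pempty A
    exact ⟨P, _, c, fun j => j.elim, ⟨c.isZero_toD.iso h⟩⟩,
    fun p _ => vanishAt_of_isZero (isZero_zero _) p, dfin_of_isZero h,
    contractible_distinguished X⟩

/-! ### Two octahedra for attaching a cell to a truncated object. -/

section

open Triangulated

variable {C : Type*} [Category C] [Preadditive C] [HasZeroObject C] [HasShift C ℤ]
  [∀ n : ℤ, (shiftFunctor C n).Additive] [Pretriangulated C] [IsTriangulated C]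
  {S X₁ X X' Y' : C} {α : S ⟶ X₁} {β : X₁ ⟶ X} {γ : X ⟶ S⟦(1 : ℤ)⟧} {u : X' ⟶ X₁} {g : X₁ ⟶ Y'}
  {k : Y' ⟶ X'⟦(1 : ℤ)⟧}

/-- Octahedron on `X' ⟶ X₁ ⟶ X`: keeping the lower truncation `X'` changes the upper one from `Y'`
to an extension of `S[1]` by `Y'`, with connecting map `α ≫ g` up to sign and shift. -/
theorem exists_octahedron_comp (hT : Triangle.mk α β γ ∈ distTriang C)
    (hT' : Triangle.mk u g k ∈ distTriang C) :
    ∃ (Z : C) (v : X ⟶ Z) (z : Z ⟶ X'⟦(1 : ℤ)⟧) (m : Y' ⟶ Z) (m' : Z ⟶ S⟦(1 : ℤ)⟧),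
      Triangle.mk (u ≫ β) v z ∈ distTriang C ∧
      Triangle.mk m m' (-(α ≫ g)⟦(1 : ℤ)⟧') ∈ distTriang C := by
  obtain ⟨Z, v, z, hZ⟩ := distinguished_cocone_triangle (u ≫ β)
  have h : Triangle.mk β γ (-α⟦(1 : ℤ)⟧') ∈ distTriang C := rot_of_distTriang _ hT
  let O := someOctahedron rfl hT' h hZ
  refine ⟨Z, v, z, O.m₁, O.m₃, hZ, ?_⟩
  have := O.mem
  rwa [Preadditive.neg_comp, ← Functor.map_comp] at this

/-- If `α` dies in `Y'`, it lifts to `X'`. The octahedron on `S ⟶ X' ⟶ X₁` then attaches the cell to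
`X'` and leaves `Y'` unchanged. -/
theorem exists_octahedron_lift (hT : Triangle.mk α β γ ∈ distTriang C)
    (hT' : Triangle.mk u g k ∈ distTriang C) (h : α ≫ g = 0) :
    ∃ (X'' : C) (w : S ⟶ X') (v : X' ⟶ X'') (z : X'' ⟶ S⟦(1 : ℤ)⟧) (m : X'' ⟶ X) (m' : X ⟶ Y')
      (k' : Y' ⟶ X''⟦(1 : ℤ)⟧), Triangle.mk w v z ∈ distTriang C ∧
      Triangle.mk m m' k' ∈ distTriang C := by
  obtain ⟨w, hw⟩ := Triangle.coyoneda_exact₂ _ hT' α h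
  obtain ⟨X'', v, z, hT''⟩ := distinguished_cocone_triangle w
  let O := someOctahedron (show w ≫ u = α from hw.symm) hT'' hT' hT
  exact ⟨X'', w, v, z, O.m₁, O.m₃, _, hT'', O.mem⟩

end

/-- `X` arises from `X₁` by attaching a cell of bidegree `p`. It goes to the lower truncation if
`p.1 < 0`, to the upper one if `p.1 > 0`; for `p.1 = 0` this depends on whether the attaching map is
zero in the upper truncation. -/
theorem FinTrunc.attach (hA : A.CohomologicallyConnected) {p : ℤ × ℤ} {X₁ X : DCat A}
    {α : (toD A).obj (sphere A (p.1 + 1, p.2)) ⟶ X₁} {β : X₁ ⟶ X}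
    {γ : X ⟶ ((toD A).obj (sphere A (p.1 + 1, p.2)))⟦(1 : ℤ)⟧}
    (hT : Triangle.mk α β γ ∈ distTriang (DCat A)) (h : FinTrunc X₁) : FinTrunc X := by
  obtain ⟨X', Y', u, g, k, hX', hY', hf, hT'⟩ := h
  -- If `p.1 < 0`, the attaching sphere has degree `p.1 + 1 ≤ 0`, so `α ≫ g` vanishes by
  -- orthogonality.
  by_cases hx : p.1 < 0 ∨ p.1 = 0 ∧ α ≫ g = 0
  · have hαg : α ≫ g = 0 := by
      rcases hx with hx | hx
      · exact hom_eq_zero_of_cellLE_of_cohGE (by dsimp; lia) (cellLE_sphere _) hY' _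
      · exact hx.2
    obtain ⟨X'', w, v, z, m, m', k', hT'', hT₃⟩ := exists_octahedron_lift hT hT' hαg
    have h₁ : (tStr A).IsLE X' 0 := ⟨hX'⟩
    have h₂ : (tStr A).IsLE (((toD A).obj (sphere A (p.1 + 1, p.2)))⟦(1 : ℤ)⟧) 0 := by
      have : (tStr A).IsLE ((toD A).obj (sphere A (p.1 + 1, p.2))) (p.1 + 1) :=
        ⟨cellLE_sphere (p.1 + 1, p.2)⟩
      have := (tStr A).isLE_shift ((toD A).obj (sphere A (p.1 + 1, p.2))) (p.1 + 1) 1 p.1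
      exact (tStr A).isLE_of_le _ p.1 0 (by lia)
    have hX'' : (tStr A).IsLE X'' 0 := (tStr A).isLE₂ _ (rot_of_distTriang _ hT'') 0 h₁ h₂
    exact ⟨X'', Y', m, m', k', hX''.le, hY',
      (Dfin A).ext_of_isTriangulatedClosed₃ _ hT'' (dfin_sphere _) hf, hT₃⟩
  -- Now `p.1 ≥ 0`. In degrees `≤ 0` the cohomology of `S[1]` can be nonzero only in bidegree `p`,
  -- so only that bidegree of `Z` needs care.
  · obtain ⟨Z, v, z, m, m', hZ, hT₃⟩ := exists_octahedron_comp hT hT'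
    refine ⟨X', Z, u ≫ β, v, z, hX', fun q hq => ?_, hf, hZ⟩
    by_cases hqp : q = p
    · subst hqp
      intro f
      let e : (toD A).obj ((sphere A (q.1 + 1, q.2)).shift 1) ≅
          ((toD A).obj (sphere A (q.1 + 1, q.2)))⟦(1 : ℤ)⟧ :=
        ((toD A).commShiftIso (1 : ℤ)).app (sphere A (q.1 + 1, q.2))
      -- A class of `Z` maps to a scalar multiple of the generator of `S[1]`. If the scalar is zero,
      -- the class comes from `Y'` and vanishes. Otherwise the map to `S[1]` is split up to an
      -- isomorphism, so the connecting map `α ≫ g` is zero, which this case excludes.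
      rcases (sphereCells A q).eq_zero_or_isIso ((sphereCells A (q.1 + 1, q.2)).shift 1)
        (Prod.ext (add_sub_cancel_right _ _).symm rfl) ((f ≫ m') ≫ e.inv) with h | h
      · have h : f ≫ m' = 0 := by
          rw [← cancel_mono e.inv, h, zero_comp]
        obtain ⟨w, hw⟩ := Triangle.coyoneda_exact₂ _ hT₃ f h
        rw [hw, hY' q hq w]
        exact zero_comp
      · have : IsIso (f ≫ m') := by
          rw [show f ≫ m' = ((f ≫ m') ≫ e.inv) ≫ e.hom by simp]
          infer_instance
        have h₁ : m' ≫ (-(α ≫ g)⟦(1 : ℤ)⟧') = 0 := comp_distTriang_mor_zero₂₃ _ hT₃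
        have h₂ : (α ≫ g)⟦(1 : ℤ)⟧' = 0 := by
          rw [← neg_eq_zero, ← cancel_epi (f ≫ m'), Category.assoc, h₁, comp_zero, comp_zero]
        have h₃ : α ≫ g = 0 := (shiftFunctor (DCat A) (1 : ℤ)).map_injective (by
          rw [h₂, Functor.map_zero])
        exfalso
        exact hx (by
          by_cases h : q.1 < 0
          · exact Or.inl h
          · exact Or.inr ⟨by lia, h₃⟩)
    · refine vanishAt_obj₂ hT₃ (hY' q hq) ((vanishAt_shift_iff _ _ _).2
        ((vanishAt_toD_iff _ _).2 (hA.acyclicAt_sphere ?_)))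
      have : ¬ (q.1 = p.1 ∧ q.2 = p.2) := fun h => hqp (Prod.ext h.1 h.2)
      dsimp
      have : ¬ p.1 < 0 := fun h => hx (Or.inl h)
      lia

/-- Induction on the number of cells, removing one of maximal rank. -/
theorem finTrunc_toD (hA : A.CohomologicallyConnected) (n : ℕ) (P : DGMod A) (J : Type u)
    [Finite J] (c : Cells P J) (hn : Nat.card J = n) : FinTrunc ((toD A).obj P) := by
  induction n generalizing P J with
  | zero =>
    have : IsEmpty J := Finite.card_eq_zero_iff.1 hn
    exact .of_isZero c.isZero_toD
  | succ n ih =>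
    have : Nonempty J := (Nat.card_pos_iff.1 (by lia)).1
    obtain ⟨j₀, h₀⟩ := Finite.exists_max c.rank
    have h := ih _ _ (c.complCells j₀ h₀) (by
      rw [← Nat.card_congr (Cells.complEquiv j₀), Nat.card_sum,
        Nat.card_unique (α := PUnit.{u + 1})] at hn
      exact Nat.succ_injective hn)
    obtain ⟨e⟩ := c.exists_attach_iso j₀ h₀
    obtain ⟨k, hT⟩ := exists_cone_distinguished (c.attach j₀ h₀)
    exact (h.attach hA hT).of_iso e

theorem hasInducedTStructure_dfin (hA : A.CohomologicallyConnected) [(Dfin A).IsTriangulated] :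
    (Dfin A).HasInducedTStructure (tStr A) where
  exists_triangle_zero_one X hX := by
    obtain ⟨P, J, _, c, ⟨e⟩⟩ := Dfin.exists_cells hX
    obtain ⟨X', Y', f, g, h, hX', hY', hf, hT⟩ := (finTrunc_toD hA _ P J c rfl).of_iso e
    -- Finiteness of the upper truncation follows from the other two vertices, so `FinTrunc` does
    -- not record it.
    exact ⟨X', Y', ⟨hX'⟩, ⟨hY'⟩, f, g, h, hT, (Dfin A).le_isoClosure _ hf,
      (Dfin A).le_isoClosure _ ((Dfin A).ext_of_isTriangulatedClosed₃ _ hT hf hX)⟩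

namespace DGMod

/-! ### Cohomology in a single bidegree -/

theorem pr_eq_zero_of_mem_deg {M : DGMod A} {n : ℤ} {x : M.carrier} (hx : x ∈ M.deg n)
    {p : ℤ × ℤ} (hp : p.1 ≠ n) : M.pr p x = 0 := by
  refine AddSubgroup.iSup_induction (fun s : ℤ => M.gr (n, s)) (C := fun x => M.pr p x = 0) hx
    (fun s x hx => M.pr_diff (fun h => hp (congrArg Prod.fst h)) hx) (map_zero _)
    (fun x y hx hy => by rw [map_add, hx, hy, add_zero])

theorem subsingleton_H_iff (M : DGMod A) (n : ℤ) :
    Subsingleton (M.H n) ↔ ∀ s, M.AcyclicAt (n, s) := by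
  have h : ∀ H : AddSubgroup (M.cocycles n), Subsingleton (M.cocycles n ⧸ H) ↔ H = ⊤ := fun H =>
    ⟨QuotientAddGroup.addSubgroup_eq_top_of_subsingleton H, by
      rintro rfl
      exact QuotientAddGroup.subsingleton_quotient_top⟩
  rw [h, AddSubgroup.addSubgroupOf_eq_top]
  clear h
  constructor
  · intro h s x hx hd
    obtain ⟨y, -, hy⟩ := h ⟨AddSubgroup.mem_iSup_of_mem s hx, hd⟩
    exact ⟨y, hy⟩
  · rintro h x ⟨hx, hd⟩
    obtain ⟨s, hs⟩ := M.exists_sum_pr x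
    rw [hs]
    refine sum_mem fun p _ => ?_
    by_cases hp : p.1 = n
    · subst hp
      obtain ⟨y, hy, hxy⟩ := (h p.2).exists_mem (M.pr_mem p x) (by
        have := M.pr_d (p.1 + 1, p.2) x
        rw [show M.d x = 0 from hd, map_zero] at this
        simpa using this.symm)
      exact ⟨y, AddSubgroup.mem_iSup_of_mem p.2 hy, hxy⟩
    · rw [pr_eq_zero_of_mem_deg hx hp]
      exact zero_mem _

/-! ### Reduction modulo the augmentation ideal -/

/-- The submodule `A⁺ M`. -/
abbrev aug (M : DGMod A) : Submodule A.carrier M.carrier := Submodule.span A.carrier M.augSet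

theorem smul_mem_aug (M : DGMod A) {p q : ℤ × ℤ} (hp : 0 < p.2) {a : A.carrier} (ha : a ∈ A.gr p)
    {x : M.carrier} (hx : x ∈ M.gr q) : a • x ∈ M.aug :=
  Submodule.subset_span ⟨p, q, a, x, hp, ha, hx, rfl⟩

theorem pr_mem_aug (M : DGMod A) (p : ℤ × ℤ) {x : M.carrier} (hx : x ∈ M.aug) :
    M.pr p x ∈ M.aug :=
  M.pr_mem_span _ (by
    rintro _ ⟨p, q, a, x, _, ha, hx, rfl⟩
    exact ⟨p + q, M.smul_mem p q a x ha hx⟩) p x hx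

theorem map_mem_aug {M N : DGMod A} (φ : M.carrier →+ N.carrier) (σ : A.carrier →+* A.carrier)
    (hσ : ∀ p, ∀ a ∈ A.gr p, σ a ∈ A.gr p) (h : ∀ a x, φ (a • x) = σ a • φ x)
    (hφ : ∀ p, ∀ x ∈ M.gr p, ∃ q, φ x ∈ N.gr q) {x : M.carrier} (hx : x ∈ M.aug) :
    φ x ∈ N.aug := by
  induction hx using Submodule.span_induction with
  | mem x hx =>
    obtain ⟨p, q, a, x, hp, ha, hx, rfl⟩ := hx
    obtain ⟨r, hr⟩ := hφ q x hx
    rw [h]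
    exact N.smul_mem_aug hp (hσ p a ha) hr
  | zero => simp
  | add x y _ _ hx hy =>
    rw [map_add]
    exact add_mem hx hy
  | smul a x _ hx =>
    rw [h]
    exact Submodule.smul_mem _ _ hx

theorem lin_mem_aug {M N : DGMod A} (f : M ⟶ N) {x : M.carrier} (hx : x ∈ M.aug) :
    f.lin x ∈ N.aug :=
  map_mem_aug f.lin.toAddMonoidHom (RingHom.id _) (fun _ _ h => h) f.lin.map_smul
    (fun p x hx => ⟨p, f.lin_mem p x hx⟩) hx

theorem htpy_mem_aug {M N : DGMod A} {f g : M ⟶ N} (H : Htpy f g) {x : M.carrier}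
    (hx : x ∈ M.aug) : H.h x ∈ N.aug :=
  map_mem_aug H.h (A.sgn 1) (fun _ _ h => A.sgn_mem 1 h) H.h_smul'
    (fun p x hx => ⟨_, H.h_mem p.1 p.2 x hx⟩) hx

theorem mem_aug_shift {M : DGMod A} {n : ℤ} {x : M.carrier} :
    (show (M.shift n).carrier from x) ∈ (M.shift n).aug ↔ x ∈ M.aug := by
  constructor
  · exact fun hx => map_mem_aug (M := M.shift n) (N := M) (AddMonoidHom.id M.carrier) (A.sgn n)
      (fun _ _ h => A.sgn_mem n h) (fun _ _ => rfl) (fun p x hx => ⟨_, hx⟩) hx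
  · refine fun hx => map_mem_aug (M := M) (N := M.shift n) (AddMonoidHom.id M.carrier)
      (A.sgn (-n)) (fun _ _ h => A.sgn_mem _ h) (fun a x => ?_) (fun p x hx => ?_) hx
    · exact congrArg (fun c : A.carrier => c • (show M.carrier from x)) (sgn_sgn_neg n a).symm
    · refine ⟨(p.1 - n, p.2), ?_⟩
      change x ∈ M.gr (p.1 - n + n, p.2)
      rwa [sub_add_cancel]

/-- The cohomology of `M ⊗_A ℚ` in bidegree `p` vanishes. -/
def RedAcyclicAt (M : DGMod A) (p : ℤ × ℤ) : Prop :=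
  ∀ x ∈ M.gr p, M.d x ∈ M.aug → ∃ y, x - M.d y ∈ M.aug

theorem RedAcyclicAt.exists_mem {M : DGMod A} {p : ℤ × ℤ} (h : M.RedAcyclicAt p) {x : M.carrier}
    (hx : x ∈ M.gr p) (hd : M.d x ∈ M.aug) : ∃ y ∈ M.gr (p.1 - 1, p.2), x - M.d y ∈ M.aug := by
  obtain ⟨y, hy⟩ := h x hx hd
  have := M.pr_mem_aug p hy
  rw [map_sub, M.pr_same hx, pr_d] at this
  exact ⟨_, M.pr_mem _ y, this⟩

theorem acyclicAt_red_iff (M : DGMod A) (p : ℤ × ℤ) : M.red.AcyclicAt p ↔ M.RedAcyclicAt p := by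
  constructor
  · intro h x hx hd
    obtain ⟨y, hy⟩ := h (M.aug.mkQ x) ⟨x, hx, rfl⟩ ((Submodule.Quotient.mk_eq_zero _).2 hd)
    obtain ⟨y, rfl⟩ := M.aug.mkQ_surjective y
    exact ⟨y, (Submodule.Quotient.eq _).1 hy.symm⟩
  · rintro h _ ⟨x, hx, rfl⟩ hd
    obtain ⟨y, hy⟩ := h x hx ((Submodule.Quotient.mk_eq_zero M.aug).1 hd)
    exact ⟨M.aug.mkQ y, ((Submodule.Quotient.eq _).2 hy).symm⟩

/-- Chain maps and homotopies preserve `A⁺M`, so they descend to reductions. Being a homotopy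
retract is enough. -/
theorem RedAcyclicAt.of_htpy {M N : DGMod A} {p : ℤ × ℤ} (hN : N.RedAcyclicAt p) (f : M ⟶ N)
    (g : N ⟶ M) (H : Htpy (f ≫ g) (𝟙 M)) : M.RedAcyclicAt p := fun x hx hd => by
  obtain ⟨y, hy⟩ := hN (f.lin x) (f.lin_mem p x hx) (by
    rw [← f.lin_d]
    exact lin_mem_aug f hd)
  refine ⟨g.lin y - H.h x, ?_⟩
  have h₁ := lin_mem_aug g hy
  have h₂ := htpy_mem_aug H hd
  have h₃ := H.comm x
  rw [comp_lin, id_lin, sub_eq_iff_eq_add] at h₃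
  rw [map_sub, h₃, g.lin_d] at h₁
  rw [map_sub]
  convert sub_mem h₁ h₂ using 1
  abel

/-- Reduction commutes with cones, membership in `A⁺` being componentwise; what remains is one piece
of the long exact sequence, done by hand modulo `A⁺`. -/
theorem RedAcyclicAt.cone {M N : DGMod A} {f : M ⟶ N} {p : ℤ × ℤ} (hN : N.RedAcyclicAt p)
    (hM : M.RedAcyclicAt (p.1 + 1, p.2)) : (cone f).RedAcyclicAt p := by
  have h_aug (x : N.carrier) (y : M.carrier) (hx : x ∈ N.aug) (hy : y ∈ M.aug) :
      (show (DGMod.cone f).carrier from (x, y)) ∈ (DGMod.cone f).aug := by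
    have h₁ := lin_mem_aug (coneInl f) hx
    have h₂ : coneInr f y ∈ (DGMod.cone f).aug :=
      map_mem_aug (M := M.shift 1) (coneInr f).toAddMonoidHom (RingHom.id _) (fun _ _ h => h)
        (coneInr f).map_smul (fun p x hx => ⟨p, zero_mem _, hx⟩) (mem_aug_shift.2 hy)
    convert add_mem h₁ h₂ using 1
    exact Prod.ext (add_zero x).symm (zero_add y).symm
  have h_fst {z : (DGMod.cone f).carrier} (hz : z ∈ (DGMod.cone f).aug) : z.1 ∈ N.aug :=
    map_mem_aug (M := DGMod.cone f) (AddMonoidHom.fst N.carrier M.carrier) (RingHom.id _)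
      (fun _ _ h => h) (fun _ _ => rfl) (fun p x hx => ⟨p, hx.1⟩) hz
  have h_snd {z : (DGMod.cone f).carrier} (hz : z ∈ (DGMod.cone f).aug) :
      (show M.carrier from z.2) ∈ M.aug :=
    mem_aug_shift.1 (map_mem_aug (M := DGMod.cone f) (N := M.shift 1)
      (AddMonoidHom.snd N.carrier M.carrier) (RingHom.id _)
      (fun _ _ h => h) (fun _ _ => rfl) (fun p x hx => ⟨p, hx.2⟩) hz)
  have key (x : N.carrier) (y : M.carrier) (hx : x ∈ N.gr p) (hy : y ∈ M.gr (p.1 + 1, p.2))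
      (h₁ : N.d x + f.lin y ∈ N.aug) (h₂ : -M.d y ∈ M.aug) :
      ∃ x' y', x - (N.d x' + f.lin y') ∈ N.aug ∧ y - -M.d y' ∈ M.aug := by
    -- Since `y ≡ d y'`, the element `x + f y'` is a cocycle modulo `A⁺N`. If `x'` is a primitive of
    -- it, then `(x', -y')` is one of `(x, y)`.
    obtain ⟨y', hy', h⟩ := hM.exists_mem hy (neg_mem_iff.1 h₂)
    have hy'' : y' ∈ M.gr p := by simpa using hy'
    obtain ⟨x', hx'⟩ := hN (x + f.lin y') (add_mem hx (f.lin_mem p y' hy'')) (by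
      have := lin_mem_aug f h
      rw [map_sub, f.lin_d] at this
      rw [map_add]
      convert sub_mem h₁ this using 1
      abel)
    refine ⟨x', -y', ?_, ?_⟩
    · convert hx' using 1
      rw [map_neg]
      abel
    · rwa [map_neg, neg_neg]
  rintro ⟨x, y⟩ ⟨hx, hy⟩ hd
  have hd' := cone_d f x y
  have h₁ := h_fst hd
  have h₂ := h_snd hd
  rw [hd'] at h₁ h₂
  obtain ⟨x', y', h₁, h₂⟩ := key x y hx hy h₁ h₂
  refine ⟨(show N.carrier × M.carrier from (x', y')), ?_⟩
  have := h_aug _ _ h₁ h₂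
  convert this using 1
  exact congrArg (fun z : N.carrier × M.carrier => (show N.carrier × M.carrier from (x, y)) - z)
    (cone_d f x' y')

theorem RedAcyclicAt.shift_iff {M : DGMod A} {n : ℤ} {p : ℤ × ℤ} :
    (M.shift n).RedAcyclicAt p ↔ M.RedAcyclicAt (p.1 + n, p.2) := by
  have key : ∀ e : ℤˣ, (∀ x ∈ M.gr (p.1 + n, p.2), e • M.d x ∈ M.aug →
      ∃ y, x - e • M.d y ∈ M.aug) ↔ M.RedAcyclicAt (p.1 + n, p.2) := fun e => by
    rcases Int.units_eq_one_or e with rfl | rfl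
    · simp [RedAcyclicAt]
    · simp only [Units.neg_smul, one_smul, neg_mem_iff]
      simp only [← map_neg M.d]
      exact forall₃_congr fun x _ _ =>
        ⟨fun ⟨y, hy⟩ => ⟨-y, hy⟩, fun ⟨y, hy⟩ => ⟨-y, by rwa [neg_neg]⟩⟩
  rw [← key n.negOnePow]
  exact forall₂_congr fun x _ => imp_congr mem_aug_shift
    (exists_congr fun y => mem_aug_shift (n := n))

/-- The reduction of a cell module vanishes in the bidegrees without cells. -/
theorem Cells.redAcyclicAt {M : DGMod A} {J : Type u} (c : Cells M J) {p : ℤ × ℤ}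
    (hp : ∀ j, c.deg j ≠ p) : M.RedAcyclicAt p := fun x hx _ => by
  refine ⟨0, ?_⟩
  rw [map_zero, sub_zero, ← c.b.linearCombination_repr x, Finsupp.linearCombination_apply]
  refine sum_mem fun j _ => ?_
  change c.b.repr x j • c.b j ∈ M.aug
  have h := c.repr_mem hx j
  -- Coefficients of negative weight are zero; those of weight `0` are zero because no cell lies in
  -- bidegree `p`, so their degree is nonzero; those of positive weight lie in `A⁺`.
  rcases lt_trichotomy (p - c.deg j).2 0 with h' | h' | h'
  · simp [AdamsCDGA.eq_zero_of_neg h' h]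
  · have h₀ : (p - c.deg j).1 ≠ 0 := fun h => hp j (sub_eq_zero.1 (Prod.ext h h')).symm
    rw [← Prod.mk.eta (p := p - c.deg j), h'] at h
    rw [AdamsCDGA.eq_zero_of_mem_gr_zero h₀ h, zero_smul]
    exact zero_mem _
  · exact M.smul_mem_aug h' h (c.mem j)

/-- All of `M` lives in weights `≥ n + 1`, and `A⁺` raises weights by at least one, so `A⁺M` lives
in weights `≥ n + 2`. This gap drives the Nakayama argument. -/
theorem Cells.eq_zero_of_mem_aug {M : DGMod A} {J : Type u} (c : Cells M J) {n : ℤ}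
    (hn : ∀ j, n < (c.deg j).2) {x : M.carrier} (hx : x ∈ M.aug) {p : ℤ × ℤ}
    (hp : p.2 ≤ n + 1) : M.pr p x = 0 := by
  induction hx using Submodule.span_induction generalizing p with
  | mem x hx =>
    obtain ⟨q, r, a, x, hq, ha, hx, rfl⟩ := hx
    by_cases h : p = q + r
    · rw [c.eq_zero_of_lt (fun j => ?_) hx, smul_zero, map_zero]
      have := hn j
      have : p.2 = q.2 + r.2 := by rw [h]; rfl
      lia
    · exact M.pr_diff h (M.smul_mem q r a x ha hx)
  | zero => simp
  | add x y _ _ hx hy => rw [map_add, hx hp, hy hp, add_zero]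
  | smul a x _ hx =>
    refine A.induction a (fun q a ha => ?_) (fun a b h h' => by
      rw [add_smul, map_add, h, h', add_zero])
    rw [M.pr_smul p q a ha]
    rcases lt_or_ge q.2 0 with h | h
    · rw [AdamsCDGA.eq_zero_of_neg h ha, zero_smul]
    · rw [hx (by change p.2 - q.2 ≤ _; lia), smul_zero]

end DGMod

open DGMod

/-! ### Reductions of objects of the derived category. -/

/-- The objects `X` such that the cohomology of `X ⊗_A ℚ` in bidegree `p` vanishes. -/
def redVanishAt (A : AdamsCDGA.{u}) (p : ℤ × ℤ) : ObjectProperty (DCat A) := fun X =>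
  ∃ (P : DGMod A) (J : Type u) (_ : Cells P J), P.RedAcyclicAt p ∧ Nonempty ((toD A).obj P ≅ X)

instance (p : ℤ × ℤ) : (redVanishAt A p).IsClosedUnderIsomorphisms where
  of_iso := by
    rintro X Y e ⟨P, J, c, hP, ⟨e'⟩⟩
    exact ⟨P, J, c, hP, ⟨e' ≪≫ e⟩⟩

/-- Independence of the cell replacement: by K-projectivity, cell modules isomorphic in `D_A` are
homotopy equivalent. -/
theorem DGMod.Cells.redVanishAt_iff {P : DGMod A} {J : Type u} (c : Cells P J) {X : DCat A}
    (e : (toD A).obj P ≅ X) (p : ℤ × ℤ) : redVanishAt A p X ↔ P.RedAcyclicAt p := by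
  refine ⟨?_, fun h => ⟨P, J, c, h, ⟨e⟩⟩⟩
  rintro ⟨Q, K, c', hQ, ⟨e'⟩⟩
  obtain ⟨f, hf⟩ := c.toD_map_surjective (e.hom ≫ e'.inv)
  obtain ⟨g, hg⟩ := c'.toD_map_surjective (e'.hom ≫ e.inv)
  obtain ⟨H⟩ := c.htpy_of_toD_map_eq (f := f ≫ g) (g := 𝟙 P) (by
    rw [Functor.map_comp, hf, hg, CategoryTheory.Functor.map_id]
    simp)
  exact hQ.of_htpy f g H

theorem redAcyclic_iff (I : Set ℤ) (X : DCat A) :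
    redAcyclic A I X ↔ ∀ n ∈ I, ∀ s, redVanishAt A (n, s) X := by
  constructor
  · rintro ⟨P, ⟨⟨J, ⟨c⟩⟩, ⟨e⟩⟩, h⟩ n hn s
    exact (c.toCells.redVanishAt_iff e _).2
      ((acyclicAt_red_iff _ _).1 ((subsingleton_H_iff _ _).1 (h n hn) s))
  · intro h
    obtain ⟨P, J, c, ⟨e⟩⟩ := exists_cells X
    exact ⟨P, ⟨c.isCell, ⟨e⟩⟩, fun n hn => (subsingleton_H_iff _ _).2 fun s =>
      (acyclicAt_red_iff _ _).2 ((c.redVanishAt_iff e _).1 (h n hn s))⟩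

theorem redVanishAt_shift_iff (X : DCat A) (n : ℤ) (p : ℤ × ℤ) :
    redVanishAt A p (X⟦n⟧) ↔ redVanishAt A (p.1 + n, p.2) X := by
  obtain ⟨P, J, c, ⟨e⟩⟩ := exists_cells X
  rw [c.redVanishAt_iff e, ← RedAcyclicAt.shift_iff]
  exact (c.shift n).redVanishAt_iff
    (((toD A).commShiftIso n).app P ≪≫ (shiftFunctor (DCat A) n).mapIso e) p

/-- Every triangle is represented by the cone of a map of cell modules, and that cone is a cell
module whose reduction is known. -/
theorem redVanishAt_obj₃ {T : Triangle (DCat A)} (hT : T ∈ distTriang (DCat A)) {p : ℤ × ℤ}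
    (h₂ : redVanishAt A p T.obj₂) (h₁ : redVanishAt A (p.1 + 1, p.2) T.obj₁) :
    redVanishAt A p T.obj₃ := by
  obtain ⟨P, J, c, hP, ⟨e⟩⟩ := h₁
  obtain ⟨Q, K, c', hQ, ⟨e'⟩⟩ := h₂
  obtain ⟨f, h⟩ := exists_cone_iso hT c e e'
  exact ⟨_, _, c.cone c' f, hQ.cone hP, h⟩

theorem redVanishAt_obj₂ {T : Triangle (DCat A)} (hT : T ∈ distTriang (DCat A)) {p : ℤ × ℤ}
    (h₁ : redVanishAt A p T.obj₁) (h₃ : redVanishAt A p T.obj₃) : redVanishAt A p T.obj₂ :=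
  redVanishAt_obj₃ (inv_rot_of_distTriang _ hT) h₁ ((redVanishAt_shift_iff _ _ _).2 (by
    simpa using h₃))

theorem redVanishAt_obj₁ {T : Triangle (DCat A)} (hT : T ∈ distTriang (DCat A)) {p : ℤ × ℤ}
    (h₂ : redVanishAt A p T.obj₂) (h₃ : redVanishAt A (p.1 - 1, p.2) T.obj₃) :
    redVanishAt A p T.obj₁ :=
  redVanishAt_obj₂ (inv_rot_of_distTriang _ hT) ((redVanishAt_shift_iff _ _ _).2 h₃) h₂

theorem redVanishAt_of_cellLE {X : DCat A} {n : ℤ} (hX : cellLE A n X) {p : ℤ × ℤ} (hp : n < p.1) :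
    redVanishAt A p X := by
  obtain ⟨P, J, c, hc, e⟩ := hX
  refine ⟨P, J, c, c.redAcyclicAt fun j h => ?_, e⟩
  have := hc j
  rw [h] at this
  lia

theorem redVanishAt_of_vanishAt {X : DCat A} {n : ℤ} (hX : ∀ p : ℤ × ℤ, p.2 ≤ n → vanishAt A p X)
    {p : ℤ × ℤ} (hp : p.2 ≤ n) : redVanishAt A p X := by
  obtain ⟨P, J, c, hc, e⟩ := exists_cells_of_vanishAt hX
  refine ⟨P, J, c, c.redAcyclicAt fun j h => ?_, e⟩
  have := hc j
  rw [h] at this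
  lia

/-- An object of bounded below weights vanishes if its reduction does. -/
theorem isZero_of_redVanishAt {X : DCat A} (hX : Dplusw A X) (h : ∀ p, redVanishAt A p X) :
    IsZero X := by
  obtain ⟨n, hn⟩ := (dplusw_iff X).1 hX
  -- The range of weights without cohomology is extended by one at each step, choosing each time a
  -- new replacement without cells in the weights already treated.
  have key (k : ℕ) : ∀ p : ℤ × ℤ, p.2 ≤ n + k → vanishAt A p X := by
    induction k with
    | zero => simpa using hn
    | succ k ih =>
      obtain ⟨P, J, c, hc, ⟨e⟩⟩ := exists_cells_of_vanishAt ih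
      refine fun p hp => (vanishAt A p).prop_of_iso e ((vanishAt_toD_iff _ _).2 fun x hx hd => ?_)
      obtain ⟨y, hy, hxy⟩ := ((c.redVanishAt_iff e p).1 (h p)).exists_mem hx (by
        rw [hd]
        exact zero_mem _)
      refine ⟨y, ?_⟩
      -- `x` is a boundary modulo `A⁺P`, but `A⁺P` is zero in the weight of `x`, so `x` is a
      -- boundary.
      have h₁ := c.eq_zero_of_mem_aug hc hxy (p := p) (by push_cast at hp; lia)
      have h₂ := P.d_mem _ _ _ hy
      rw [sub_add_cancel] at h₂
      rw [map_sub, P.pr_same hx, P.pr_same h₂, sub_eq_zero] at h₁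
      exact h₁.symm
  exact isZero_of_vanishAt fun p => key (p.2 - n).toNat p (by
    have := Int.self_le_toNat (p.2 - n)
    lia)

open DGMod

/-! ### Reductions of objects with vanishing cohomology in low degrees -/

theorem AdamsCDGA.d_algebraMap (q : ℚ) : A.d (algebraMap ℚ A.carrier q) = 0 := by
  rw [Algebra.algebraMap_eq_smul_one, map_smul, Semifree.d_one, smul_zero]

theorem sphereElt_eq_smul (p : ℤ × ℤ) (a : A.carrier) :
    sphereElt p a = a • sphereGen A p := by
  refine Eq.trans ?_ (Finsupp.smul_single a PUnit.unit (1 : A.carrier)).symm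
  rw [smul_eq_mul, mul_one]
  rfl

namespace DGMod

theorem semifreeD_zero {J : Type u} (x : J →₀ A.carrier) :
    semifreeD 0 x = x.mapRange A.d (map_zero _) := by
  induction x using Finsupp.induction_linear with
  | zero => simp
  | add x y hx hy => rw [map_add, hx, hy, Finsupp.mapRange_add (map_add A.d)]
  | single j a => simp [semifreeD_single]

/-- The `ℚ`-vector space structure on a dg module. -/
abbrev ratModule (M : DGMod A) : Module ℚ M.carrier :=
  Module.compHom M.carrier (algebraMap ℚ A.carrier)

/-- Cocycles of Adams degree `t` and degrees at least `n` whose classes form a basis of the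
corresponding part of the cohomology. -/
theorem exists_cohomology_basis (M : DGMod A) (n t : ℤ) :
    ∃ (J : Type u) (deg : J → ℤ) (v : J → M.carrier), (∀ j, n ≤ deg j) ∧
      (∀ j, v j ∈ M.gr (deg j, t)) ∧ (∀ j, M.d (v j) = 0) ∧
      (∀ (c : J →₀ ℚ) (w : M.carrier),
        M.d w = c.sum (fun j q => algebraMap ℚ A.carrier q • v j) → c = 0) ∧
      ∀ i, n ≤ i → ∀ x ∈ M.gr (i, t), M.d x = 0 → ∃ (c : J →₀ ℚ) (w : M.carrier),
        M.d w = x - c.sum (fun j q => algebraMap ℚ A.carrier q • v j) := by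
  let := M.ratModule
  let B : Submodule ℚ M.carrier := LinearMap.range M.d.toRatLinearMap
  let s : Set (M.carrier ⧸ B) :=
    {z | ∃ (i : ℤ) (x : M.carrier), n ≤ i ∧ x ∈ M.gr (i, t) ∧ M.d x = 0 ∧ B.mkQ x = z}
  -- The basis is extracted from the classes of bihomogeneous cocycles themselves, so each member
  -- has a representative in a single bidegree.
  obtain ⟨b, hbs, hspan, hli⟩ := exists_linearIndependent ℚ s
  choose deg v hdeg hv hd hvb using fun j : b => hbs j.2
  have hsum (c : b →₀ ℚ) : B.mkQ (c.sum fun j q => algebraMap ℚ A.carrier q • v j) =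
      Finsupp.linearCombination ℚ (Subtype.val : b → M.carrier ⧸ B) c := by
    rw [Finsupp.linearCombination_apply, Finsupp.sum, Finsupp.sum, map_sum]
    refine Finset.sum_congr rfl fun j _ => ?_
    rw [← hvb j]
    exact B.mkQ.map_smul (c j) (v j)
  refine ⟨b, deg, v, hdeg, hv, hd, fun c w hw => ?_, fun i hi x hx hdx => ?_⟩
  · have : Finsupp.linearCombination ℚ (Subtype.val : b → M.carrier ⧸ B) c = 0 := by
      rw [← hsum, ← hw]
      exact (Submodule.Quotient.mk_eq_zero B).2 ⟨w, rfl⟩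
    exact linearIndependent_iff.1 hli c this
  · have hx' : B.mkQ x ∈ Submodule.span ℚ b := by
      rw [hspan]
      exact Submodule.subset_span ⟨i, x, hi, hx, hdx, rfl⟩
    rw [← Subtype.range_coe (s := b), Finsupp.mem_span_range_iff_exists_finsupp] at hx'
    obtain ⟨c, hc⟩ := hx'
    obtain ⟨w, hw⟩ := (Submodule.Quotient.eq B).1 (show B.mkQ x = B.mkQ _ from
      hc.symm.trans (hsum c).symm)
    exact ⟨c, w, hw⟩

/-- The free module on a basis of a part of the cohomology of `M`. -/
theorem exists_free_cover {M : DGMod A} {n t : ℤ} (hM : ∀ i < n, M.AcyclicAt (i, t)) :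
    ∃ (J : Type u) (F : Semifree A J) (φ : F.mod ⟶ M), F.bd = 0 ∧
      (∀ j, n ≤ (F.deg j).1 ∧ (F.deg j).2 = t) ∧ ∀ i, (cone φ).AcyclicAt (i, t) := by
  obtain ⟨J, deg, v, hdeg, hv, hd, hli, hspan⟩ := M.exists_cohomology_basis n t
  let F : Semifree A J :=
    { deg := fun j => (deg j, t)
      bd := 0
      bd_mem := fun _ _ => zero_mem _
      bd_bd := fun _ => map_zero _ }
  have hFd (j) : F.mod.d (F.basis j) = 0 := F.d_basis j
  let φ : F.mod ⟶ M := homOfBasis F.basis F.basis_mem (F.basis.constr ℕ v)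
    (fun j => by rw [Module.Basis.constr_basis]; exact hv j)
    (fun j => by rw [Module.Basis.constr_basis, hd, hFd, map_zero])
  have hφ (j) : φ.lin (F.basis j) = v j := F.basis.constr_basis ℕ v j
  refine ⟨J, F, φ, rfl, fun j => ⟨hdeg j, rfl⟩, fun i => ?_⟩
  rw [acyclicAt_cone_iff]
  intro x hx y hy h₁ h₂
  -- All generators have weight `t`, so coefficients in weight `t` lie in `A(0) = ℚ`: there `F` is
  -- just a rational vector space with zero differential.
  have hy' : ∃ c : J →₀ ℚ, y = c.sum fun j q => algebraMap ℚ A.carrier q • F.basis j := by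
    let f : A.carrier → ℚ := Function.invFun (algebraMap ℚ A.carrier)
    have hf (q : ℚ) : f (algebraMap ℚ A.carrier q) = q :=
      Function.leftInverse_invFun (algebraMap ℚ A.carrier).injective q
    have hf₀ : f 0 = 0 := by rw [← map_zero (algebraMap ℚ A.carrier), hf]
    have hfy (j : J) : algebraMap ℚ A.carrier (f (F.basis.repr y j)) = F.basis.repr y j := by
      have h : F.basis.repr y j ∈ A.gr (i + 1 - deg j, t - t) := hy j
      rw [sub_self] at h
      by_cases hj : i + 1 - deg j = 0
      · rw [hj] at h
        obtain ⟨q, hq⟩ := AdamsCDGA.exists_eq_smul_one h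
        rw [hq, ← Algebra.algebraMap_eq_smul_one, hf]
      · rw [AdamsCDGA.eq_zero_of_mem_gr_zero hj h, hf₀, map_zero]
    refine ⟨(F.basis.repr y).mapRange f hf₀, ?_⟩
    rw [Finsupp.sum_mapRange_index (by simp)]
    refine ((Finset.sum_congr rfl fun j _ => ?_).trans (F.basis.linearCombination_repr y)).symm
    exact congrArg (· • F.basis j) (hfy j)
  obtain ⟨c, rfl⟩ := hy'
  -- The cocycle condition makes `φ y` a boundary, so independence of the chosen classes forces `y =
  -- 0`. This is injectivity of `φ` on cohomology in weight `t`.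
  have hc : c = 0 := hli c (-x) (by
    rw [map_neg, neg_eq_iff_add_eq_zero, ← h₁]
    simp only [Finsupp.sum, map_sum, map_smul, hφ])
  subst hc
  simp only [Finsupp.sum_zero_index, map_zero, add_zero] at h₁ ⊢
  -- Surjectivity on cohomology: for `i < n` there is none, and for `i ≥ n` the chosen classes span.
  rcases lt_or_ge i n with hi | hi
  · obtain ⟨x', hx'⟩ := hM i hi x hx h₁
    exact ⟨x', 0, by rw [hx', map_zero, add_zero], by simp⟩
  · obtain ⟨c, w, hw⟩ := hspan i hi x hx h₁
    refine ⟨w, c.sum fun j q => algebraMap ℚ A.carrier q • F.basis j, ?_, ?_⟩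
    · rw [hw]
      simp only [Finsupp.sum, map_sum, map_smul, hφ, sub_add_cancel]
    · simp [Finsupp.sum, map_sum, leibniz', hFd, AdamsCDGA.d_algebraMap]

/-- Without boundaries, `F` is a direct sum of spheres, and primitives are found coordinate by
coordinate. -/
theorem Semifree.acyclicAt {J : Type u} {F : Semifree A J} (hF : F.bd = 0) {q : ℤ × ℤ}
    (h : ∀ j, (sphere A (F.deg j)).AcyclicAt q) : F.mod.AcyclicAt q := by
  obtain ⟨deg, bd, bd_mem, bd_bd⟩ := F
  obtain rfl : bd = 0 := hF
  intro x hx hd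
  let F : Semifree A J := ⟨deg, 0, bd_mem, bd_bd⟩
  let ι (j : J) : sphere A (deg j) ⟶ F.mod := ofCocycle (F.basis_mem j) (F.d_basis j)
  have hι (j : J) (a : A.carrier) : (ι j).lin (sphereElt _ a) = a • F.basis j := by
    rw [sphereElt_eq_smul, map_smul]
    exact congrArg (a • ·) (ofCocycle_gen _ _)
  have hd' : ∀ j, A.d (F.basis.repr x j) = 0 := fun j => by
    have : F.basis.repr (F.mod.d x) = (F.basis.repr x).mapRange A.d (map_zero _) :=
      semifreeD_zero (J := J) x
    rw [← Finsupp.mapRange_apply (hf := map_zero A.d), ← this, hd, map_zero]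
    rfl
  have hy (j : J) : ∃ y, (sphere A (deg j)).d y = sphereElt _ (F.basis.repr x j) :=
    h j _ (sphereElt_mem_iff.2 (hx j)) (by rw [d_sphereElt, hd', map_zero])
  choose y hy using hy
  refine ⟨∑ j ∈ (F.basis.repr x).support, (ι j).lin (y j), ?_⟩
  refine Eq.trans ?_ (F.basis.linearCombination_repr x)
  refine (map_sum F.mod.d _ _).trans (Finset.sum_congr rfl fun j _ => ?_)
  exact ((ι j).lin_d _).symm.trans ((congrArg _ (hy j)).trans (hι j _))

end DGMod

/-- The cohomology of lowest weight is removed repeatedly by free modules on generators of degree `≥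
n`, which do not contribute to the reduction in degrees `< n`. Once nothing is left in weights `≤
p.2`, the reduction vanishes at `p`. -/
theorem AdamsCDGA.CohomologicallyConnected.redVanishAt_of_cohGE (hA : A.CohomologicallyConnected)
    {X : DCat A} {n : ℤ} (hX : Dplusw A X) (h : cohGE A n X) {p : ℤ × ℤ} (hp : p.1 < n) :
    redVanishAt A p X := by
  -- The induction is on the number of weights up to `p.2` in which cohomology may remain; `X`
  -- varies because it is replaced by a cone.
  have key (k : ℕ) : ∀ X, cohGE A n X → (∀ q : ℤ × ℤ, q.2 ≤ p.2 - k → vanishAt A q X) →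
      redVanishAt A p X := by
    induction k with
    | zero => exact fun X _ hX => redVanishAt_of_vanishAt hX (by simp)
    | succ k ih =>
      intro X hX₁ hX₂
      obtain ⟨M, ⟨e⟩⟩ := exists_toD_obj_iso X
      have hM₁ (q : ℤ × ℤ) (hq : q.1 < n) : M.AcyclicAt q :=
        (vanishAt_toD_iff _ _).1 ((vanishAt A q).prop_of_iso e.symm (hX₁ q hq))
      have hM₂ (q : ℤ × ℤ) (hq : q.2 ≤ p.2 - (k + 1 : ℕ)) : M.AcyclicAt q :=
        (vanishAt_toD_iff _ _).1 ((vanishAt A q).prop_of_iso e.symm (hX₂ q hq))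
      obtain ⟨J, F, φ, hF, hdeg, hφ⟩ := exists_free_cover (t := p.2 - k) fun i hi => hM₁ (i, _) hi
      obtain ⟨δ, hT⟩ := exists_cone_distinguished φ
      let c : Cells F.mod J := F.cells 0 (fun j i h => by simp [hF] at h)
      have hL : redVanishAt A p ((toD A).obj F.mod) :=
        ⟨_, _, c, c.redAcyclicAt fun j h => (hp.trans_le (hdeg j).1).ne' (congrArg Prod.fst h),
          ⟨Iso.refl _⟩⟩
      refine (redVanishAt A p).prop_of_iso e (redVanishAt_obj₂ hT hL (ih _ ?_ ?_))
      · intro q hq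
        obtain ⟨i, s⟩ := q
        by_cases hs : s = p.2 - k
        · subst hs
          exact (vanishAt_toD_iff _ _).2 (hφ i)
        -- Connectedness enters here. A class of the cone in degree `< n` could only come from the
        -- free module in degree `≤ n`, whose cohomology there lies entirely in weight `p.2 - k`,
        -- the weight already cleared.
        · refine vanishAt_obj₃ hT ((vanishAt_toD_iff _ _).2 (hM₁ _ hq))
            ((vanishAt_toD_iff _ _).2 (Semifree.acyclicAt hF fun j => hA.acyclicAt_sphere ?_))
          have := hdeg j
          dsimp at hq ⊢
          lia
      · rintro ⟨i, s⟩ hs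
        by_cases hs' : s = p.2 - k
        · subst hs'
          exact (vanishAt_toD_iff _ _).2 (hφ i)
        · dsimp at hs
          refine vanishAt_obj₃ hT ((vanishAt_toD_iff _ _).2 (hM₂ _ ?_))
            ((vanishAt_toD_iff _ _).2 (c.acyclicAt_of_lt fun j => ?_))
          · push_cast
            lia
          · have : (c.deg j).2 = p.2 - k := (hdeg j).2
            dsimp
            lia
  obtain ⟨m, hm⟩ := (dplusw_iff X).1 hX
  exact key (p.2 - m).toNat X h fun q hq => hm q (by
    have := Int.self_le_toNat (p.2 - m)
    lia)

/-! ### Comparison of the t-structures -/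

namespace AdamsCDGA.CohomologicallyConnected

variable (hA : A.CohomologicallyConnected)
include hA

/-- For the converse, the upper truncation has no reduction in degrees `≤ n` by connectedness and
none above `n` by the triangle, so it is zero by Nakayama. -/
theorem cellLE_iff {X : DCat A} (hX : Dplusw A X) (n : ℤ) :
    cellLE A n X ↔ ∀ p : ℤ × ℤ, n < p.1 → redVanishAt A p X := by
  refine ⟨fun h p hp => redVanishAt_of_cellLE h hp, fun h => ?_⟩
  obtain ⟨X', Y', f, g, k, hX', hY', -, hw, hT⟩ := exists_truncation hX n
  have hY : IsZero Y' := isZero_of_redVanishAt hw fun p => by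
    by_cases hp : p.1 < n + 1
    · exact hA.redVanishAt_of_cohGE hw hY' hp
    · exact redVanishAt_obj₃ hT (h p (by lia)) (redVanishAt_of_cellLE hX' (by dsimp; lia))
  have : IsIso f := (Triangle.isZero₃_iff_isIso₁ _ hT).1 hY
  exact (cellLE A n).prop_of_iso (asIso f) hX'

/-- Dual argument: truncating at `n - 1`, the reduction of the lower truncation vanishes in degrees
`≥ n` by its cells, and below `n` by the triangle. -/
theorem cohGE_iff {X : DCat A} (hX : Dplusw A X) (n : ℤ) :
    cohGE A n X ↔ ∀ p : ℤ × ℤ, p.1 < n → redVanishAt A p X := by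
  refine ⟨fun h p hp => hA.redVanishAt_of_cohGE hX h hp, fun h => ?_⟩
  obtain ⟨X', Y', f, g, k, hX', hY', hw, hw', hT⟩ := exists_truncation hX (n - 1)
  rw [sub_add_cancel] at hY'
  have hX : IsZero X' := isZero_of_redVanishAt hw fun p => by
    by_cases hp : n - 1 < p.1
    · exact redVanishAt_of_cellLE hX' hp
    · exact redVanishAt_obj₁ hT (h p (by lia))
        (hA.redVanishAt_of_cohGE hw' hY' (by dsimp; lia))
  have : IsIso g := (Triangle.isZero₁_iff_isIso₂ _ hT).1 hX
  exact (cohGE A n).prop_of_iso (asIso g).symm hY'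

theorem dLE_iff {X : DCat A} (hX : Dplusw A X) : DLE A X ↔ cellLE A 0 X := by
  rw [hA.cellLE_iff hX]
  exact ⟨fun h p hp => (redAcyclic_iff _ X).1 h.2 p.1 hp p.2,
    fun h => ⟨hX, (redAcyclic_iff _ X).2 fun n hn s => h (n, s) hn⟩⟩

theorem dGE_iff {X : DCat A} (hX : Dplusw A X) : DGE A X ↔ cohGE A 0 X := by
  rw [hA.cohGE_iff hX]
  exact ⟨fun h p hp => (redAcyclic_iff _ X).1 h.2 p.1 hp p.2,
    fun h => ⟨hX, (redAcyclic_iff _ X).2 fun n hn s => h (n, s) hn⟩⟩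

theorem heart_iff {X : DCat A} (hX : Dplusw A X) :
    heart A X ↔ cellLE A 0 X ∧ cohGE A 0 X := by
  rw [← hA.dLE_iff hX, ← hA.dGE_iff hX]
  constructor
  · rintro ⟨-, h⟩
    rw [redAcyclic_iff] at h
    exact ⟨⟨hX, (redAcyclic_iff _ X).2 fun n hn => h n (ne_of_gt hn)⟩,
      ⟨hX, (redAcyclic_iff _ X).2 fun n hn => h n (ne_of_lt hn)⟩⟩
  · rintro ⟨⟨-, h₁⟩, ⟨-, h₂⟩⟩
    rw [redAcyclic_iff] at h₁ h₂
    exact ⟨hX, (redAcyclic_iff _ X).2 fun n hn =>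
      (lt_or_gt_of_ne hn).elim (fun hn => h₂ n hn) (fun hn => h₁ n hn)⟩

/-- The t-structure induced on a triangulated subcategory of `D^{+w}_A`. -/
theorem exists_tStructure (P : ObjectProperty (DCat A)) [P.IsTriangulated]
    [P.HasInducedTStructure (tStr A)] (hP : P ≤ Dplusw A) :
    ∃ t : Triangulated.TStructure P.FullSubcategory, (∀ X, t.le 0 X ↔ DLE A X.obj) ∧
      (∀ X, t.ge 0 X ↔ DGE A X.obj) ∧ (∀ X, t.heart X ↔ heart A X.obj) ∧ IsNondegenerate t := by
  refine ⟨P.tStructure (tStr A), fun X => (hA.dLE_iff (hP _ X.property)).symm,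
    fun X => (hA.dGE_iff (hP _ X.property)).symm, fun X => (hA.heart_iff (hP _ X.property)).symm,
    fun X hX => ?_, fun X hX => ?_⟩
  -- To kill the reduction at `p`, a bound below both `p.1` and `1` is used; Nakayama then applies.
  · have h : IsZero X.obj := isZero_of_redVanishAt (hP _ X.property) fun p =>
      redVanishAt_of_cellLE (hX (min 0 (p.1 - 1)) (min_le_left _ _)) (by lia)
    exact h.of_full_of_faithful_of_isZero P.ι X
  -- On this side the cohomology itself vanishes in every bidegree, so Nakayama is not needed.
  · have h : IsZero X.obj := isZero_of_vanishAt fun p =>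
      hX (max 0 (p.1 + 1)) (le_max_left _ _) p (by lia)
    exact h.of_full_of_faithful_of_isZero P.ι X

end AdamsCDGA.CohomologicallyConnected

end AdamsDG

end

/-! ### The theorem, from the t-structure of `D_A` restricted to the two subcategories. -/

theorem mainTheorem8 (A : AdamsDG.AdamsCDGA.{u}) (hA : A.CohomologicallyConnected) :
    (∃ (_ : (AdamsDG.Dplusw A).IsTriangulated)
        (t : CategoryTheory.Triangulated.TStructure (AdamsDG.Dplusw A).FullSubcategory),
      (∀ X, t.le 0 X ↔ AdamsDG.DLE A X.obj) ∧
      (∀ X, t.ge 0 X ↔ AdamsDG.DGE A X.obj) ∧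
      (∀ X, t.heart X ↔ AdamsDG.heart A X.obj) ∧
      AdamsDG.IsNondegenerate t) ∧
    AdamsDG.Dfin A ≤ AdamsDG.Dplusw A ∧
    ∃ (_ : (AdamsDG.Dfin A).IsTriangulated)
        (t : CategoryTheory.Triangulated.TStructure (AdamsDG.Dfin A).FullSubcategory),
      (∀ X, t.le 0 X ↔ AdamsDG.DLE A X.obj) ∧
      (∀ X, t.ge 0 X ↔ AdamsDG.DGE A X.obj) ∧
      (∀ X, t.heart X ↔ AdamsDG.heart A X.obj) ∧
      AdamsDG.IsNondegenerate t := by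
  have := AdamsDG.isTriangulated_dplusw A
  have := AdamsDG.isTriangulated_dfin A
  have := AdamsDG.hasInducedTStructure_dplusw A
  have := AdamsDG.hasInducedTStructure_dfin hA
  exact ⟨⟨inferInstance, hA.exists_tStructure _ le_rfl⟩, AdamsDG.dfin_le_dplusw A,
    inferInstance, hA.exists_tStructure _ (AdamsDG.dfin_le_dplusw A)⟩
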